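/- Let $k$ be an algebraically closed field and let $X$ be a nonempty separated scheme of finite type over $k$ (for example an algebraic variety) with a $k$-Poisson structure $\Lambda_0$, i.e. a structure of sheaf of Poisson $k$-algebras on $\mathcal{O}_X$; regard $\Lambda_0$ as a section of $\mathscr{H}om_{\mathcal{O}_X}(\wedge^2\Omega^1_{X/k},\mathcal{O}_X)$. Let $HP^n(X,\Lambda_0)$ be the $n$-th hypercohomology of the truncated Lichnerowicz–Poisson complex of sheaves $$0\to \mathscr{H}om_{\mathcal{O}_X}(\Omega^1_{X/k},\mathcal{O}_X)\xrightarrow{[\Lambda_0,-]}\mathscr{H}om_{\mathcal{O}_X}(\wedge^2\Omega^1_{X/k},\mathcal{O}_X)\xrightarrow{[\Lambda_0,-]}\mathscr{H}om_{\mathcal{O}_X}(\wedge^3\Omega^1_{X/k},\mathcal{O}_X)\to\cdots,$$ where $[-,-]$ is the Schouten bracket and $\mathscr{H}om_{\mathcal{O}_X}(\wedge^n\Omega^1_{X/k},\mathcal{O}_X)$ is placed in degree $n$. A first-order Poisson deformation $\xi$ of $(X,\Lambda_0)$ is a flat surjective morphism $\mathcal{X}\to \operatorname{Spec} k[\epsilon]$,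 $\epsilon^2=0$, with a $k[\epsilon]$-Poisson structure $\Lambda$ on $\mathcal{X}$ and a cartesian square identifying $X$ with $\mathcal{X}\times_{\operatorname{Spec}k[\epsilon]}\operatorname{Spec}k$ in such a way that $\Lambda$ induces $\Lambda_0$. Two of them are isomorphic if there is a Poisson isomorphism of the total spaces over $\operatorname{Spec}k[\epsilon]$ inducing the identity on $X$. The trivial deformation is $X\times_k\operatorname{Spec}k[\epsilon]$ with the $k[\epsilon]$-bilinear extension of $\Lambda_0$. The underlying flat deformation is locally trivial if every point of $X$ has an open neighbourhood $U$ such that $\mathcal{X}|_U\cong U\times_k\operatorname{Spec}k[\epsilon]$ as deformations of the scheme $U$ (without Poisson structures). Then there is a bijection $$\kappa:\left\{\begin{array}{c}\text{isomorphism classes of first-order Poisson deformations of }(X,\Lambda_0)\\ \text{whose underlying flat deformation is locally trivial}\end{array}\right\}\longrightarrow HP^2(X,\Lambda_0)$$ such that $\kappa(\xi)=0$ if and only if $\xi$ is isomorphic to the trivial deformation. Moreover $\kappa$ is the Poisson Kodaira–Spencer map: every such $\xi$ has an open cover $\{U_i\}$ of $X$ with splittings $s_i:\mathcal{O}_X|_{U_i}\to\mathcal{O}_{\mathcal{X}}|_{U_i}$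 of sheaves of $k$-algebras, and sections $p_{ij}$ of $\mathscr{H}om_{\mathcal{O}_X}(\Omega^1_{X/k},\mathcal{O}_X)$ on $U_i\cap U_j$ and $\Lambda_i'$ of $\mathscr{H}om_{\mathcal{O}_X}(\wedge^2\Omega^1_{X/k},\mathcal{O}_X)$ on $U_i$, such that $$s_j(f)=s_i(f)+\epsilon\, s_i(p_{ij}(f)),\qquad \{s_i(f),s_i(g)\}=s_i(\{f,g\}_0)+\epsilon\, s_i(\Lambda_i'(f,g)),$$ where $\{-,-\}_0$ is the bracket of $\Lambda_0$; and for every choice of such data, $\kappa(\xi)$ is the class of the hyper-Čech cocycle $(\{p_{ij}\},\{\Lambda_i'\})$ (for which $p_{ij}+p_{jk}=p_{ik}$, $\Lambda_j'-\Lambda_i'=[\Lambda_0,p_{ij}]$ and $[\Lambda_0,\Lambda_i']=0$). If $X$ is moreover nonsingular (smooth over $k$), then $\kappa$ is a bijection from the set of isomorphism classes of all first-order Poisson deformations of $(X,\Lambda_0)$ to $HP^2(X,\Lambda_0)$, again with $\kappa(\xi)=0$ if and only if $\xi$ is isomorphic to the trivial deformation. -/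

import Mathlib

open CategoryTheory AlgebraicGeometry TopologicalSpace Opposite

universe u

namespace PoissonDeformation

/-- A Poisson bracket on a commutative ring. -/
structure PoissonBracket (A : Type*) [CommRing A] where
  br : A → A → A
  add_left : ∀ a b c, br (a + b) c = br a c + br b c
  add_right : ∀ a b c, br a (b + c) = br a b + br a c
  self : ∀ a, br a a = 0
  leibniz : ∀ a b c, br (a * b) c = a * br b c + b * br a c
  jacobi : ∀ a b c, br a (br b c) + br b (br c a) + br c (br a b) = 0

/-- `Q` is a skew-symmetric `n`-derivation of the `k`-algebra `A`: it is `k`-linear and a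
derivation in each argument, and alternating. -/
structure IsPolyDer (k : Type*) {A : Type*} [CommRing k] [CommRing A] [Algebra k A] {n : ℕ}
    (Q : (Fin n → A) → A) : Prop where
  add : ∀ v i a b, Q (Function.update v i (a + b)) =
    Q (Function.update v i a) + Q (Function.update v i b)
  smul : ∀ v i (c : k) a, Q (Function.update v i (c • a)) = c • Q (Function.update v i a)
  leibniz : ∀ v i a b, Q (Function.update v i (a * b)) =
    a * Q (Function.update v i b) + b * Q (Function.update v i a)
  alt : ∀ v i j, v i = v j → i ≠ j → Q v = 0

namespace PoissonBracket

variable {A : Type*} [CommRing A] (P : PoissonBracket A)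

/-- The sum `∑ᵢ (-1)ⁱ {vᵢ, Q(…v̂ᵢ…)} + ∑_{i<j} (-1)ⁱ⁺ʲ Q({vᵢ, vⱼ}, …v̂ᵢ…v̂ⱼ…)`, where in the second sum
the argument `{vᵢ, vⱼ}` has been moved to the place of `vⱼ`, which multiplies by `(-1)ʲ⁻¹`. -/
def ce {n : ℕ} (Q : (Fin n → A) → A) (v : Fin (n + 1) → A) : A :=
  ∑ i : Fin (n + 1), (-1) ^ (i : ℕ) * (P.br (v i) (Q (i.removeNth v)) -
    ∑ j ∈ Finset.Ioi i, Q (i.removeNth (Function.update v j (P.br (v i) (v j)))))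

/-- The Schouten bracket `[Λ, Q]`, where `Λ` is the biderivation of the Poisson bracket `P`. It is
`∑_{σ ∈ S_{n,1}} sgn σ {Q(v_{σ 0}, …, v_{σ(n-1)}), v_{σ n}}
  - (-1)ⁿ⁻¹ ∑_{σ ∈ S_{2,n-1}} sgn σ Q({v_{σ 0}, v_{σ 1}}, v_{σ 2}, …, v_{σ n})`
with `S_{p,q}` the `(p,q)`-shuffles. A shuffle in `S_{n,1}` is given by the index `i = σ n` and has
sign `(-1)ⁿ⁻ⁱ`, one in `S_{2,n-1}` by `i = σ 0 < j = σ 1` and has sign `(-1)ⁱ⁺ʲ⁻¹`. -/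
def schouten {n : ℕ} (Q : (Fin n → A) → A) (v : Fin (n + 1) → A) : A :=
  (-1) ^ (n + 1) * P.ce Q v

/-- Lie derivative along `{x, -}`. -/
def lie (x : A) {n : ℕ} (Q : (Fin n → A) → A) (v : Fin n → A) : A :=
  P.br x (Q v) - ∑ j, Q (Function.update v j (P.br x (v j)))

/-- Insertion of `x` as the first argument. -/
def ins (x : A) {n : ℕ} (Q : (Fin (n + 1) → A) → A) (v : Fin n → A) : A := Q (Fin.cons x v)

theorem skew (a b : A) : P.br a b = -P.br b a := by
  have h := P.self (a + b)
  rw [P.add_left, P.add_right, P.add_right, P.self, P.self] at h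
  linear_combination h

@[simp] theorem zero_left (a : A) : P.br 0 a = 0 := by
  have := P.add_left 0 0 a
  simpa using this

@[simp] theorem zero_right (a : A) : P.br a 0 = 0 := by
  have := P.add_right a 0 0
  simpa using this

theorem neg_right (a b : A) : P.br a (-b) = -P.br a b := by
  have := P.add_right a b (-b)
  simp at this
  linear_combination -this

theorem sub_right (a b c : A) : P.br a (b - c) = P.br a b - P.br a c := by
  rw [sub_eq_add_neg, P.add_right, P.neg_right, sub_eq_add_neg]

theorem leibniz_right (a b c : A) : P.br a (b * c) = b * P.br a c + c * P.br a b := by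
  rw [P.skew, P.leibniz, P.skew a b, P.skew a c]; ring

theorem sum_right {ι : Type*} (a : A) (s : Finset ι) (f : ι → A) :
    P.br a (∑ i ∈ s, f i) = ∑ i ∈ s, P.br a (f i) := by
  classical
  induction s using Finset.induction_on with
  | empty => simp
  | insert i s hi ih => rw [Finset.sum_insert hi, Finset.sum_insert hi, P.add_right, ih]

theorem jacobi' (a b c : A) : P.br a (P.br b c) = P.br (P.br a b) c + P.br b (P.br a c) := by
  have h := P.jacobi a b c
  rw [P.skew c a, P.neg_right, P.skew c (P.br a b)] at h
  linear_combination h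

theorem ce_zero (Q : (Fin 0 → A) → A) (x : A) (v : Fin 0 → A) :
    P.ce Q (Fin.cons x v) = P.lie x Q v := by
  simp [ce, lie]

theorem ce_cons {n : ℕ} (Q : (Fin (n + 1) → A) → A) (x : A) (v : Fin (n + 1) → A) :
    P.ce Q (Fin.cons x v) = P.lie x Q v - P.ce (ins x Q) v := by
  rw [ce, Fin.sum_univ_succ, lie, ce, sub_eq_add_neg (P.br x (Q v) - _),
    ← Finset.sum_neg_distrib]
  congr 1
  · rw [Fin.Ioi_zero_eq_map, Finset.sum_map]
    simp [← Fin.cons_update]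
  · refine Finset.sum_congr rfl fun i _ => ?_
    rw [Fin.Ioi_succ, Finset.sum_map]
    have h : ∀ (w : Fin (n + 1) → A), i.succ.removeNth (Fin.cons x w : Fin (n + 2) → A)
      = Fin.cons x (i.removeNth w) := by
      intro w
      ext j
      refine Fin.cases ?_ (fun j => ?_) j <;> simp [Fin.removeNth]
    simp [h, ← Fin.cons_update, ins, pow_succ]

theorem ce_sub {n : ℕ} (Q R : (Fin n → A) → A) :
    P.ce (fun v => Q v - R v) = fun v => P.ce Q v - P.ce R v := by
  ext v
  simp only [ce, P.sub_right]
  rw [← Finset.sum_sub_distrib]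
  refine Finset.sum_congr rfl fun i _ => ?_
  rw [Finset.sum_sub_distrib]
  ring

theorem ce_add {n : ℕ} (Q R : (Fin n → A) → A) :
    P.ce (fun v => Q v + R v) = fun v => P.ce Q v + P.ce R v := by
  ext v
  simp only [ce, P.add_right]
  rw [← Finset.sum_add_distrib]
  refine Finset.sum_congr rfl fun i _ => ?_
  rw [Finset.sum_add_distrib]
  ring

theorem lie_sub (x : A) {n : ℕ} (Q R : (Fin n → A) → A) :
    P.lie x (fun v => Q v - R v) = fun v => P.lie x Q v - P.lie x R v := by
  ext v
  simp only [lie, P.sub_right, Finset.sum_sub_distrib]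
  ring

section

variable {k : Type*} [CommRing k] [Algebra k A]

theorem _root_.PoissonDeformation.IsPolyDer.sub {n : ℕ} {Q R : (Fin n → A) → A}
    (hQ : IsPolyDer k Q) (hR : IsPolyDer k R) : IsPolyDer k (fun v => Q v - R v) where
  add v i a b := by simp only [hQ.add, hR.add]; ring
  smul v i c a := by simp only [hQ.smul, hR.smul, smul_sub]
  leibniz v i a b := by simp only [hQ.leibniz, hR.leibniz]; ring
  alt v i j h hij := by simp only [hQ.alt v i j h hij, hR.alt v i j h hij, sub_zero]

theorem _root_.PoissonDeformation.IsPolyDer.ins {n : ℕ} {Q : (Fin (n + 1) → A) → A}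
    (hQ : IsPolyDer k Q) (x : A) : IsPolyDer k (ins x Q) where
  add v i a b := by simp only [PoissonBracket.ins, Fin.cons_update, hQ.add]
  smul v i c a := by simp only [PoissonBracket.ins, Fin.cons_update, hQ.smul]
  leibniz v i a b := by simp only [PoissonBracket.ins, Fin.cons_update, hQ.leibniz]
  alt v i j h hij := hQ.alt _ i.succ j.succ (by simpa using h) (by simpa using hij)

/-- A skew-symmetric polyderivation as an alternating map. -/
def _root_.PoissonDeformation.IsPolyDer.toAlt {n : ℕ} {Q : (Fin n → A) → A}
    (hQ : IsPolyDer k Q) : A [⋀^Fin n]→ₗ[k] A where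
  toFun := Q
  map_update_add' v i a b := by convert hQ.add v i a b
  map_update_smul' v i a b := by convert hQ.smul v i a b
  map_eq_zero_of_eq' v i j h hij := hQ.alt v i j h hij

theorem _root_.PoissonDeformation.IsPolyDer.swap {n : ℕ} {Q : (Fin n → A) → A}
    (hQ : IsPolyDer k Q) (v : Fin n → A) {i j : Fin n} (h : i ≠ j) :
    Q (v ∘ Equiv.swap i j) = - Q v := hQ.toAlt.map_swap v h

theorem ins_add {n : ℕ} {Q : (Fin (n + 1) → A) → A} (hQ : IsPolyDer k Q) (x y : A) :
    ins (x + y) Q = fun v => ins x Q v + ins y Q v := by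
  ext v
  have := hQ.add (Fin.cons x v) 0 x y
  simpa only [ins, Fin.update_cons_zero] using this

theorem ins_smul {n : ℕ} {Q : (Fin (n + 1) → A) → A} (hQ : IsPolyDer k Q) (c : k) (x : A) :
    ins (c • x) Q = fun v => c • ins x Q v := by
  ext v
  have := hQ.smul (Fin.cons x v) 0 c x
  simpa only [ins, Fin.update_cons_zero] using this

theorem ins_lie {n : ℕ} (Q : (Fin (n + 1) → A) → A) (x y : A) :
    ins y (P.lie x Q) = fun v => P.lie x (ins y Q) v - ins (P.br x y) Q v := by
  ext v
  simp [ins, lie, Fin.sum_univ_succ, Fin.cons_update]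
  ring

theorem lie_lie : ∀ {n : ℕ} {Q : (Fin n → A) → A} (_ : IsPolyDer k Q) (x y : A) (v : Fin n → A),
    P.lie x (P.lie y Q) v = P.lie y (P.lie x Q) v + P.lie (P.br x y) Q v
  | 0, Q, _, x, y, v => by
    simp only [lie, Finset.univ_eq_empty, Finset.sum_empty, sub_zero]
    rw [P.jacobi' x y]; ring
  | n + 1, Q, hQ, x, y, v => by
    obtain ⟨z, v, rfl⟩ : ∃ z w, v = Fin.cons z w := ⟨v 0, Fin.tail v, (Fin.cons_self_tail v).symm⟩
    have h0 : ∀ a (R : (Fin (n + 1) → A) → A), P.lie a R (Fin.cons z v) =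
        P.lie a (ins z R) v - ins (P.br a z) R v := fun a R => congrFun (P.ins_lie R a z) v
    have h1 := h0 x (P.lie y Q)
    have h2 := h0 y (P.lie x Q)
    have h3 := h0 (P.br x y) Q
    simp only [P.ins_lie, P.lie_sub] at h1 h2 h3
    rw [h1, h2, h3, lie_lie (hQ.ins z), P.jacobi' x y z, ins_add hQ]
    ring

theorem _root_.PoissonDeformation.IsPolyDer.lie {n : ℕ} {Q : (Fin n → A) → A}
    (hP : ∀ (c : k) (a : A), P.br (algebraMap k A c) a = 0)
    (hQ : IsPolyDer k Q) (x : A) : IsPolyDer k (P.lie x Q) := by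
  have hs : ∀ (c : k) a, P.br x (c • a) = c • P.br x a := by
    intro c a
    rw [Algebra.smul_def, P.leibniz_right, P.skew x (algebraMap k A c), hP, Algebra.smul_def]; ring
  have key : ∀ (v : Fin n → A) (i : Fin n) (a : A), P.lie x Q (Function.update v i a) =
      P.br x (Q (Function.update v i a)) - Q (Function.update v i (P.br x a)) -
        ∑ j ∈ Finset.univ.erase i,
          Q (Function.update (Function.update v j (P.br x (v j))) i a) := by
    intro v i a
    rw [PoissonBracket.lie, ← Finset.add_sum_erase _ _ (Finset.mem_univ i), ← sub_sub]
    congr 1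
    · simp
    · refine Finset.sum_congr rfl fun j hj => ?_
      have hj : j ≠ i := Finset.ne_of_mem_erase hj
      rw [Function.update_of_ne hj, Function.update_comm hj]
  constructor
  · intro v i a b
    simp only [key, P.add_right, hQ.add, Finset.sum_add_distrib]
    ring
  · intro v i c a
    simp only [key, hs, hQ.smul, smul_sub, Finset.smul_sum]
  · intro v i a b
    simp only [key, P.add_right, hQ.add, Finset.sum_add_distrib, hQ.leibniz, P.leibniz_right,
      mul_sub, Finset.mul_sum]
    ring
  · intro v i j h hij
    rw [PoissonBracket.lie, hQ.alt v i j h hij, P.zero_right, zero_sub, neg_eq_zero]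
    rw [← Finset.add_sum_erase _ _ (Finset.mem_univ i),
      ← Finset.add_sum_erase _ _ (show j ∈ Finset.univ.erase i by simp [hij.symm]),
      Finset.sum_eq_zero, add_zero]
    · have e : Function.update v i (P.br x (v i)) ∘ Equiv.swap i j =
          Function.update v j (P.br x (v j)) := by
        ext l
        rcases eq_or_ne l i with rfl | hi
        · simp [hij, hij.symm, h]
        · rcases eq_or_ne l j with rfl | hj
          · simp [h]
          · simp [Equiv.swap_apply_of_ne_of_ne hi hj, hi, hj]
      rw [← e, hQ.swap _ hij, add_neg_cancel]
    · intro l hl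
      simp only [Finset.mem_erase, Finset.mem_univ, and_true] at hl
      refine hQ.alt _ i j ?_ hij
      rw [Function.update_of_ne hl.2.symm, Function.update_of_ne hl.1.symm, h]

theorem lie_ce : ∀ {n : ℕ} {Q : (Fin n → A) → A} (_ : IsPolyDer k Q) (x : A)
    (v : Fin (n + 1) → A), P.lie x (P.ce Q) v = P.ce (P.lie x Q) v
  | n, Q, hQ, x, v => by
    obtain ⟨y, v, rfl⟩ : ∃ z w, v = Fin.cons z w := ⟨v 0, Fin.tail v, (Fin.cons_self_tail v).symm⟩
    have h1 := congrFun (P.ins_lie (P.ce Q) x y) v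
    change P.lie x (P.ce Q) (Fin.cons y v) = P.lie x (ins y (P.ce Q)) v -
      P.ce Q (Fin.cons (P.br x y) v) at h1
    rw [h1]
    match n, Q, hQ, v with
    | 0, Q, hQ, v =>
      have h2 : ins y (P.ce Q) = P.lie y Q := funext fun w => P.ce_zero Q y w
      rw [h2, P.ce_zero, P.ce_zero, P.lie_lie hQ]; ring
    | n + 1, Q, hQ, v =>
      have h2 : ins y (P.ce Q) = fun w => P.lie y Q w - P.ce (ins y Q) w :=
        funext fun w => P.ce_cons Q y w
      rw [h2, P.lie_sub, P.ce_cons, P.ce_cons, P.ins_lie, P.ce_sub]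
      beta_reduce
      rw [P.lie_lie hQ x y, lie_ce (hQ.ins y)]
      ring

theorem ce_ce : ∀ {n : ℕ} {Q : (Fin n → A) → A} (_ : IsPolyDer k Q) (v : Fin (n + 2) → A),
    P.ce (P.ce Q) v = 0
  | n, Q, hQ, v => by
    obtain ⟨y, v, rfl⟩ : ∃ z w, v = Fin.cons z w := ⟨v 0, Fin.tail v, (Fin.cons_self_tail v).symm⟩
    rw [P.ce_cons]
    match n, Q, hQ, v with
    | 0, Q, hQ, v =>
      have h2 : ins y (P.ce Q) = P.lie y Q := funext fun w => P.ce_zero Q y w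
      rw [h2, P.lie_ce hQ, sub_self]
    | n + 1, Q, hQ, v =>
      have h2 : ins y (P.ce Q) = fun w => P.lie y Q w - P.ce (ins y Q) w :=
        funext fun w => P.ce_cons Q y w
      rw [h2, P.ce_sub, P.lie_ce hQ]
      beta_reduce
      rw [ce_ce (hQ.ins y)]
      ring

theorem ce_smul (hP : ∀ (c : k) (a : A), P.br (algebraMap k A c) a = 0) (c : k) {n : ℕ}
    (Q : (Fin n → A) → A) : P.ce (fun v => c • Q v) = fun v => c • P.ce Q v := by
  have hs : ∀ x a, P.br x (c • a) = c • P.br x a := by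
    intro x a
    rw [Algebra.smul_def, P.leibniz_right, P.skew x (algebraMap k A c), hP, Algebra.smul_def]; ring
  ext v
  simp only [ce, hs, ← Finset.smul_sum, ← smul_sub, mul_smul_comm]

/-- Antisymmetric functions that are polyderivations in all arguments but the first. -/
theorem isPolyDer_of_tail {n : ℕ} {D : (Fin (n + 2) → A) → A}
    (h : ∀ x, IsPolyDer k (ins x D)) (h0 : ∀ x v, D (Fin.cons x (Fin.cons x v)) = 0)
    (hadd : ∀ x y v, D (Fin.cons (x + y) v) = D (Fin.cons x v) + D (Fin.cons y v)) :
    IsPolyDer k D := by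
  have hsucc : ∀ (v : Fin (n + 2) → A) (i : Fin (n + 1)), D v = ins (v 0) D (Fin.tail v) := by
    intro v i
    rw [ins, Fin.cons_self_tail]
  have halt0 : ∀ (v : Fin (n + 2) → A) (j : Fin (n + 1)), v 0 = v j.succ → D v = 0 := by
    intro v j hj
    have key : ∀ w : Fin (n + 1) → A, v 0 = w 0 → ins (v 0) D w = 0 := by
      intro w hw
      rw [ins, ← Fin.cons_self_tail w, ← hw, h0]
    rw [hsucc v j]
    rcases eq_or_ne 0 j with rfl | hj0
    · exact key _ hj
    · have := (h (v 0)).swap (Fin.tail v) hj0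
      rw [key _ (by simpa [Fin.tail] using hj)] at this
      exact neg_eq_zero.mp this.symm
  have hswap : ∀ x y v, D (Fin.cons x (Fin.cons y v)) = - D (Fin.cons y (Fin.cons x v)) := by
    intro x y v
    have e := h0 (x + y) v
    have ha : ∀ z, D (Fin.cons z (Fin.cons (x + y) v)) =
        D (Fin.cons z (Fin.cons x v)) + D (Fin.cons z (Fin.cons y v)) := by
      intro z
      have := (h z).add (Fin.cons x v) 0 x y
      simpa only [ins, Fin.update_cons_zero] using this
    rw [hadd, ha, ha, h0, h0] at e
    linear_combination e
  have hup0 : ∀ (v : Fin (n + 2) → A) a, D (Function.update v 0 a) =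
      - ins (v 1) D (Function.update (Fin.tail v) 0 a) := by
    intro v a
    obtain ⟨x, v, rfl⟩ : ∃ z w, v = Fin.cons z w := ⟨v 0, Fin.tail v, (Fin.cons_self_tail v).symm⟩
    obtain ⟨y, v, rfl⟩ : ∃ z w, v = Fin.cons z w := ⟨v 0, Fin.tail v, (Fin.cons_self_tail v).symm⟩
    rw [Fin.update_cons_zero, hswap, Fin.tail_cons, Fin.update_cons_zero]
    rfl
  have hup : ∀ (v : Fin (n + 2) → A) (i : Fin (n + 1)) a, D (Function.update v i.succ a) =
      ins (v 0) D (Function.update (Fin.tail v) i a) := by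
    intro v i a
    rw [ins, Fin.cons_update, Fin.cons_self_tail]
  constructor
  · intro v i a b
    refine Fin.cases ?_ (fun i => ?_) i
    · simp only [hup0, (h _).add]; ring
    · simp only [hup, (h _).add]
  · intro v i c a
    refine Fin.cases ?_ (fun i => ?_) i
    · simp only [hup0, (h _).smul, smul_neg]
    · simp only [hup, (h _).smul]
  · intro v i a b
    refine Fin.cases ?_ (fun i => ?_) i
    · simp only [hup0, (h _).leibniz]; ring
    · simp only [hup, (h _).leibniz]
  · intro v i j
    refine Fin.cases ?_ (fun i => ?_) i <;> refine Fin.cases ?_ (fun j => ?_) j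
    · intro _ h; exact absurd rfl h
    · intro hv _; exact halt0 v j hv
    · intro hv _; exact halt0 v i hv.symm
    · intro hv hij
      rw [hsucc v i]
      exact (h _).alt _ i j hv (by simpa using hij)

theorem lie_add_left {n : ℕ} {Q : (Fin n → A) → A} (hQ : IsPolyDer k Q) (x y : A) :
    P.lie (x + y) Q = fun v => P.lie x Q v + P.lie y Q v := by
  ext v
  simp only [lie, P.add_left, hQ.add, Finset.sum_add_distrib]
  ring

theorem _root_.PoissonDeformation.IsPolyDer.ce
    (hP : ∀ (c : k) (a : A), P.br (algebraMap k A c) a = 0) :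
    ∀ {n : ℕ} {Q : (Fin n → A) → A} (_ : IsPolyDer k Q), IsPolyDer k (P.ce Q)
  | 0, Q, hQ => by
    have key : ∀ v : Fin 1 → A, P.ce Q v = P.br (v 0) (Q Fin.elim0) := by
      intro v
      obtain ⟨x, w, rfl⟩ : ∃ z w, v = Fin.cons z w :=
        ⟨v 0, Fin.tail v, (Fin.cons_self_tail v).symm⟩
      rw [P.ce_zero, Subsingleton.elim w Fin.elim0]
      simp [PoissonBracket.lie]
    constructor
    · intro v i a b
      rw [Fin.fin_one_eq_zero i]
      simp [key, P.add_left]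
    · intro v i c a
      rw [Fin.fin_one_eq_zero i]
      simp [key, Algebra.smul_def, P.leibniz, hP]
    · intro v i a b
      rw [Fin.fin_one_eq_zero i]
      simp [key, P.leibniz]
    · intro v i j _ hij
      exact absurd ((Fin.fin_one_eq_zero i).trans (Fin.fin_one_eq_zero j).symm) hij
  | n + 1, Q, hQ => by
    have h2 : ∀ y, ins y (P.ce Q) = fun w => P.lie y Q w - P.ce (PoissonBracket.ins y Q) w :=
      fun y => funext fun w => P.ce_cons Q y w
    refine isPolyDer_of_tail (fun x => ?_) (fun x v => ?_) (fun x y v => ?_)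
    · rw [h2]
      exact (hQ.lie P hP x).sub (IsPolyDer.ce hP (hQ.ins x))
    · have h1 := congrFun (P.ins_lie Q x x) v
      rw [P.self] at h1
      have h0 : PoissonBracket.ins 0 Q v = 0 := by
        have := ins_smul hQ (0 : k) 0
        simpa using congrFun this v
      change P.lie x Q (Fin.cons x v) = _ at h1
      rw [P.ce_cons, h1, h0, sub_zero]
      match n, Q, hQ, v with
      | 0, Q, hQ, v => rw [P.ce_zero, sub_self]
      | n + 1, Q, hQ, v =>
        have : PoissonBracket.ins x (PoissonBracket.ins x Q) = fun w => 0 - 0 := by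
          ext w
          rw [sub_zero]
          exact hQ.alt _ 0 1 rfl (by simp)
        rw [P.ce_cons, this, P.ce_sub]
        ring
    · rw [P.ce_cons, P.ce_cons, P.ce_cons, P.lie_add_left hQ, ins_add hQ, P.ce_add]
      ring

theorem schouten_schouten {n : ℕ} {Q : (Fin n → A) → A} (hQ : IsPolyDer k Q)
    (v : Fin (n + 2) → A) : P.schouten (P.schouten Q) v = 0 := by
  have h : ∀ (m : ℕ), P.ce (fun v => (-1) ^ m * P.ce Q v) = fun v => (-1) ^ m * P.ce (P.ce Q) v := by
    intro m
    rcases neg_one_pow_eq_or A m with e | e <;> rw [e]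
    · simp
    · have := P.ce_sub (fun _ => 0) (P.ce Q)
      have h0 := P.ce_sub (P.ce Q) (P.ce Q)
      simp only [sub_self] at h0
      simpa [h0] using this
  unfold schouten
  rw [h]
  simp [P.ce_ce hQ]

theorem schouten_add {n : ℕ} (Q R : (Fin n → A) → A) :
    P.schouten (Q + R) = P.schouten Q + P.schouten R := by
  ext v
  have := congrFun (P.ce_add Q R) v
  simp only [schouten, Pi.add_apply, ← mul_add]
  exact congrArg _ this

theorem schouten_smul (hP : ∀ (c : k) (a : A), P.br (algebraMap k A c) a = 0) (c : k) {n : ℕ}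
    (Q : (Fin n → A) → A) : P.schouten (c • Q) = c • P.schouten Q := by
  ext v
  have := congrFun (P.ce_smul hP c Q) v
  simp only [schouten, Pi.smul_apply, ← mul_smul_comm]
  exact congrArg _ this

theorem _root_.PoissonDeformation.IsPolyDer.schouten {n : ℕ} {Q : (Fin n → A) → A}
    (hQ : IsPolyDer k Q) (hP : ∀ (c : k) (a : A), P.br (algebraMap k A c) a = 0) :
    IsPolyDer k (P.schouten Q) := by
  have h := hQ.ce P hP
  unfold PoissonBracket.schouten
  constructor
  · intro v i a b
    rw [h.add, mul_add]
  · intro v i c a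
    rw [h.smul, mul_smul_comm]
  · intro v i a b
    rw [h.leibniz]; ring
  · intro v i j hv hij
    rw [h.alt v i j hv hij, mul_zero]

end

end PoissonBracket

section Schemes

variable {X S : Scheme.{u}}

/-- Restriction of sections. -/
abbrev res (X : Scheme.{u}) {U V : X.Opens} (h : V ≤ U) : Γ(X, U) →+* Γ(X, V) :=
  (X.presheaf.map (homOfLE h).op).hom

theorem res_self (U : X.Opens) (h : U ≤ U) (a : Γ(X, U)) : res X h a = a := by
  simp [res]

theorem res_res {U V W : X.Opens} (h : V ≤ U) (h' : W ≤ V) (a : Γ(X, U)) :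
    res X h' (res X h a) = res X (h'.trans h) a := by
  have : (homOfLE (h'.trans h)).op = (homOfLE h).op ≫ (homOfLE h').op := rfl
  simp [res, this]

/-- A Poisson structure on the `S`-scheme `f : X ⟶ S`: a Poisson bracket on the sheaf `𝒪_X`
for which all functions coming from `S` are central. -/
structure PoissonStructure (f : X ⟶ S) where
  bracket : ∀ U : X.Opens, PoissonBracket Γ(X, U)
  res_br : ∀ (U V : X.Opens) (h : V ≤ U) (a b : Γ(X, U)),
    res X h ((bracket U).br a b) = (bracket V).br (res X h a) (res X h b)
  base_br : ∀ (V : S.Opens) (U : X.Opens) (h : U ≤ f ⁻¹ᵁ V) (s : Γ(S, V)) (a : Γ(X, U)),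
    (bracket U).br (f.appLE V U h s) a = 0

/-- `φ : X ⟶ Y` is a Poisson morphism. -/
def IsPoissonHom {X Y S T : Scheme.{u}} {f : X ⟶ S} {g : Y ⟶ T} (P : PoissonStructure f)
    (Q : PoissonStructure g) (φ : X ⟶ Y) : Prop :=
  ∀ (U : Y.Opens) (a b : Γ(Y, U)),
    φ.app U ((Q.bracket U).br a b) = (P.bracket (φ ⁻¹ᵁ U)).br (φ.app U a) (φ.app U b)

end Schemes

section Sheaves

variable (k : Type u) [Field k] (X : Scheme.{u}) [X.Over (Spec (.of k))]

/-- The `k`-algebra structure on the sections of a `k`-scheme. -/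
noncomputable instance sectionsAlgebra (U : X.Opens) : Algebra k Γ(X, U) :=
  (((X ↘ Spec (.of k)).appLE ⊤ U le_top).hom.comp (Scheme.ΓSpecIso (.of k)).inv.hom).toAlgebra

theorem res_algebraMap {U V : X.Opens} (h : V ≤ U) (c : k) :
    res X h (algebraMap k Γ(X, U) c) = algebraMap k Γ(X, V) c := by
  have := (X ↘ Spec (.of k)).appLE_map (U := ⊤) (V := U) le_top (homOfLE h).op
  change (X.presheaf.map (homOfLE h).op) ((X ↘ Spec (.of k)).appLE ⊤ U le_top _) = _
  rw [← CommRingCat.comp_apply, this]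
  rfl

theorem res_smul {U V : X.Opens} (h : V ≤ U) (c : k) (a : Γ(X, U)) :
    res X h (c • a) = c • res X h a := by
  rw [Algebra.smul_def, Algebra.smul_def, map_mul, res_algebraMap]

/-- Sections over `U` of the sheaf `ℋom(⋀ⁿ Ω_{X/k}, 𝒪_X)`: families of skew-symmetric
`n`-derivations of the `k`-algebras `𝒪_X(W)`, `W ⊆ U` open, compatible with restriction. -/
def polyDer (n : ℕ) (U : X.Opens) :
    Submodule k (∀ W : {W : X.Opens // W ≤ U}, (Fin n → Γ(X, W.1)) → Γ(X, W.1)) where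
  carrier := {D | (∀ W, IsPolyDer k (D W)) ∧
    ∀ (W W' : {W : X.Opens // W ≤ U}) (h : W'.1 ≤ W.1) (v : Fin n → Γ(X, W.1)),
      res X h (D W v) = D W' fun i => res X h (v i)}
  add_mem' {D E} hD hE := by
    refine ⟨fun W => ⟨?_, ?_, ?_, ?_⟩, fun W W' h v => ?_⟩
    · intro v i a b
      simp only [Pi.add_apply, (hD.1 W).add, (hE.1 W).add]; ring
    · intro v i c a
      simp only [Pi.add_apply, (hD.1 W).smul, (hE.1 W).smul, smul_add]
    · intro v i a b
      simp only [Pi.add_apply, (hD.1 W).leibniz, (hE.1 W).leibniz]; ring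
    · intro v i j h hij
      simp only [Pi.add_apply, (hD.1 W).alt v i j h hij, (hE.1 W).alt v i j h hij, add_zero]
    · simp only [Pi.add_apply, map_add, hD.2 W W' h, hE.2 W W' h]
  zero_mem' := by
    refine ⟨fun W => ⟨?_, ?_, ?_, ?_⟩, fun W W' h v => ?_⟩ <;> intros <;> simp
  smul_mem' c D hD := by
    refine ⟨fun W => ⟨?_, ?_, ?_, ?_⟩, fun W W' h v => ?_⟩
    · intro v i a b
      simp only [Pi.smul_apply, (hD.1 W).add, smul_add]
    · intro v i c' a
      simp only [Pi.smul_apply, (hD.1 W).smul, smul_comm c c']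
    · intro v i a b
      simp only [Pi.smul_apply, (hD.1 W).leibniz, smul_add, mul_smul_comm]
    · intro v i j h hij
      simp only [Pi.smul_apply, (hD.1 W).alt v i j h hij, smul_zero]
    · simp only [Pi.smul_apply, res_smul, hD.2 W W' h]

/-- The presheaf `ℋom(⋀ⁿ Ω_{X/k}, 𝒪_X)`. -/
noncomputable def polyDerPresheaf (n : ℕ) : TopCat.Presheaf (ModuleCat.{u} k) X where
  obj U := ModuleCat.of k (polyDer k X n U.unop)
  map f := ModuleCat.ofHom
    { toFun := fun D => ⟨fun W => D.1 ⟨W.1, W.2.trans f.unop.le⟩,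
        fun _ => D.2.1 _, fun W W' h v => D.2.2 ⟨W.1, _⟩ ⟨W'.1, _⟩ h v⟩
      map_add' := fun _ _ => rfl
      map_smul' := fun _ _ => rfl }
  map_id _ := rfl
  map_comp _ _ := rfl

theorem polyDerPresheaf_isSheaf (n : ℕ) : (polyDerPresheaf k X n).IsSheaf := by
  rw [TopCat.Presheaf.isSheaf_iff_isSheafUniqueGluing]
  intro ι U sf hsf
  have hcomp : ∀ (i j : ι) (W : X.Opens) (hi : W ≤ U i) (hj : W ≤ U j),
      (sf i).1 ⟨W, hi⟩ = (sf j).1 ⟨W, hj⟩ := fun i j W hi hj =>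
    congrFun (congrArg Subtype.val (hsf i j)) ⟨W, le_inf hi hj⟩
  have hcov : ∀ W : {W : X.Opens // W ≤ iSup U}, W.1 ≤ ⨆ i, W.1 ⊓ U i := by
    intro W
    rw [← inf_iSup_eq]
    exact le_inf le_rfl W.2
  have hloc : ∀ (W : {W : X.Opens // W ≤ iSup U}) (a b : Γ(X, W.1)),
      (∀ i, res X (inf_le_left : W.1 ⊓ U i ≤ W.1) a = res X inf_le_left b) → a = b := by
    intro W a b h
    exact X.sheaf.eq_of_locally_eq' (fun i => W.1 ⊓ U i) W.1 (fun i => homOfLE inf_le_left)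
      (hcov W) a b h
  have hex : ∀ (W : {W : X.Opens // W ≤ iSup U}) (v : Fin n → Γ(X, W.1)), ∃ s : Γ(X, W.1),
      ∀ i, res X (inf_le_left : W.1 ⊓ U i ≤ W.1) s =
        (sf i).1 ⟨W.1 ⊓ U i, inf_le_right⟩ fun l => res X inf_le_left (v l) := by
    intro W v
    obtain ⟨s, hs, -⟩ := X.sheaf.existsUnique_gluing' (fun i => W.1 ⊓ U i) W.1
      (fun i => homOfLE inf_le_left) (hcov W)
      (fun i => (sf i).1 ⟨W.1 ⊓ U i, inf_le_right⟩ fun l => res X inf_le_left (v l)) (by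
        intro i j
        change res X (inf_le_left : (W.1 ⊓ U i) ⊓ (W.1 ⊓ U j) ≤ W.1 ⊓ U i) _ =
          res X (inf_le_right : (W.1 ⊓ U i) ⊓ (W.1 ⊓ U j) ≤ W.1 ⊓ U j) _
        rw [(sf i).2.2 ⟨_, inf_le_right⟩ ⟨(W.1 ⊓ U i) ⊓ (W.1 ⊓ U j),
            inf_le_left.trans inf_le_right⟩ inf_le_left,
          (sf j).2.2 ⟨_, inf_le_right⟩ ⟨(W.1 ⊓ U i) ⊓ (W.1 ⊓ U j),
            inf_le_right.trans inf_le_right⟩ inf_le_right,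
          hcomp i j _ _ (inf_le_right.trans inf_le_right)]
        simp only [res_res])
    exact ⟨s, hs⟩
  choose G hG using hex
  have hGU : ∀ (i : ι) (W : X.Opens) (h : W ≤ U i),
      G ⟨W, h.trans (le_iSup U i)⟩ = (sf i).1 ⟨W, h⟩ := by
    intro i W h
    ext v
    refine hloc ⟨W, h.trans (le_iSup U i)⟩ _ _ fun j => ?_
    rw [hG, (sf i).2.2 ⟨W, h⟩ ⟨W ⊓ U j, inf_le_left.trans h⟩ inf_le_left, hcomp i j]
  have hupd : ∀ (W V : X.Opens) (h : V ≤ W) (v : Fin n → Γ(X, W)) (l : Fin n) (a : Γ(X, W)),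
      (fun m => res X h (Function.update v l a m)) =
        Function.update (fun m => res X h (v m)) l (res X h a) := by
    intro W V h v l a
    ext m
    rcases eq_or_ne m l with rfl | hm <;> simp [*]
  refine ⟨⟨G, fun W => ⟨?_, ?_, ?_, ?_⟩, fun W W' h v => ?_⟩, ?_, ?_⟩
  · intro v l a b
    refine hloc W _ _ fun i => ?_
    simp only [map_add, hG, hupd, ((sf i).2.1 _).add]
  · intro v l c a
    refine hloc W _ _ fun i => ?_
    simp only [res_smul, hG, hupd, ((sf i).2.1 _).smul]
  · intro v l a b
    refine hloc W _ _ fun i => ?_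
    simp only [map_add, map_mul, hG, hupd, ((sf i).2.1 _).leibniz]
  · intro v l m hv hlm
    refine hloc W _ _ fun i => ?_
    rw [hG, map_zero]
    exact ((sf i).2.1 _).alt _ l m (by rw [hv]) hlm
  · refine hloc W' _ _ fun i => ?_
    rw [hG, res_res, ← res_res (inf_le_left : W.1 ⊓ U i ≤ W.1)
        (le_inf (inf_le_left.trans h) inf_le_right : W'.1 ⊓ U i ≤ W.1 ⊓ U i), hG,
      (sf i).2.2 ⟨_, inf_le_right⟩ ⟨W'.1 ⊓ U i, inf_le_right⟩
        (le_inf (inf_le_left.trans h) inf_le_right)]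
    simp only [res_res]
  · intro i
    refine Subtype.ext (funext fun W => ?_)
    exact hGU i W.1 W.2
  · intro s hs
    refine Subtype.ext (funext fun W => funext fun v => hloc W _ _ fun i => ?_)
    rw [hG, s.2.2 W ⟨W.1 ⊓ U i, inf_le_left.trans W.2⟩ inf_le_left]
    have := congrFun (congrArg Subtype.val (hs i)) ⟨W.1 ⊓ U i, inf_le_right⟩
    exact congrFun this _

/-- The sheaf `ℋom(⋀ⁿ Ω_{X/k}, 𝒪_X)` of `k`-vector spaces. -/
noncomputable def polyDerSheaf (n : ℕ) : TopCat.Sheaf (ModuleCat.{u} k) X :=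
  ⟨polyDerPresheaf k X n, polyDerPresheaf_isSheaf k X n⟩

variable {X} (Λ : PoissonStructure (X ↘ Spec (.of k)))

theorem algebraMap_br (U : X.Opens) (c : k) (a : Γ(X, U)) :
    (Λ.bracket U).br (algebraMap k Γ(X, U) c) a = 0 :=
  Λ.base_br ⊤ U le_top _ a

theorem res_schouten {n : ℕ} {W W' : X.Opens} (h : W' ≤ W) {Q : (Fin n → Γ(X, W)) → Γ(X, W)}
    {Q' : (Fin n → Γ(X, W')) → Γ(X, W')} (hQ : ∀ v, res X h (Q v) = Q' fun i => res X h (v i))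
    (v : Fin (n + 1) → Γ(X, W)) : res X h ((Λ.bracket W).schouten Q v) =
      (Λ.bracket W').schouten Q' fun i => res X h (v i) := by
  simp only [PoissonBracket.schouten, PoissonBracket.ce, map_mul, map_pow, map_neg, map_one,
    map_sum, map_sub, Λ.res_br W W' h, hQ]
  refine congrArg _ (Finset.sum_congr rfl fun i _ => ?_)
  congr 2
  refine Finset.sum_congr rfl fun j _ => congrArg Q' ?_
  ext l
  simp only [Fin.removeNth]
  rcases eq_or_ne (i.succAbove l) j with rfl | hl
  · simp [Λ.res_br W W' h]
  · simp [hl]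

/-- The differential `[Λ, -]`. -/
noncomputable def lpDifferential (n : ℕ) : polyDerSheaf k X n ⟶ polyDerSheaf k X (n + 1) :=
  ⟨{ app := fun _ => ModuleCat.ofHom
      { toFun := fun D => ⟨fun W => (Λ.bracket W.1).schouten (D.1 W),
          fun W => (D.2.1 W).schouten _ (algebraMap_br k Λ W.1),
          fun W W' h v => res_schouten k Λ h (D.2.2 W W' h) v⟩
        map_add' := fun _ _ => Subtype.ext (funext fun _ => PoissonBracket.schouten_add _ _ _)
        map_smul' := fun c _ => Subtype.ext (funext fun W =>
          PoissonBracket.schouten_smul _ (algebraMap_br k Λ W.1) c _) }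
     naturality := fun _ _ _ => rfl }⟩

/-- The complex `n ↦ ℋom(⋀ⁿ⁺¹ Ω_{X/k}, 𝒪_X)`. -/
noncomputable def lpComplexNat : CochainComplex (TopCat.Sheaf (ModuleCat.{u} k) X) ℕ :=
  CochainComplex.of (fun n => polyDerSheaf k X (n + 1)) (fun n => lpDifferential k Λ (n + 1)) (by
    intro n
    refine ObjectProperty.hom_ext _ (NatTrans.ext (funext fun _ => ModuleCat.hom_ext (LinearMap.ext
      fun D => Subtype.ext (funext fun W => funext fun v => ?_))))
    exact (Λ.bracket W.1).schouten_schouten (D.2.1 W) v)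

/-- The truncated Lichnerowicz-Poisson complex of sheaves
`0 ⟶ ℋom(Ω_{X/k}, 𝒪_X) ⟶ ℋom(⋀² Ω_{X/k}, 𝒪_X) ⟶ ⋯` with differential `[Λ, -]`, the sheaf
`ℋom(⋀ⁿ Ω_{X/k}, 𝒪_X)` being in degree `n`. -/
noncomputable def lpComplex : CochainComplex (TopCat.Sheaf (ModuleCat.{u} k) X) ℤ :=
  (lpComplexNat k Λ).extend (ComplexShape.embeddingUpIntGE 1)

theorem lpComplex_isStrictlyGE : (lpComplex k Λ).IsStrictlyGE 1 := by
  rw [CochainComplex.isStrictlyGE_iff]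
  intro n hn
  exact HomologicalComplex.isZero_extend_X _ _ _
    ((ComplexShape.notMem_range_embeddingUpIntGE_iff 1 n).2 hn)

end Sheaves

section Hypercohomology

/-- An injective resolution of a complex: a quasi-isomorphism to a bounded below complex of
injective objects. -/
structure InjectiveResolution {C : Type*} [Category* C] [Abelian C] (K : CochainComplex C ℤ) where
  I : CochainComplex C ℤ
  σ : K ⟶ I
  quasiIso : QuasiIso σ
  injective : ∀ n, Injective (I.X n)
  boundedBelow : ∃ n, I.IsStrictlyGE n

theorem InjectiveResolution.nonempty {C : Type*} [Category* C] [Abelian C] [EnoughInjectives C]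
    (K : CochainComplex C ℤ) (n : ℤ) [K.IsStrictlyGE n] : Nonempty (InjectiveResolution K) := by
  obtain ⟨L, i, hi, hL, hn⟩ := CochainComplex.Plus.modelCategoryQuillen.exists_quasiIso_injective K n
  exact ⟨⟨L, i, hi, hL, n, hn⟩⟩

/-- The global sections functor on sheaves of `k`-vector spaces. -/
noncomputable def globalSections (k : Type u) [Field k] (T : TopCat.{u}) :
    TopCat.Sheaf (ModuleCat.{u} k) T ⥤ ModuleCat.{u} k where
  obj F := F.obj.obj (op ⊤)
  map f := f.hom.app (op ⊤)

instance (k : Type u) [Field k] (T : TopCat.{u}) : (globalSections k T).Additive where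
  map_add := rfl

/-- The complex of global sections of a complex of sheaves. -/
noncomputable def globalSectionsComplex {k : Type u} [Field k] {T : TopCat.{u}}
    (K : CochainComplex (TopCat.Sheaf (ModuleCat.{u} k) T) ℤ) :
    CochainComplex (ModuleCat.{u} k) ℤ :=
  ((globalSections k T).mapHomologicalComplex _).obj K

/-- The `n`-th hypercohomology group of `K`, computed by an injective resolution of `K`. -/
noncomputable abbrev hypercohomology {k : Type u} [Field k] {T : TopCat.{u}}
    {K : CochainComplex (TopCat.Sheaf (ModuleCat.{u} k) T) ℤ} (R : InjectiveResolution K) (n : ℤ) :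
    ModuleCat.{u} k :=
  (globalSectionsComplex R.I).homology n

variable (k : Type u) [Field k] {X : Scheme.{u}} [X.Over (Spec (.of k))]
  (Λ : PoissonStructure (X ↘ Spec (.of k)))

/-- A chosen injective resolution of the truncated Lichnerowicz-Poisson complex. -/
noncomputable def lpResolution : InjectiveResolution (lpComplex k Λ) :=
  haveI := lpComplex_isStrictlyGE k Λ
  (InjectiveResolution.nonempty (lpComplex k Λ) 1).some

/-- The `n`-th truncated Lichnerowicz-Poisson cohomology group of `(X, Λ)`: the hypercohomology of the
truncated Lichnerowicz-Poisson complex. -/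
noncomputable abbrev HP (n : ℤ) : ModuleCat.{u} k := hypercohomology (lpResolution k Λ) n

/-- The map from the sheaf of skew-symmetric `n + 1`-derivations to the term of degree
`n + 1` of the injective resolution. -/
noncomputable def toResolution (n : ℕ) (m : ℤ) (h : 1 + (n : ℤ) = m) :
    polyDerSheaf k X (n + 1) ⟶ (lpResolution k Λ).I.X m :=
  (HomologicalComplex.extendXIso (lpComplexNat k Λ) (ComplexShape.embeddingUpIntGE 1) h).inv ≫
    (lpResolution k Λ).σ.f m

end Hypercohomology

section Deformations

variable (k : Type u) [Field k]

/-- `Spec k ⟶ Spec k[ε]`. -/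
noncomputable def specFst : Spec (.of k) ⟶ Spec (.of (DualNumber k)) :=
  Spec.map (CommRingCat.ofHom (TrivSqZeroExt.fstHom k k k).toRingHom)

/-- `Spec k[ε] ⟶ Spec k`. -/
noncomputable def specDual : Spec (.of (DualNumber k)) ⟶ Spec (.of k) :=
  Spec.map (CommRingCat.ofHom (algebraMap k (DualNumber k)))

variable {k} {X : Scheme.{u}} [X.Over (Spec (.of k))]
  (Λ : PoissonStructure (X ↘ Spec (.of k)))

/-- A first-order Poisson deformation of `(X, Λ)`: a cartesian square
```
(X, Λ) --incl--> (total, poisson)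
  |                   | proj
Spec k  ------->   Spec k[ε]
```
with `proj` flat and surjective, `poisson` a Poisson structure over `k[ε]` inducing `Λ`. -/
structure FirstOrderDeformation where
  total : Scheme.{u}
  proj : total ⟶ Spec (.of (DualNumber k))
  incl : X ⟶ total
  isPullback : IsPullback incl (X ↘ Spec (.of k)) proj (specFst k)
  flat : Flat proj
  surjective : Surjective proj
  poisson : PoissonStructure proj
  incl_poisson : IsPoissonHom Λ poisson incl

theorem IsPoissonHom.id {S : Scheme.{u}} {f : X ⟶ S} (P : PoissonStructure f) :
    IsPoissonHom P P (𝟙 X) := by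
  intro U a b
  rw [Scheme.Hom.id_app]
  rfl

theorem IsPoissonHom.comp {X Y Z S T R : Scheme.{u}} {f : X ⟶ S} {g : Y ⟶ T} {h : Z ⟶ R}
    {P : PoissonStructure f} {Q : PoissonStructure g} {O : PoissonStructure h} {φ : X ⟶ Y}
    {ψ : Y ⟶ Z} (hφ : IsPoissonHom P Q φ) (hψ : IsPoissonHom Q O ψ) :
    IsPoissonHom P O (φ ≫ ψ) := by
  intro U a b
  have e : ∀ c, (φ ≫ ψ).app U c = φ.app (ψ ⁻¹ᵁ U) (ψ.app U c) := fun c => by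
    rw [Scheme.Hom.comp_app]; rfl
  rw [e, e, e, hψ, hφ]
  rfl

theorem IsPoissonHom.symm {X Y S T : Scheme.{u}} {f : X ⟶ S} {g : Y ⟶ T}
    {P : PoissonStructure f} {Q : PoissonStructure g} (φ : X ≅ Y)
    (hφ : IsPoissonHom P Q φ.hom) : IsPoissonHom Q P φ.inv := by
  intro U a b
  have hV : ∀ V : X.Opens, φ.hom ⁻¹ᵁ (φ.inv ⁻¹ᵁ V) = V := fun V => by
    rw [← Scheme.Hom.comp_preimage]; simp
  have h : ∀ c : Γ(X, U), φ.hom.app (φ.inv ⁻¹ᵁ U) (φ.inv.app U c) = res X (hV U).le c := by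
    intro c
    have := Scheme.Hom.congr_app φ.hom_inv_id U
    rw [Scheme.Hom.comp_app] at this
    have := congrArg (fun f => f.hom c) this
    rw [Scheme.Hom.id_app] at this
    exact this
  have hinj : Function.Injective (φ.hom.app (φ.inv ⁻¹ᵁ U)) :=
    (ConcreteCategory.bijective_of_isIso (φ.hom.app (φ.inv ⁻¹ᵁ U))).1
  apply hinj
  rw [h, hφ, h, h, P.res_br]

namespace FirstOrderDeformation

variable {Λ}

/-- Isomorphism of Poisson deformations: a Poisson isomorphism over `Spec k[ε]` inducing the
identity on `X`. -/
def Equivalent (ξ η : FirstOrderDeformation Λ) : Prop :=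
  ∃ φ : ξ.total ≅ η.total, φ.hom ≫ η.proj = ξ.proj ∧ ξ.incl ≫ φ.hom = η.incl ∧
    IsPoissonHom ξ.poisson η.poisson φ.hom

instance setoid (Λ : PoissonStructure (X ↘ Spec (.of k))) : 
    Setoid (FirstOrderDeformation Λ) where
  r := Equivalent
  iseqv :=
    { refl := fun ξ => ⟨Iso.refl _, by simp, by simp, IsPoissonHom.id _⟩
      symm := by
        rintro ξ η ⟨φ, h1, h2, h3⟩
        exact ⟨φ.symm, by simp [← h1], by simp [← h2], h3.symm⟩
      trans := by
        rintro ξ η ζ ⟨φ, h1, h2, h3⟩ ⟨ψ, h4, h5, h6⟩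
        exact ⟨φ ≪≫ ψ, by simp [h4, h1], by simp [reassoc_of% h2, h5], h3.comp h6⟩ }

/-- The deformation is isomorphic to the trivial one: the total space is `X ×_k Spec k[ε]`, with
projection `r` to `X`, and its bracket is the `k[ε]`-bilinear extension of the bracket of `X`,
that is, the `k[ε]`-bilinear bracket for which `r` is a Poisson morphism. -/
def IsTrivial (ξ : FirstOrderDeformation Λ) : Prop :=
  ∃ r : ξ.total ⟶ X, IsPullback r ξ.proj (X ↘ Spec (.of k)) (specDual k) ∧
    ξ.incl ≫ r = 𝟙 X ∧ IsPoissonHom ξ.poisson Λ r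

/-- The underlying flat deformation is locally trivial: each point of `X` has an open neighbourhood
`U = incl ⁻¹ V` over which the deformation is isomorphic, as a deformation of schemes, to
`U ×_k Spec k[ε]`. -/
def IsLocallyTrivial (ξ : FirstOrderDeformation Λ) : Prop :=
  ∀ x : X, ∃ V : ξ.total.Opens, ξ.incl x ∈ V ∧
    ∃ r : V.toScheme ⟶ (ξ.incl ⁻¹ᵁ V).toScheme,
      IsPullback r (V.ι ≫ ξ.proj) ((ξ.incl ⁻¹ᵁ V).ι ≫ X ↘ Spec (.of k)) (specDual k) ∧
        (ξ.incl ∣_ V) ≫ r = 𝟙 _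

/-- The ring homomorphism `k[ε] ⟶ 𝒪(W)`. -/
noncomputable def scalar (ξ : FirstOrderDeformation Λ) (W : ξ.total.Opens) :
    DualNumber k →+* Γ(ξ.total, W) :=
  (ξ.proj.appLE ⊤ W le_top).hom.comp (Scheme.ΓSpecIso (.of (DualNumber k))).inv.hom

/-- Local trivializations of (the underlying deformation of) `ξ` and the resulting cocycle.
Over the members `V i` of an open cover, `s i` is a splitting of `𝒪_total → 𝒪_X` by a morphism of
sheaves of `k`-algebras, that is, a trivialization of `ξ` over `V i`. Then `s j = s i + ε p i j` and
the bracket of `ξ` is `Λ + ε Λ' i` in the trivialization `s i`. -/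
structure KodairaSpencerDatum (ξ : FirstOrderDeformation Λ) where
  ι : Type u
  V : ι → ξ.total.Opens
  cover : ⨆ i, V i = ⊤
  s : ∀ (i : ι) (W : ξ.total.Opens), W ≤ V i → Γ(X, ξ.incl ⁻¹ᵁ W) →+* Γ(ξ.total, W)
  s_incl : ∀ i W h f, ξ.incl.app W (s i W h f) = f
  s_res : ∀ i W h W' (h' : W' ≤ W) f,
    res ξ.total h' (s i W h f) = s i W' (h'.trans h) (res X (ξ.incl.preimage_mono h') f)
  s_const : ∀ i W h (c : k), s i W h (algebraMap k _ c) = ξ.scalar W (algebraMap k _ c)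
  p : ∀ i j, polyDer k X 1 (ξ.incl ⁻¹ᵁ (V i ⊓ V j))
  Λ' : ∀ i, polyDer k X 2 (ξ.incl ⁻¹ᵁ V i)
  s_sub : ∀ i j W (hi : W ≤ V i) (hj : W ≤ V j) f,
    s j W hj f = s i W hi f + ξ.scalar W DualNumber.eps *
      s i W hi ((p i j).1 ⟨ξ.incl ⁻¹ᵁ W, ξ.incl.preimage_mono (le_inf hi hj)⟩ ![f])
  s_br : ∀ i W h f g, (ξ.poisson.bracket W).br (s i W h f) (s i W h g) =
    s i W h ((Λ.bracket _).br f g) + ξ.scalar W DualNumber.eps *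
      s i W h ((Λ' i).1 ⟨ξ.incl ⁻¹ᵁ W, ξ.incl.preimage_mono h⟩ ![f, g])

/-- `c` is the class in `HP²` of the hyper-Čech cocycle `(p, Λ')`. In the injective resolution `I`,
writing `p i j = b j - b i` for a `0`-cochain `b` of `I¹`, it is the class of the global
section `z` of `I²` which is `Λ' i - d (b i)` on the `i`-th member of the cover. -/
def KodairaSpencerDatum.Represents {ξ : FirstOrderDeformation Λ} (D : ξ.KodairaSpencerDatum)
    (c : HP k Λ 2) : Prop :=
  ∃ (z : (globalSectionsComplex (lpResolution k Λ).I).cycles 2)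
    (b : ∀ i, ((lpResolution k Λ).I.X 1).obj.obj (op (ξ.incl ⁻¹ᵁ D.V i))),
    (globalSectionsComplex (lpResolution k Λ).I).homologyπ 2 z = c ∧
    (∀ i j, ((lpResolution k Λ).I.X 1).obj.map
          (homOfLE (ξ.incl.preimage_mono inf_le_right : ξ.incl ⁻¹ᵁ (D.V i ⊓ D.V j) ≤ _)).op (b j) -
        ((lpResolution k Λ).I.X 1).obj.map
          (homOfLE (ξ.incl.preimage_mono inf_le_left : ξ.incl ⁻¹ᵁ (D.V i ⊓ D.V j) ≤ _)).op (b i) =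
      (toResolution k Λ 0 1 rfl).hom.app _ (D.p i j)) ∧
    ∀ i, ((lpResolution k Λ).I.X 2).obj.map (homOfLE (le_top : ξ.incl ⁻¹ᵁ D.V i ≤ ⊤)).op
        ((globalSectionsComplex (lpResolution k Λ).I).iCycles 2 z) =
      (toResolution k Λ 1 2 rfl).hom.app _ (D.Λ' i) - ((lpResolution k Λ).I.d 1 2).hom.app _ (b i)

/-- Poisson isomorphism classes of first-order Poisson deformations of `(X, Λ)`. -/
def Classes (Λ : PoissonStructure (X ↘ Spec (.of k))) : Type (u + 1) :=
  Quotient (setoid Λ)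

/-- The first-order Poisson deformations whose underlying flat deformation is locally trivial. -/
abbrev LocallyTrivial (Λ : PoissonStructure (X ↘ Spec (.of k))) : Type (u + 1) :=
  {ξ : FirstOrderDeformation Λ // ξ.IsLocallyTrivial}

/-- Poisson isomorphism classes of first-order Poisson deformations of `(X, Λ)` whose underlying
flat deformation is locally trivial. -/
def LocallyTrivialClasses (Λ : PoissonStructure (X ↘ Spec (.of k))) : Type (u + 1) :=
  Quotient ((setoid Λ).comap (Subtype.val : LocallyTrivial Λ → FirstOrderDeformation Λ))

/-- The class of a deformation. -/
def toClass {Λ : PoissonStructure (X ↘ Spec (.of k))} (ξ : FirstOrderDeformation Λ) : Classes Λ :=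
  Quotient.mk _ ξ

/-- The class of a deformation whose underlying flat deformation is locally trivial. -/
def LocallyTrivial.toClass {Λ : PoissonStructure (X ↘ Spec (.of k))} (ξ : LocallyTrivial Λ) :
    LocallyTrivialClasses Λ :=
  Quotient.mk _ ξ

end FirstOrderDeformation

end Deformations

end PoissonDeformation

/-! A deformation has the same underlying space as `X`, and flatness over `k[ε]` identifies the
ideal `ε𝒪` of the total space with `𝒪_X`. So a first-order Poisson deformation gives an extension of
`𝒪_X` by itself in sheaves of Poisson `k`-algebras, with kernel of square zero (`SheafExt`).
Isomorphisms of deformations correspond to morphisms of extensions (`equivalent_iff`), trivial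
deformations to extensions with a global splitting that preserves brackets (`isTrivial_iff`), and
locally trivial ones to locally split extensions (`isLocallyTrivial_iff`). Conversely, a locally
split extension is the structure sheaf of a scheme flat over `k[ε]` (`SheafExt.toDeformation`), so
that the theorem becomes a classification of locally split extensions.

The splittings over an open set form a torsor under derivations. Each splitting `s` has a bivector
`λ_s` (`Spl.lam`), the first-order term of the bracket. The Jacobi identity gives `[Λ, λ_s] = 0`
(`lpd_lam`), and a change of splitting gives `[Λ, t - s] = λ_t - λ_s` (`lpd_sub`): this is the
hyper-Čech cocycle. To reach hypercohomology, take an injective resolution `K → I` of the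
Lichnerowicz–Poisson complex. A marking of an extension is a function `B` from splittings to
sections of `I¹` with `B t - B s = t - s`, together with a global cocycle `z` of `I²` with `z = λ_s
- d (B s)`. Markings exist because Čech `H¹` of `I¹` vanishes (`LocSplit.exists_isMarked`), and two
markings of one extension differ by a global section `w` of `I¹`, which changes `z` by `d w`; so the
class of `z` is well defined (`IsMarked.unique`).

For bijectivity, note that `K` starts in degree 1, so `I` is exact in degrees at most 0 and the
image `B¹` of `I⁰ → I¹` is injective, hence a direct summand of `I¹` (`exists_boundary_projection`).
The quasi-isomorphism then says: a closed bivector that equals `d β` in `I²` is `[Λ, q]` for exactly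
one derivation `q` congruent to `β` modulo `B¹` (`exists_derivation_of_resd`, `eq_of_bdp`). This
uniqueness makes local choices glue. Two extensions of the same class have, locally, pairs of
splittings with equal bivectors and equal markings modulo `B¹`; the resulting local isomorphisms
agree on overlaps (`IsMarked.nonempty_hom`). Given a class, writing `z` locally as `l - d b`
produces derivations on overlaps that form a cocycle, from which an extension is glued
(`Cocycle.toExt`, `SheafExt.exists_isMarked`).

If `X` is smooth, formal smoothness lifts the identity of the coordinate ring through the
square-zero thickening on affine opens, so every deformation is locally trivial
(`isLocallyTrivial_of_smooth`). -/

namespace PoissonDeformation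

/-! ### Sheaves of vector spaces: gluing, free sections, Čech vanishing for injectives. -/

section ModuleSheaves

variable {k : Type u} [Field k] {T : TopCat.{u}}

/-- The restriction of a section of a presheaf of modules. -/
abbrev mres (F : TopCat.Presheaf (ModuleCat.{u} k) T) {U V : Opens T} (h : V ≤ U)
    (x : F.obj (op U)) : F.obj (op V) :=
  F.map (homOfLE h).op x

theorem mres_self (F : TopCat.Presheaf (ModuleCat.{u} k) T) {U : Opens T} (h : U ≤ U)
    (x : F.obj (op U)) : mres F h x = x := by
  simp [mres]

theorem mres_mres (F : TopCat.Presheaf (ModuleCat.{u} k) T) {U V W : Opens T} (h : V ≤ U)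
    (h' : W ≤ V) (x : F.obj (op U)) : mres F h' (mres F h x) = mres F (h'.trans h) x := by
  have : (homOfLE (h'.trans h)).op = (homOfLE h).op ≫ (homOfLE h').op := rfl
  simp [mres, this]

theorem mres_hom {F G : TopCat.Sheaf (ModuleCat.{u} k) T} (φ : F ⟶ G) {U V : Opens T} (h : V ≤ U)
    (x : F.obj.obj (op U)) :
    mres G.obj h (φ.hom.app (op U) x) = φ.hom.app (op V) (mres F.obj h x) :=
  (NatTrans.naturality_apply φ.hom (homOfLE h).op x).symm

theorem comp_app {F G H : TopCat.Sheaf (ModuleCat.{u} k) T} (φ : F ⟶ G) (ψ : G ⟶ H) {U : Opens T}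
    (x : F.obj.obj (op U)) : (φ ≫ ψ).hom.app (op U) x = ψ.hom.app (op U) (φ.hom.app (op U) x) :=
  rfl

theorem section_ext (F : TopCat.Sheaf (ModuleCat.{u} k) T) {U : Opens T} {x y : F.obj.obj (op U)}
    (h : ∀ p ∈ U, ∃ (V : Opens T) (hV : V ≤ U), p ∈ V ∧ mres F.obj hV x = mres F.obj hV y) :
    x = y := by
  choose V hV hp hxy using fun p : U => h p.1 p.2
  refine TopCat.Sheaf.eq_of_locally_eq' F V U (fun p => homOfLE (hV p)) ?_ x y fun p => hxy p
  intro p hpU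
  exact Opens.mem_iSup.2 ⟨⟨p, hpU⟩, hp _⟩

theorem exists_gluing (F : TopCat.Sheaf (ModuleCat.{u} k) T) {U : Opens T} {ι : Type u}
    (V : ι → Opens T) (hV : ∀ i, V i ≤ U) (hc : U ≤ ⨆ i, V i) (x : ∀ i, F.obj.obj (op (V i)))
    (h : ∀ i j, mres F.obj (inf_le_left : V i ⊓ V j ≤ V i) (x i) = mres F.obj inf_le_right (x j)) :
    ∃ y : F.obj.obj (op U), ∀ i, mres F.obj (hV i) y = x i := by
  obtain ⟨s, hs, -⟩ := TopCat.Sheaf.existsUnique_gluing' F V U (fun i => homOfLE (hV i)) hc x h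
  exact ⟨s, hs⟩

/-- Uniqueness forces the chosen local solutions to agree on overlaps, so they glue. The glued
section satisfies `P` only near each point, since `P` is stable under restriction but need not be a
local condition. -/
theorem exists_unique_of_local (F : TopCat.Sheaf (ModuleCat.{u} k) T) {U : Opens T}
    (P : ∀ V : Opens T, V ≤ U → F.obj.obj (op V) → Prop)
    (hP : ∀ V W (hV : V ≤ U) (hW : W ≤ V) x, P V hV x → P W (hW.trans hV) (mres F.obj hW x))
    (hu : ∀ V hV x y, P V hV x → P V hV y → x = y)
    (he : ∀ p ∈ U, ∃ (V : Opens T) (hV : V ≤ U) (x : _), p ∈ V ∧ P V hV x) :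
    ∃ y : F.obj.obj (op U), ∀ p ∈ U, ∃ (V : Opens T) (hV : V ≤ U), p ∈ V ∧
      P V hV (mres F.obj hV y) := by
  choose V hV x hp hx using fun p : U => he p.1 p.2
  obtain ⟨y, hy⟩ := exists_gluing F V hV
    (fun p hpU => Opens.mem_iSup.2 ⟨⟨p, hpU⟩, hp _⟩) x
    (fun i j => hu _ (inf_le_left.trans (hV i)) _ _ (hP _ _ _ _ _ (hx i)) (hP _ _ _ _ _ (hx j)))
  exact ⟨y, fun p hpU => ⟨V ⟨p, hpU⟩, hV _, hp _, by rw [hy]; exact hx _⟩⟩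

theorem locally_surjective_of_epi {F G : TopCat.Sheaf (ModuleCat.{u} k) T} (φ : F ⟶ G) [Epi φ]
    {U : Opens T} (x : G.obj.obj (op U)) {p : T} (hp : p ∈ U) :
    ∃ (V : Opens T) (hV : V ≤ U) (y : F.obj.obj (op V)), p ∈ V ∧
      φ.hom.app (op V) y = mres G.obj hV x := by
  have h := (TopCat.Sheaf.isLocallySurjective_iff_epi φ).2 inferInstance
  obtain ⟨V, i, ⟨y, hy⟩, hpV⟩ := (TopCat.Presheaf.isLocallySurjective_iff φ.hom).1 h U x p hp
  exact ⟨V, i, y, hpV, hy⟩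

/-- Yoneda: the free presheaf on the presheaf represented by `U` corepresents sections over `U`.
`hom_free_ext` is the uniqueness half. -/
theorem exists_hom_free (U : Opens T) (F : TopCat.Presheaf (ModuleCat.{u} k) T)
    (x : F.obj (op U)) : ∃ f : yoneda.obj U ⋙ ModuleCat.free k ⟶ F,
      f.app (op U) (ModuleCat.freeMk (R := k) (𝟙 U)) = x := by
  refine ⟨{ app := fun V => ModuleCat.freeDesc (↾ fun g : V.unop ⟶ U => F.map g.op x)
            naturality := ?_ }, ?_⟩
  · intro V W g
    refine ModuleCat.free_hom_ext fun h => ?_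
    rw [ConcreteCategory.comp_apply, ConcreteCategory.comp_apply]
    refine (congrArg _ (ModuleCat.free_map_apply (R := k) ((yoneda.obj U).map g) h)).trans ?_
    refine (ModuleCat.freeDesc_apply _ _).trans ?_
    refine Eq.trans ?_ (congrArg (F.map g) (ModuleCat.freeDesc_apply _ _).symm)
    change F.map (h.op ≫ g) x = F.map g (F.map h.op x)
    rw [F.map_comp]
    rfl
  · refine (ModuleCat.freeDesc_apply _ _).trans ?_
    change F.map (𝟙 (op U)) x = x
    simp

theorem hom_free_ext (U : Opens T) (F : TopCat.Presheaf (ModuleCat.{u} k) T)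
    (f g : yoneda.obj U ⋙ ModuleCat.free k ⟶ F)
    (h : f.app (op U) (ModuleCat.freeMk (R := k) (𝟙 U)) = g.app (op U) (ModuleCat.freeMk (𝟙 U))) :
    f = g := by
  refine NatTrans.ext (funext fun V => ModuleCat.free_hom_ext fun (i : V.unop ⟶ U) => ?_)
  have e : ∀ χ : yoneda.obj U ⋙ ModuleCat.free k ⟶ F, χ.app V (ModuleCat.freeMk i) =
      F.map i.op (χ.app (op U) (ModuleCat.freeMk (𝟙 U))) := by
    intro χ
    rw [← NatTrans.naturality_apply χ i.op]
    exact congrArg (χ.app V) (ModuleCat.free_map_apply ((yoneda.obj U).map i.op) (𝟙 U)).symm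
  rw [e, e, h]

/-- Sheafification turns the free presheaf on `U` into a sheaf corepresenting sections over `U`.
Statements about arbitrary test objects, such as exactness up to refinements, can thereby be applied
to sections. -/
theorem exists_free_section (U : Opens T) : ∃ (A : TopCat.Sheaf (ModuleCat.{u} k) T)
    (a : A.obj.obj (op U)),
    (∀ (F : TopCat.Sheaf (ModuleCat.{u} k) T) (x : F.obj.obj (op U)),
      ∃ φ : A ⟶ F, φ.hom.app (op U) a = x) ∧
    ∀ (F : TopCat.Sheaf (ModuleCat.{u} k) T) (φ ψ : A ⟶ F),
      φ.hom.app (op U) a = ψ.hom.app (op U) a → φ = ψ := by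
  let J := Opens.grothendieckTopology T
  let P : (Opens T)ᵒᵖ ⥤ ModuleCat.{u} k := yoneda.obj U ⋙ ModuleCat.free k
  let a₀ : P.obj (op U) := ModuleCat.freeMk (𝟙 U)
  let η : P ⟶ ((presheafToSheaf J _).obj P).obj := CategoryTheory.toSheafify J P
  refine ⟨(presheafToSheaf J _).obj P, η.app (op U) a₀, ?_, ?_⟩
  · intro F x
    obtain ⟨f, hf⟩ := exists_hom_free U F.obj x
    refine ⟨⟨sheafifyLift J f F.property⟩, ?_⟩
    have := congrArg (fun g => g.app (op U) a₀) (toSheafify_sheafifyLift J f F.property)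
    exact this.trans hf
  · intro F φ ψ h
    refine ObjectProperty.hom_ext _ (sheafify_hom_ext J _ _ F.property ?_)
    exact hom_free_ext U F.obj _ _ h

/-- `F` embeds in the presheaf `W ↦ ∏ F(W ⊓ U i)`. As an injective object among presheaves it is a
retract of this product, and the retraction acts as a contracting homotopy. -/
theorem cech_of_injective (F : TopCat.Sheaf (ModuleCat.{u} k) T) (hF₀ : Injective F) {ι : Type u}
    (U : ι → Opens T) (hU : ⨆ i, U i = ⊤) (c : ∀ i j, F.obj.obj (op (U i ⊓ U j)))
    (hc : ∀ i j l, mres F.obj (inf_le_left : (U i ⊓ U j) ⊓ U l ≤ U i ⊓ U j) (c i j) +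
      mres F.obj (le_inf (inf_le_left.trans inf_le_right) inf_le_right) (c j l) =
      mres F.obj (le_inf (inf_le_left.trans inf_le_left) inf_le_right) (c i l)) :
    ∃ b : ∀ i, F.obj.obj (op (U i)), ∀ i j,
      mres F.obj inf_le_right (b j) - mres F.obj inf_le_left (b i) = c i j := by
  let G : TopCat.Presheaf (ModuleCat.{u} k) T :=
    { obj := fun W => ModuleCat.of k (∀ i, F.obj.obj (op (W.unop ⊓ U i)))
      map := fun {W W'} f => ModuleCat.ofHom (LinearMap.pi fun i =>
        (F.obj.map (homOfLE (inf_le_inf_right (U i) f.unop.le)).op).hom ∘ₗ LinearMap.proj i)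
      map_id := by
        intro W
        refine ModuleCat.hom_ext (LinearMap.ext fun x => funext fun i => ?_)
        exact mres_self F.obj _ (x i)
      map_comp := by
        intro W W' W'' f g
        refine ModuleCat.hom_ext (LinearMap.ext fun x => funext fun i => ?_)
        exact (mres_mres F.obj _ _ (x i)).symm }
  let φ : F.obj ⟶ G :=
    { app := fun W => ModuleCat.ofHom (LinearMap.pi fun i =>
        (F.obj.map (homOfLE (inf_le_left : W.unop ⊓ U i ≤ W.unop)).op).hom)
      naturality := by
        intro W W' f
        refine ModuleCat.hom_ext (LinearMap.ext fun x => funext fun i => ?_)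
        refine (mres_mres F.obj f.unop.le _ x).trans (mres_mres F.obj _ _ x).symm }
  have hφ : Mono φ := by
    have : ∀ W, Mono (φ.app W) := fun W => by
      rw [ModuleCat.mono_iff_injective]
      intro x y hxy
      refine section_ext F fun p hp => ?_
      have : p ∈ ⨆ i, U i := by rw [hU]; trivial
      obtain ⟨i, hi⟩ := Opens.mem_iSup.1 this
      exact ⟨W.unop ⊓ U i, inf_le_left, ⟨hp, hi⟩, congrFun hxy i⟩
    exact NatTrans.mono_of_mono_app φ
  -- The inclusion of sheaves into presheaves is right adjoint to sheafification, which preserves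
  -- monomorphisms, so it preserves injectives.
  have hF : Injective ((sheafToPresheaf (Opens.grothendieckTopology T) (ModuleCat.{u} k)).obj F) :=
    (sheafificationAdjunction (Opens.grothendieckTopology T) (ModuleCat.{u} k)).map_injective F
      hF₀
  obtain ⟨r, hr⟩ : ∃ r : G ⟶ F.obj, φ ≫ r = 𝟙 _ := hF.factors (𝟙 F.obj) φ
  have hr' : ∀ W x, r.app W (φ.app W x) = x := fun W x =>
    congrArg (fun g => g.app W x) hr
  let g : ∀ i, G.obj (op (U i)) := fun i => fun l => c i l
  refine ⟨fun i => - r.app _ (g i), fun i j => ?_⟩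
  -- The cocycle relation, read with the third index free: `c i j` is `g i - g j` on `U i ⊓ U j`.
  -- Applying the retraction shows that `-r (g i)` is the required cochain.
  have key : φ.app (op (U i ⊓ U j)) (c i j) =
      G.map (homOfLE (inf_le_left : U i ⊓ U j ≤ U i)).op (g i) -
        G.map (homOfLE (inf_le_right : U i ⊓ U j ≤ U j)).op (g j) := by
    funext l
    exact eq_sub_of_add_eq (hc i j l)
  have h2 := congrArg (r.app _) key
  rw [hr', map_sub, NatTrans.naturality_apply, NatTrans.naturality_apply] at h2
  rw [h2]
  simp only [mres, map_neg]
  abel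

end ModuleSheaves


/-! ### Complexes of injectives, and quasi-isomorphisms on local sections. -/

section Complexes

-- A bounded below exact complex of injectives splits. If the image `Q` of one differential is
-- injective, it is a direct summand of the next term; the complement, which by exactness is the
-- image of the next differential, is a retract of an injective and so is injective. The induction
-- climbs from the lower bound `m`. Exactness in degrees at most 0 is just enough to reach the image
-- of `I⁰ → I¹`, whence `b ≤ 1`.
open Limits ZeroObject in
theorem exists_injective_image {C : Type*} [Category* C] [Abelian C] (I : CochainComplex C ℤ)
    (hI : ∀ n, Injective (I.X n)) (m : ℤ) [I.IsStrictlyGE m] (hex : ∀ n ≤ 0, I.ExactAt n) (j : ℕ) :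
    ∀ a b : ℤ, a + 1 = b → b ≤ m + j → b ≤ 1 → ∃ Q : C, Injective Q ∧
      ∃ (e : I.X a ⟶ Q) (ι : Q ⟶ I.X b), Epi e ∧ Mono ι ∧ e ≫ ι = I.d a b := by
  induction j with
  | zero =>
    intro a b hab hb _
    have hz : IsZero (I.X a) := I.isZero_of_isStrictlyGE m a (by simp at hb; omega)
    exact ⟨0, inferInstance, 0, 0, ⟨fun f g _ => (isZero_zero C).eq_of_src f g⟩,
      ⟨fun f g _ => (isZero_zero C).eq_of_tgt f g⟩, hz.eq_of_src _ _⟩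
  | succ j ih =>
    intro b c hbc hc hc1
    obtain ⟨Q, hQ, e, ι, he, hι, hd⟩ := ih (b - 1) b (by omega) (by push_cast at hc; omega)
      (by omega)
    have hιd : ι ≫ I.d b c = 0 := by
      rw [← cancel_epi e, ← Category.assoc, hd, I.d_comp_d, comp_zero]
    -- Replacing the source of the incoming differential by its image does not affect exactness.
    have hex' : (ShortComplex.mk ι (I.d b c) hιd).Exact := by
      have h1 : (I.sc' (b - 1) b c).Exact := by
        rw [← I.exactAt_iff' (b - 1) b c (by simp) (by simp [hbc])]
        exact hex b (by omega)
      let φ : I.sc' (b - 1) b c ⟶ ShortComplex.mk ι (I.d b c) hιd :=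
        { τ₁ := e
          τ₂ := 𝟙 (I.X b)
          τ₃ := 𝟙 (I.X c)
          comm₁₂ := hd.trans (Category.comp_id _).symm
          comm₂₃ := (Category.id_comp _).trans (Category.comp_id _).symm }
      have : Epi φ.τ₁ := he
      have : IsIso φ.τ₂ := inferInstanceAs (IsIso (𝟙 (I.X b)))
      have : Mono φ.τ₃ := inferInstanceAs (Mono (𝟙 (I.X c)))
      exact (ShortComplex.exact_iff_of_epi_of_isIso_of_mono φ).1 h1
    have hm := hex'.mono_cokernelDesc
    dsimp at hm
    obtain ⟨r, hr⟩ := hQ.factors (𝟙 Q) ι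
    -- The idempotent `𝟙 - r ≫ ι` kills `Q`, so it descends to a section of the cokernel projection.
    let s : cokernel ι ⟶ I.X b := cokernel.desc ι (𝟙 _ - r ≫ ι) (by
      rw [Preadditive.comp_sub, ← Category.assoc, hr]; simp)
    have hs : s ≫ cokernel.π ι = 𝟙 _ := by
      rw [← cancel_epi (cokernel.π ι)]
      simp [s, Preadditive.sub_comp]
    refine ⟨cokernel ι, ⟨fun {A B} g f hf => ?_⟩, cokernel.π ι,
      cokernel.desc ι (I.d b c) hιd, inferInstance, hm, by simp⟩
    obtain ⟨h, hh⟩ := (hI b).factors (g ≫ s) f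
    exact ⟨h ≫ cokernel.π ι, by rw [← Category.assoc, hh, Category.assoc, hs, Category.comp_id]⟩

variable {k : Type u} [Field k] {T : TopCat.{u}}

/-- The differential of a complex of sheaves on sections. -/
noncomputable abbrev dsec (K : CochainComplex (TopCat.Sheaf (ModuleCat.{u} k) T) ℤ) (i j : ℤ)
    {U : Opens T} (x : (K.X i).obj.obj (op U)) : (K.X j).obj.obj (op U) :=
  (K.d i j).hom.app (op U) x

variable {K I : CochainComplex (TopCat.Sheaf (ModuleCat.{u} k) T) ℤ} (σ : K ⟶ I) [QuasiIso σ]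

/-- Injectivity of `σ` on cohomology, tested on the sheaf that corepresents sections over `U`. The
refinement is an epimorphism of sheaves, and sections lift along it only locally, hence the smaller
open set. The next lemma is the surjective counterpart. -/
theorem locally_exact_of_quasiIso_mono (i j l : ℤ) (hi : i + 1 = j) (hl : j + 1 = l) {U : Opens T}
    (x : (K.X j).obj.obj (op U)) (hx : dsec K j l x = 0) (y : (I.X i).obj.obj (op U))
    (h : (σ.f j).hom.app (op U) x = dsec I i j y) {p : T} (hp : p ∈ U) :
    ∃ (V : Opens T) (hV : V ≤ U) (x₁ : (K.X i).obj.obj (op V)), p ∈ V ∧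
      mres (K.X j).obj hV x = dsec K i j x₁ := by
  have hm : Mono (HomologicalComplex.homologyMap σ j) := inferInstance
  rw [HomologicalComplex.mono_homologyMap_iff_up_to_refinements σ i j l (by simp [← hi])
    (by simp [hl])] at hm
  obtain ⟨A, a, hA, hA'⟩ := exists_free_section (k := k) U
  obtain ⟨φ, rfl⟩ := hA _ x
  obtain ⟨ψ, rfl⟩ := hA _ y
  obtain ⟨A', π, hπ, x₁, hx₁⟩ := hm φ (hA' _ _ _ hx) ψ (hA' _ _ _ h)
  obtain ⟨V, hV, a', hpV, ha'⟩ := locally_surjective_of_epi π a hp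
  refine ⟨V, hV, x₁.hom.app _ a', hpV, ?_⟩
  rw [mres_hom, ← ha', ← comp_app, hx₁, comp_app]

theorem locally_exact_of_quasiIso_epi (i j l : ℤ) (hi : i + 1 = j) (hl : j + 1 = l) {U : Opens T}
    (y : (I.X j).obj.obj (op U)) (hy : dsec I j l y = 0) {p : T} (hp : p ∈ U) :
    ∃ (V : Opens T) (hV : V ≤ U) (x : (K.X j).obj.obj (op V)) (y₁ : (I.X i).obj.obj (op V)),
      p ∈ V ∧ dsec K j l x = 0 ∧
      mres (I.X j).obj hV y = (σ.f j).hom.app (op V) x + dsec I i j y₁ := by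
  have hm : Epi (HomologicalComplex.homologyMap σ j) := inferInstance
  rw [HomologicalComplex.epi_homologyMap_iff_up_to_refinements σ i j l (by simp [← hi])
    (by simp [hl])] at hm
  obtain ⟨A, a, hA, hA'⟩ := exists_free_section (k := k) U
  obtain ⟨φ, rfl⟩ := hA _ y
  obtain ⟨A', π, hπ, x₂, hx₂, y₁, h⟩ := hm φ (hA' _ _ _ hy)
  obtain ⟨V, hV, a', hpV, ha'⟩ := locally_surjective_of_epi π a hp
  refine ⟨V, hV, x₂.hom.app _ a', y₁.hom.app _ a', hpV, ?_, ?_⟩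
  · rw [dsec, ← comp_app, hx₂]; rfl
  · rw [mres_hom, ← ha', ← comp_app, h]; rfl

end Complexes


/-! ### The Lichnerowicz–Poisson complex inside its injective resolution, on sections. -/

section Resolution

variable (k : Type u) [Field k] {X : Scheme.{u}} [X.Over (Spec (.of k))]
  (Λ : PoissonStructure (X ↘ Spec (.of k)))

/-- Restriction of polyderivations. -/
def polyDerRes {n : ℕ} {U V : X.Opens} (h : V ≤ U) : polyDer k X n U →ₗ[k] polyDer k X n V where
  toFun D := ⟨fun W => D.1 ⟨W.1, W.2.trans h⟩, fun _ => D.2.1 _,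
    fun W W' h' v => D.2.2 ⟨W.1, _⟩ ⟨W'.1, _⟩ h' v⟩
  map_add' _ _ := rfl
  map_smul' _ _ := rfl

/-- The differential `[Λ, -]` on sections. -/
noncomputable def lpd (n : ℕ) (U : X.Opens) : polyDer k X n U →ₗ[k] polyDer k X (n + 1) U :=
  ((lpDifferential k Λ n).hom.app (op U)).hom

/-- The terms of the injective resolution. -/
noncomputable abbrev resI (n : ℤ) : TopCat.Sheaf (ModuleCat.{u} k) X := (lpResolution k Λ).I.X n

/-- The differential of the injective resolution on sections. -/
noncomputable def resd (i j : ℤ) (U : X.Opens) :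
    (resI k Λ i).obj.obj (op U) →ₗ[k] (resI k Λ j).obj.obj (op U) :=
  (((lpResolution k Λ).I.d i j).hom.app (op U)).hom

/-- Restriction of sections of the terms of the injective resolution. -/
noncomputable def resRes {n : ℤ} {U V : X.Opens} (h : V ≤ U) :
    (resI k Λ n).obj.obj (op U) →ₗ[k] (resI k Λ n).obj.obj (op V) :=
  ((resI k Λ n).obj.map (homOfLE h).op).hom

/-- The map to the injective resolution on sections. -/
noncomputable def toRes (n : ℕ) (m : ℤ) (h : 1 + (n : ℤ) = m) (U : X.Opens) :
    polyDer k X (n + 1) U →ₗ[k] (resI k Λ m).obj.obj (op U) :=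
  ((toResolution k Λ n m h).hom.app (op U)).hom

variable {k Λ}

theorem polyDer_ext {n : ℕ} {U : X.Opens} {D E : polyDer k X n U}
    (h : ∀ (W : X.Opens) (hW : W ≤ U) v, D.1 ⟨W, hW⟩ v = E.1 ⟨W, hW⟩ v) : D = E :=
  Subtype.ext (funext fun W => funext fun v => h W.1 W.2 v)

theorem polyDerRes_res {n : ℕ} {U V W : X.Opens} (h : V ≤ U) (h' : W ≤ V) (D : polyDer k X n U) :
    polyDerRes k h' (polyDerRes k h D) = polyDerRes k (h'.trans h) D := rfl

theorem polyDerRes_lpd {n : ℕ} {U V : X.Opens} (h : V ≤ U) (D : polyDer k X n U) :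
    polyDerRes k h (lpd k Λ n U D) = lpd k Λ n V (polyDerRes k h D) := rfl

theorem resRes_res {n : ℤ} {U V W : X.Opens} (h : V ≤ U) (h' : W ≤ V)
    (x : (resI k Λ n).obj.obj (op U)) :
    resRes k Λ h' (resRes k Λ h x) = resRes k Λ (h'.trans h) x := mres_mres _ _ _ _

theorem resRes_self {n : ℤ} {U : X.Opens} (h : U ≤ U)
    (x : (resI k Λ n).obj.obj (op U)) : resRes k Λ h x = x := mres_self _ _ _

theorem resRes_resd {i j : ℤ} {U V : X.Opens} (h : V ≤ U) (x : (resI k Λ i).obj.obj (op U)) :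
    resRes k Λ h (resd k Λ i j U x) = resd k Λ i j V (resRes k Λ h x) := mres_hom _ _ _

theorem resRes_toRes {n : ℕ} {m : ℤ} {hm : 1 + (n : ℤ) = m} {U V : X.Opens} (h : V ≤ U)
    (D : polyDer k X (n + 1) U) :
    resRes k Λ h (toRes k Λ n m hm U D) = toRes k Λ n m hm V (polyDerRes k h D) :=
  mres_hom (toResolution k Λ n m hm) h D

theorem resd_resd {i j l : ℤ} {U : X.Opens} (x : (resI k Λ i).obj.obj (op U)) :
    resd k Λ j l U (resd k Λ i j U x) = 0 := by
  have := (lpResolution k Λ).I.d_comp_d i j l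
  exact congrArg (fun f => f.hom.app (op U) x) this

variable (k Λ) in
/-- The terms of the Lichnerowicz-Poisson complex. -/
noncomputable def lpXIso (n : ℕ) (m : ℤ) (h : 1 + (n : ℤ) = m) :
    polyDerSheaf k X (n + 1) ≅ (lpComplex k Λ).X m :=
  (HomologicalComplex.extendXIso (lpComplexNat k Λ) (ComplexShape.embeddingUpIntGE 1) h).symm

theorem lpComplex_d (n : ℕ) (m m' : ℤ) (h : 1 + (n : ℤ) = m) (h' : 1 + ((n + 1 : ℕ) : ℤ) = m') :
    (lpXIso k Λ n m h).hom ≫ (lpComplex k Λ).d m m' =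
      lpDifferential k Λ (n + 1) ≫ (lpXIso k Λ (n + 1) m' h').hom := by
  have e : (lpComplex k Λ).d m m' =
      (lpXIso k Λ n m h).inv ≫ lpDifferential k Λ (n + 1) ≫ (lpXIso k Λ (n + 1) m' h').hom := by
    have e' := HomologicalComplex.extend_d_eq (lpComplexNat k Λ) (ComplexShape.embeddingUpIntGE 1)
      h h'
    have e'' : (lpComplexNat k Λ).d n (n + 1) = lpDifferential k Λ (n + 1) :=
      CochainComplex.of_d (fun n => polyDerSheaf k X (n + 1))
        (fun n => lpDifferential k Λ (n + 1)) n
    rw [e''] at e'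
    exact e'
  rw [e, Iso.hom_inv_id_assoc]

theorem toResolution_eq (n : ℕ) (m : ℤ) (h : 1 + (n : ℤ) = m) :
    toResolution k Λ n m h = (lpXIso k Λ n m h).hom ≫ (lpResolution k Λ).σ.f m := rfl

theorem resd_toRes {n : ℕ} {m m' : ℤ} {h : 1 + (n : ℤ) = m} {h' : 1 + ((n + 1 : ℕ) : ℤ) = m'}
    {U : X.Opens} (D : polyDer k X (n + 1) U) :
    resd k Λ m m' U (toRes k Λ n m h U D) = toRes k Λ (n + 1) m' h' U (lpd k Λ (n + 1) U D) := by
  have e : toResolution k Λ n m h ≫ (lpResolution k Λ).I.d m m' =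
      lpDifferential k Λ (n + 1) ≫ toResolution k Λ (n + 1) m' h' := by
    rw [toResolution_eq, toResolution_eq, Category.assoc, (lpResolution k Λ).σ.comm,
      ← Category.assoc, lpComplex_d n m m' h h', Category.assoc]
  exact congrArg (fun f => f.hom.app (op U) D) e

theorem polyDer_local {n : ℕ} {U : X.Opens} {D E : polyDer k X n U}
    (h : ∀ p ∈ U, ∃ (V : X.Opens) (hV : V ≤ U), p ∈ V ∧ polyDerRes k hV D = polyDerRes k hV E) :
    D = E :=
  section_ext (polyDerSheaf k X n) h

theorem exists_polyDer_of_local {n : ℕ} {U : X.Opens}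
    (P : ∀ V : X.Opens, V ≤ U → polyDer k X n V → Prop)
    (hP : ∀ V W (hV : V ≤ U) (hW : W ≤ V) x, P V hV x → P W (hW.trans hV) (polyDerRes k hW x))
    (hu : ∀ V hV x y, P V hV x → P V hV y → x = y)
    (he : ∀ p ∈ U, ∃ (V : X.Opens) (hV : V ≤ U) (x : _), p ∈ V ∧ P V hV x) :
    ∃ y : polyDer k X n U, ∀ p ∈ U, ∃ (V : X.Opens) (hV : V ≤ U), p ∈ V ∧
      P V hV (polyDerRes k hV y) :=
  exists_unique_of_local (polyDerSheaf k X n) P hP hu he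

theorem resI_local {n : ℤ} {U : X.Opens} {x y : (resI k Λ n).obj.obj (op U)}
    (h : ∀ p ∈ U, ∃ (V : X.Opens) (hV : V ≤ U), p ∈ V ∧ resRes k Λ hV x = resRes k Λ hV y) :
    x = y :=
  section_ext (resI k Λ n) h

/-- The isomorphism from the sheaf of polyderivations to the term of the complex, on sections. -/
noncomputable def toComplex (n : ℕ) (m : ℤ) (h : 1 + (n : ℤ) = m) (U : X.Opens) :
    polyDer k X (n + 1) U ≃ₗ[k] ((lpComplex k Λ).X m).obj.obj (op U) :=
  LinearEquiv.ofLinearMap (M := polyDer k X (n + 1) U) ((lpXIso k Λ n m h).hom.hom.app (op U)).hom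
    ((lpXIso k Λ n m h).inv.hom.app (op U)).hom
    (LinearMap.ext fun x => congrArg (fun f => f.hom.app (op U) x) (lpXIso k Λ n m h).inv_hom_id)
    (LinearMap.ext fun x => congrArg (fun f => f.hom.app (op U) x) (lpXIso k Λ n m h).hom_inv_id)

theorem toComplex_res (n : ℕ) (m : ℤ) (h : 1 + (n : ℤ) = m) {U V : X.Opens} (hV : V ≤ U)
    (D : polyDer k X (n + 1) U) :
    mres ((lpComplex k Λ).X m).obj hV (toComplex (Λ := Λ) n m h U D) =
      toComplex n m h V (polyDerRes k hV D) :=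
  mres_hom (lpXIso k Λ n m h).hom hV D

theorem dsec_toComplex (n : ℕ) (m m' : ℤ) (h : 1 + (n : ℤ) = m) (h' : 1 + ((n + 1 : ℕ) : ℤ) = m')
    {U : X.Opens} (D : polyDer k X (n + 1) U) :
    dsec (lpComplex k Λ) m m' (toComplex n m h U D) =
      toComplex (n + 1) m' h' U (lpd k Λ (n + 1) U D) :=
  congrArg (fun f => f.hom.app (op U) D) (lpComplex_d (Λ := Λ) n m m' h h')

/-- The complex is zero in degree 0, so a degree 1 cocycle that is locally a boundary vanishes. -/
theorem toRes_exact_one {U : X.Opens} (q : polyDer k X 1 U) (hq : lpd k Λ 1 U q = 0)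
    (α : (resI k Λ 0).obj.obj (op U)) (h : toRes k Λ 0 1 rfl U q = resd k Λ 0 1 U α) : q = 0 := by
  have := (lpResolution k Λ).quasiIso
  refine polyDer_local fun p hp => ?_
  obtain ⟨V, hV, x, hpV, hx⟩ := locally_exact_of_quasiIso_mono (lpResolution k Λ).σ 0 1 2 rfl rfl
    (toComplex 0 1 rfl U q)
    ((dsec_toComplex (Λ := Λ) 0 1 2 rfl rfl q).trans (by
      change toComplex (Λ := Λ) (0 + 1) 2 rfl U (lpd k Λ 1 U q) = 0
      rw [hq, map_zero])) α h hp
  refine ⟨V, hV, hpV, ?_⟩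
  have := lpComplex_isStrictlyGE k Λ
  have hz : (lpComplex k Λ).d 0 1 = 0 :=
    ((lpComplex k Λ).isZero_of_isStrictlyGE 1 0 (by norm_num)).eq_of_src _ _
  have hx' : dsec (lpComplex k Λ) 0 1 x = 0 := by
    rw [dsec, hz]; rfl
  rw [hx', toComplex_res] at hx
  rw [map_zero]
  exact (LinearEquiv.map_eq_zero_iff _).1 hx

/-- Injectivity on `H²` gives `q` with `[Λ, q] = l`. Then `β - q` is a cocycle of `I`, and
surjectivity on `H¹` provides a closed derivation which, added to `q`, leaves only a boundary. -/
theorem toRes_exact_two {U : X.Opens} (l : polyDer k X 2 U) (hl : lpd k Λ 2 U l = 0)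
    (β : (resI k Λ 1).obj.obj (op U)) (h : toRes k Λ 1 2 rfl U l = resd k Λ 1 2 U β)
    {p : X} (hp : p ∈ U) :
    ∃ (V : X.Opens) (hV : V ≤ U) (q : polyDer k X 1 V) (α : (resI k Λ 0).obj.obj (op V)), p ∈ V ∧
      lpd k Λ 1 V q = polyDerRes k hV l ∧
      resRes k Λ hV β = toRes k Λ 0 1 rfl V q + resd k Λ 0 1 V α := by
  have := (lpResolution k Λ).quasiIso
  obtain ⟨V, hV, x, hpV, hx⟩ := locally_exact_of_quasiIso_mono (lpResolution k Λ).σ 1 2 3 rfl rfl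
    (toComplex 1 2 rfl U l)
    ((dsec_toComplex (Λ := Λ) 1 2 3 rfl rfl l).trans (by
      change toComplex (Λ := Λ) (1 + 1) 3 rfl U (lpd k Λ 2 U l) = 0
      rw [hl, map_zero])) β h hp
  obtain ⟨q, rfl⟩ := (toComplex (Λ := Λ) 0 1 rfl V).surjective x
  have hq : lpd k Λ 1 V q = polyDerRes k hV l := by
    rw [toComplex_res] at hx
    have := hx.trans (dsec_toComplex (Λ := Λ) 0 1 2 rfl rfl q)
    exact ((toComplex (Λ := Λ) 1 2 rfl V).injective this).symm
  have hc : resd k Λ 1 2 V (resRes k Λ hV β - toRes k Λ 0 1 rfl V q) = 0 := by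
    rw [map_sub, ← resRes_resd, ← h, resRes_toRes, ← hq, sub_eq_zero]
    exact (resd_toRes (Λ := Λ) (n := 0) (h := rfl) (h' := rfl) q).symm
  obtain ⟨W, hW, y, α, hpW, hy, hα⟩ := locally_exact_of_quasiIso_epi (lpResolution k Λ).σ 0 1 2 rfl
    rfl _ hc hpV
  obtain ⟨q', rfl⟩ := (toComplex (Λ := Λ) 0 1 rfl W).surjective y
  have hq' : lpd k Λ 1 W q' = 0 := by
    have := (dsec_toComplex (Λ := Λ) 0 1 2 rfl rfl q').symm.trans hy
    exact (LinearEquiv.map_eq_zero_iff _).1 this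
  refine ⟨W, hW.trans hV, polyDerRes k hW q + q', α, hpW, ?_, ?_⟩
  · rw [map_add, hq', add_zero, ← polyDerRes_lpd, hq, polyDerRes_res]
  · have hα' : resRes k Λ hW (resRes k Λ hV β - toRes k Λ 0 1 rfl V q) =
        toRes k Λ 0 1 rfl W q' + resd k Λ 0 1 W α := hα
    rw [map_sub, resRes_res, resRes_toRes, sub_eq_iff_eq_add] at hα'
    rw [hα', map_add]
    abel

theorem toRes_surjective_two {U : X.Opens} (z : (resI k Λ 2).obj.obj (op U))
    (hz : resd k Λ 2 3 U z = 0) {p : X} (hp : p ∈ U) :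
    ∃ (V : X.Opens) (hV : V ≤ U) (l : polyDer k X 2 V) (b : (resI k Λ 1).obj.obj (op V)), p ∈ V ∧
      lpd k Λ 2 V l = 0 ∧ resRes k Λ hV z = toRes k Λ 1 2 rfl V l - resd k Λ 1 2 V b := by
  have := (lpResolution k Λ).quasiIso
  obtain ⟨W, hW, y, α, hpW, hy, hα⟩ := locally_exact_of_quasiIso_epi (lpResolution k Λ).σ 1 2 3 rfl
    rfl z hz hp
  obtain ⟨l, rfl⟩ := (toComplex (Λ := Λ) 1 2 rfl W).surjective y
  -- The sign of `α` is changed to match the convention `z = Λ' - d b` of `Represents`.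
  refine ⟨W, hW, l, -α, hpW, ?_, ?_⟩
  · have := (dsec_toComplex (Λ := Λ) 1 2 3 rfl rfl l).symm.trans hy
    exact (LinearEquiv.map_eq_zero_iff _).1 this
  · rw [map_neg, sub_neg_eq_add]
    exact hα

-- Let `Q` be the image of `I⁰ → I¹`. It is injective, so its inclusion `ι` has a retraction `r`,
-- and `N = 𝟙 - r ≫ ι` is a projection with kernel `Q`. It does not change `d`, as `d` vanishes on
-- `Q`. Comparing sections after `N` amounts to comparing them in `I¹` modulo boundaries, without
-- leaving `I¹`. The Čech statement is `cech_of_injective` for `Q`.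
variable (k Λ) in
theorem exists_boundary_projection : ∃ N : resI k Λ 1 ⟶ resI k Λ 1,
    (∀ (U : X.Opens) x, resd k Λ 1 2 U (N.hom.app (op U) x) = resd k Λ 1 2 U x) ∧
    (∀ (U : X.Opens) x, N.hom.app (op U) (resd k Λ 0 1 U x) = 0) ∧
    (∀ (U : X.Opens) x, N.hom.app (op U) x = 0 → ∀ p ∈ U, ∃ (V : X.Opens) (hV : V ≤ U)
      (α : (resI k Λ 0).obj.obj (op V)), p ∈ V ∧ resRes k Λ hV x = resd k Λ 0 1 V α) ∧
    ∀ {ι : Type u} (U : ι → X.Opens) (_ : ⨆ i, U i = ⊤)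
      (c : ∀ i j, (resI k Λ 1).obj.obj (op (U i ⊓ U j)))
      (_ : ∀ i j l, resRes k Λ (inf_le_left : (U i ⊓ U j) ⊓ U l ≤ U i ⊓ U j) (c i j) +
        resRes k Λ (le_inf (inf_le_left.trans inf_le_right) inf_le_right) (c j l) =
        resRes k Λ (le_inf (inf_le_left.trans inf_le_left) inf_le_right) (c i l))
      (_ : ∀ i j, N.hom.app _ (c i j) = 0),
      ∃ b : ∀ i, (resI k Λ 1).obj.obj (op (U i)), (∀ i, N.hom.app _ (b i) = 0) ∧ ∀ i j,
        resRes k Λ inf_le_right (b j) - resRes k Λ inf_le_left (b i) = c i j := by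
  obtain ⟨m, hm⟩ := (lpResolution k Λ).boundedBelow
  have hex : ∀ n ≤ 0, (lpResolution k Λ).I.ExactAt n := by
    intro n hn
    have := (lpResolution k Λ).quasiIso
    have := lpComplex_isStrictlyGE k Λ
    refine (quasiIsoAt_iff_exactAt (lpResolution k Λ).σ n ?_).1 inferInstance
    rw [HomologicalComplex.exactAt_iff]
    exact ShortComplex.exact_of_isZero_X₂ _
      ((lpComplex k Λ).isZero_of_isStrictlyGE 1 n (by omega))
  -- `(1 - m).toNat` steps lead from the lower bound `m` to degree 1.
  obtain ⟨Q, hQ, e, ι, he, hι, hd⟩ := exists_injective_image (lpResolution k Λ).I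
    (lpResolution k Λ).injective m hex (1 - m).toNat 0 1 rfl (by omega) le_rfl
  obtain ⟨r, hr⟩ := hQ.factors (𝟙 Q) ι
  have hιd : ι ≫ (lpResolution k Λ).I.d 1 2 = 0 := by
    rw [← cancel_epi e, ← Category.assoc, hd, HomologicalComplex.d_comp_d, Limits.comp_zero]
  have hN : ∀ (U : X.Opens) (x : (resI k Λ 1).obj.obj (op U)),
      (𝟙 (resI k Λ 1) - r ≫ ι).hom.app (op U) x = x - ι.hom.app _ (r.hom.app _ x) := fun _ _ => rfl
  have hN0 : ∀ (U : X.Opens) (x : (resI k Λ 1).obj.obj (op U)),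
      (𝟙 (resI k Λ 1) - r ≫ ι).hom.app (op U) x = 0 → x = ι.hom.app _ (r.hom.app _ x) := by
    intro U x hx
    rwa [hN, sub_eq_zero] at hx
  have hιN : ι ≫ (𝟙 (resI k Λ 1) - r ≫ ι) = 0 := by
    rw [Preadditive.comp_sub, ← Category.assoc, hr]; simp
  refine ⟨𝟙 _ - r ≫ ι, fun U x => ?_, fun U x => ?_, fun U x hx p hp => ?_, ?_⟩
  · have : (𝟙 _ - r ≫ ι) ≫ (lpResolution k Λ).I.d 1 2 = (lpResolution k Λ).I.d 1 2 := by
      rw [Preadditive.sub_comp, Category.assoc, hιd]; simp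
    exact congrArg (fun f => f.hom.app (op U) x) this
  · have : (lpResolution k Λ).I.d 0 1 ≫ (𝟙 _ - r ≫ ι) = 0 := by
      rw [← hd, Category.assoc, hιN, Limits.comp_zero]
    exact congrArg (fun f => f.hom.app (op U) x) this
  · obtain ⟨V, hV, α, hpV, hα⟩ := locally_surjective_of_epi e (r.hom.app _ x) hp
    refine ⟨V, hV, α, hpV, ?_⟩
    conv_lhs => rw [hN0 U x hx]
    refine (mres_hom ι hV _).trans ?_
    rw [← hα, ← comp_app, hd]
    rfl
  · intro J U hU c hc hcN
    obtain ⟨b, hb⟩ := cech_of_injective Q hQ U hU (fun i j => r.hom.app _ (c i j)) (by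
      intro i j l
      rw [mres_hom, mres_hom, mres_hom, ← map_add]
      exact congrArg _ (hc i j l))
    refine ⟨fun i => ι.hom.app _ (b i), fun i => ?_, fun i j => ?_⟩
    · exact congrArg (fun f => f.hom.app (op (U i)) (b i)) hιN
    · rw [hN0 _ _ (hcN i j), ← hb, map_sub, ← mres_hom, ← mres_hom]
      rfl

variable (k Λ) in
/-- An endomorphism of the term of degree one of the resolution whose kernel is the sheaf of
boundaries. -/
noncomputable def bdProj : resI k Λ 1 ⟶ resI k Λ 1 := (exists_boundary_projection k Λ).choose

variable (k Λ) in
/-- The endomorphism `bdProj` on sections. -/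
noncomputable def bdp (U : X.Opens) :
    (resI k Λ 1).obj.obj (op U) →ₗ[k] (resI k Λ 1).obj.obj (op U) :=
  ((bdProj k Λ).hom.app (op U)).hom

theorem resRes_bdp {U V : X.Opens} (h : V ≤ U) (x : (resI k Λ 1).obj.obj (op U)) :
    resRes k Λ h (bdp k Λ U x) = bdp k Λ V (resRes k Λ h x) :=
  mres_hom (bdProj k Λ) h x

theorem resd_bdp {U : X.Opens} (x : (resI k Λ 1).obj.obj (op U)) :
    resd k Λ 1 2 U (bdp k Λ U x) = resd k Λ 1 2 U x :=
  (exists_boundary_projection k Λ).choose_spec.1 U x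

theorem bdp_resd {U : X.Opens} (x : (resI k Λ 0).obj.obj (op U)) :
    bdp k Λ U (resd k Λ 0 1 U x) = 0 :=
  (exists_boundary_projection k Λ).choose_spec.2.1 U x

theorem exists_boundary_of_bdp {U : X.Opens} (x : (resI k Λ 1).obj.obj (op U))
    (hx : bdp k Λ U x = 0) {p : X} (hp : p ∈ U) : ∃ (V : X.Opens) (hV : V ≤ U)
      (α : (resI k Λ 0).obj.obj (op V)), p ∈ V ∧ resRes k Λ hV x = resd k Λ 0 1 V α :=
  (exists_boundary_projection k Λ).choose_spec.2.2.1 U x hx p hp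

theorem cech_bdp {ι : Type u} (U : ι → X.Opens) (hU : ⨆ i, U i = ⊤)
    (c : ∀ i j, (resI k Λ 1).obj.obj (op (U i ⊓ U j)))
    (hc : ∀ i j l, resRes k Λ (inf_le_left : (U i ⊓ U j) ⊓ U l ≤ U i ⊓ U j) (c i j) +
      resRes k Λ (le_inf (inf_le_left.trans inf_le_right) inf_le_right) (c j l) =
      resRes k Λ (le_inf (inf_le_left.trans inf_le_left) inf_le_right) (c i l))
    (hcN : ∀ i j, bdp k Λ _ (c i j) = 0) :
    ∃ b : ∀ i, (resI k Λ 1).obj.obj (op (U i)), (∀ i, bdp k Λ _ (b i) = 0) ∧ ∀ i j,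
      resRes k Λ inf_le_right (b j) - resRes k Λ inf_le_left (b i) = c i j :=
  (exists_boundary_projection k Λ).choose_spec.2.2.2 U hU c hc hcN

theorem cech_resI {ι : Type u} (U : ι → X.Opens) (hU : ⨆ i, U i = ⊤)
    (c : ∀ i j, (resI k Λ 1).obj.obj (op (U i ⊓ U j)))
    (hc : ∀ i j l, resRes k Λ (inf_le_left : (U i ⊓ U j) ⊓ U l ≤ U i ⊓ U j) (c i j) +
      resRes k Λ (le_inf (inf_le_left.trans inf_le_right) inf_le_right) (c j l) =
      resRes k Λ (le_inf (inf_le_left.trans inf_le_left) inf_le_right) (c i l)) :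
    ∃ b : ∀ i, (resI k Λ 1).obj.obj (op (U i)), ∀ i j,
      resRes k Λ inf_le_right (b j) - resRes k Λ inf_le_left (b i) = c i j :=
  cech_of_injective (resI k Λ 1) ((lpResolution k Λ).injective 1) U hU c hc

theorem eq_zero_of_bdp {U : X.Opens} (q : polyDer k X 1 U) (hq : lpd k Λ 1 U q = 0)
    (h : bdp k Λ U (toRes k Λ 0 1 rfl U q) = 0) : q = 0 := by
  refine polyDer_local fun p hp => ?_
  obtain ⟨V, hV, α, hpV, hα⟩ := exists_boundary_of_bdp _ h hp
  refine ⟨V, hV, hpV, ?_⟩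
  rw [map_zero]
  refine toRes_exact_one (Λ := Λ) _ ?_ α ((resRes_toRes hV q).symm.trans hα)
  rw [← polyDerRes_lpd, hq, map_zero]

/-- Rigidity: if the difference of `q` and `q'` is closed and locally a boundary in `I¹`, it is zero
by `toRes_exact_one`. Every later choice of a derivation is unique, and hence glues, for this
reason. -/
theorem eq_of_bdp {U : X.Opens} (q q' : polyDer k X 1 U) (hq : lpd k Λ 1 U q = lpd k Λ 1 U q')
    (h : bdp k Λ U (toRes k Λ 0 1 rfl U q) = bdp k Λ U (toRes k Λ 0 1 rfl U q')) : q = q' := by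
  rw [← sub_eq_zero]
  refine eq_zero_of_bdp (Λ := Λ) _ ?_ ?_
  · rw [map_sub, hq, sub_self]
  · rw [map_sub, map_sub, h, sub_self]

/-- Local solutions come from `toRes_exact_two`. The equation `[Λ, q] = l` alone leaves `q` free up
to closed derivations; prescribing `q` modulo boundaries makes it unique, and the local solutions
glue. -/
theorem exists_derivation_of_resd {U : X.Opens} (l : polyDer k X 2 U) (hl : lpd k Λ 2 U l = 0)
    (β : (resI k Λ 1).obj.obj (op U)) (h : toRes k Λ 1 2 rfl U l = resd k Λ 1 2 U β) :
    ∃ q : polyDer k X 1 U, lpd k Λ 1 U q = l ∧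
      bdp k Λ U β = bdp k Λ U (toRes k Λ 0 1 rfl U q) := by
  obtain ⟨q, hq⟩ := exists_polyDer_of_local (k := k) (X := X) (U := U) (n := 1)
    (fun V hV (q : polyDer k X 1 V) => lpd k Λ 1 V q = polyDerRes k hV l ∧
      bdp k Λ V (resRes k Λ hV β) = bdp k Λ V (toRes k Λ 0 1 rfl V q))
    (fun V W hV hW q hq => by
      constructor
      · rw [← polyDerRes_lpd, hq.1]
        rfl
      · rw [← resRes_toRes, ← resRes_bdp hW (toRes k Λ 0 1 rfl V q), ← hq.2, resRes_bdp, resRes_res])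
    (fun V hV x y hx hy => eq_of_bdp (Λ := Λ) x y (hx.1.trans hy.1.symm) (hx.2.symm.trans hy.2))
    (fun p hp => by
      obtain ⟨V, hV, q, α, hpV, h1, h2⟩ := toRes_exact_two l hl β h hp
      refine ⟨V, hV, q, hpV, h1, ?_⟩
      rw [h2, map_add, bdp_resd, add_zero])
  refine ⟨q, polyDer_local fun p hp => ?_, resI_local fun p hp => ?_⟩
  · obtain ⟨V, hV, hpV, h1, -⟩ := hq p hp
    exact ⟨V, hV, hpV, h1⟩
  · obtain ⟨V, hV, hpV, -, h2⟩ := hq p hp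
    refine ⟨V, hV, hpV, ?_⟩
    rw [resRes_bdp, resRes_bdp, resRes_toRes]
    exact h2

end Resolution

/-! ### Cycles and homology classes in complexes of vector spaces. -/

section GlobalSections

variable {k : Type u} [Field k]

theorem exists_cycle (K : CochainComplex (ModuleCat.{u} k) ℤ) (i j : ℤ) (h : i + 1 = j) (x : K.X i)
    (hx : K.d i j x = 0) : ∃ z : K.cycles i, K.iCycles i z = x := by
  let f : ModuleCat.of k k ⟶ K.X i := ModuleCat.ofHom (LinearMap.toSpanSingleton k _ x)
  have hf : f ≫ K.d i j = 0 := by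
    refine ModuleCat.hom_ext (LinearMap.ext_ring ?_)
    change K.d i j ((1 : k) • x) = 0
    rw [one_smul, hx]
  refine ⟨K.liftCycles f j (by simp [h]) hf (1 : k), ?_⟩
  have := congrArg (fun g => g (1 : k)) (K.liftCycles_i f j (by simp [h]) hf)
  exact this.trans (one_smul k x)

theorem d_iCycles (K : CochainComplex (ModuleCat.{u} k) ℤ) (i j : ℤ) (z : K.cycles i) :
    K.d i j (K.iCycles i z) = 0 :=
  congrArg (fun g => g z) (K.iCycles_d i j)

theorem homologyπ_surjective (K : CochainComplex (ModuleCat.{u} k) ℤ) (i : ℤ) :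
    Function.Surjective (K.homologyπ i) :=
  (ModuleCat.epi_iff_surjective _).1 inferInstance

theorem homologyπ_eq_iff (K : CochainComplex (ModuleCat.{u} k) ℤ) (i j : ℤ) (h : i + 1 = j)
    (z z' : K.cycles j) : K.homologyπ j z = K.homologyπ j z' ↔
      ∃ w : K.X i, K.iCycles j z' = K.iCycles j z + K.d i j w := by
  have hinj : Function.Injective (K.iCycles j) := (ModuleCat.mono_iff_injective _).1 inferInstance
  have hd : ∀ w, K.iCycles j (K.toCycles i j w) = K.d i j w := fun w =>
    congrArg (fun g => g w) (K.toCycles_i i j)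
  have hex : (ShortComplex.mk (K.toCycles i j) (K.homologyπ j) (by simp)).Exact :=
    ShortComplex.exact_of_g_is_cokernel _ (K.homologyIsCokernel i j (by simp [← h]))
  constructor
  · intro e
    obtain ⟨w, hw⟩ := (ShortComplex.moduleCat_exact_iff _).1 hex (z' - z)
      (by change K.homologyπ j (z' - z) = 0; rw [map_sub, e, sub_self])
    refine ⟨w, ?_⟩
    change K.toCycles i j w = z' - z at hw
    rw [← hd, hw, map_sub]
    abel
  · rintro ⟨w, hw⟩
    have : z' = z + K.toCycles i j w := hinj (by rw [map_add, hd, hw])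
    rw [this, map_add]
    have h0 : K.homologyπ j (K.toCycles i j w) = 0 :=
      congrArg (fun g => g w) (K.toCycles_comp_homologyπ i j)
    rw [h0, add_zero]

end GlobalSections


/-! ### The Schouten bracket with `Λ` in degrees 1 and 2. -/

namespace PoissonBracket

variable {A : Type*} [CommRing A] (P : PoissonBracket A)

theorem neg_left (a b : A) : P.br (-a) b = -P.br a b := by
  rw [P.skew, P.neg_right, P.skew a b]

theorem sub_left (a b c : A) : P.br (a - b) c = P.br a c - P.br b c := by
  rw [sub_eq_add_neg, P.add_left, P.neg_left, sub_eq_add_neg]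

/-- The sign `(-1) ^ (n + 1)` is `+1` here. The right side measures how far `Q` is from being a
derivation of the bracket. -/
theorem schouten_one (Q : (Fin 1 → A) → A) (v : Fin 2 → A) : P.schouten Q v =
    P.br (v 0) (Q ![v 1]) + P.br (Q ![v 0]) (v 1) - Q ![P.br (v 0) (v 1)] := by
  have h0 : (0 : Fin 2).removeNth v = ![v 1] := by ext i; fin_cases i; rfl
  have h1 : (1 : Fin 2).removeNth v = ![v 0] := by ext i; fin_cases i; rfl
  have h2 : (0 : Fin 2).removeNth (Function.update v 1 (P.br (v 0) (v 1))) =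
      ![P.br (v 0) (v 1)] := by
    ext i; fin_cases i; rfl
  have e0 : Finset.Ioi (0 : Fin 2) = {1} := by decide
  have e1 : Finset.Ioi (1 : Fin 2) = ∅ := by decide
  rw [schouten, ce, Fin.sum_univ_two, e0, e1, Finset.sum_singleton, Finset.sum_empty, h0, h1, h2,
    P.skew (Q ![v 0])]
  simp
  ring

/-- The sign `(-1) ^ (n + 1)` is `-1` here. The sum inside is the `ε`-part of the Jacobi identity
for the bracket perturbed by `εQ`. -/
theorem schouten_two (Q : (Fin 2 → A) → A) (v : Fin 3 → A) : P.schouten Q v =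
    -(P.br (v 0) (Q ![v 1, v 2]) - P.br (v 1) (Q ![v 0, v 2]) + P.br (v 2) (Q ![v 0, v 1])
      - Q ![P.br (v 0) (v 1), v 2] - Q ![v 1, P.br (v 0) (v 2)] + Q ![v 0, P.br (v 1) (v 2)]) := by
  have h0 : (0 : Fin 3).removeNth v = ![v 1, v 2] := by ext i; fin_cases i <;> rfl
  have h1 : (1 : Fin 3).removeNth v = ![v 0, v 2] := by ext i; fin_cases i <;> rfl
  have h2 : (2 : Fin 3).removeNth v = ![v 0, v 1] := by ext i; fin_cases i <;> rfl
  have h3 : (0 : Fin 3).removeNth (Function.update v 1 (P.br (v 0) (v 1))) =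
      ![P.br (v 0) (v 1), v 2] := by
    ext i; fin_cases i <;> rfl
  have h4 : (0 : Fin 3).removeNth (Function.update v 2 (P.br (v 0) (v 2))) =
      ![v 1, P.br (v 0) (v 2)] := by
    ext i; fin_cases i <;> rfl
  have h5 : (1 : Fin 3).removeNth (Function.update v 2 (P.br (v 1) (v 2))) =
      ![v 0, P.br (v 1) (v 2)] := by
    ext i; fin_cases i <;> rfl
  have e0 : Finset.Ioi (0 : Fin 3) = {1, 2} := by decide
  have e1 : Finset.Ioi (1 : Fin 3) = {2} := by decide
  have e2 : Finset.Ioi (2 : Fin 3) = ∅ := by decide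
  rw [schouten, ce, Fin.sum_univ_three, e0, e1, e2, Finset.sum_pair (by decide),
    Finset.sum_singleton, Finset.sum_empty, h0, h1, h2, h3, h4, h5]
  simp
  ring

end PoissonBracket

/-! ### Poisson extensions of `𝒪_X`, their splittings, differences and bivectors. -/

section Extensions

variable {k : Type u} [Field k] {X : Scheme.{u}} [X.Over (Spec (.of k))]

theorem vec_one {A : Type*} (v : Fin 1 → A) : ![v 0] = v := by ext i; fin_cases i; rfl

theorem vec_two {A : Type*} (v : Fin 2 → A) : ![v 0, v 1] = v := by ext i; fin_cases i <;> rfl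

theorem update_one {A : Type*} (v : Fin 1 → A) (i : Fin 1) (a : A) :
    Function.update v i a = ![a] := by
  ext j; fin_cases i; fin_cases j; rfl

/-- A sheaf-theoretic first-order Poisson deformation: an extension of `𝒪_X` by itself as a sheaf of
Poisson `k`-algebras, with `e` multiplication by `ε`. -/
structure SheafExt (Λ : PoissonStructure (X ↘ Spec (.of k))) where
  F : TopCat.Presheaf CommRingCat.{u} X
  isSheaf : F.IsSheaf
  π : ∀ U : X.Opens, F.obj (op U) →+* Γ(X, U)
  π_res : ∀ (U V : X.Opens) (h : V ≤ U) a, π V ((F.map (homOfLE h).op).hom a) = res X h (π U a)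
  e : ∀ U : X.Opens, Γ(X, U) →+ F.obj (op U)
  e_res : ∀ (U V : X.Opens) (h : V ≤ U) a, (F.map (homOfLE h).op).hom (e U a) = e V (res X h a)
  π_e : ∀ U a, π U (e U a) = 0
  e_injective : ∀ U, Function.Injective (e U)
  exact : ∀ U a, π U a = 0 → ∃ b, e U b = a
  mul_e : ∀ U a b, a * e U b = e U (π U a * b)
  const : ∀ U : X.Opens, k →+* F.obj (op U)
  const_res : ∀ (U V : X.Opens) (h : V ≤ U) c, (F.map (homOfLE h).op).hom (const U c) = const V c
  π_const : ∀ U c, π U (const U c) = algebraMap k Γ(X, U) c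
  bracket : ∀ U : X.Opens, PoissonBracket (F.obj (op U))
  bracket_res : ∀ (U V : X.Opens) (h : V ≤ U) a b, (F.map (homOfLE h).op).hom ((bracket U).br a b) =
    (bracket V).br ((F.map (homOfLE h).op).hom a) ((F.map (homOfLE h).op).hom b)
  bracket_const : ∀ U c a, (bracket U).br (const U c) a = 0
  π_br : ∀ U a b, π U ((bracket U).br a b) = (Λ.bracket U).br (π U a) (π U b)
  br_e : ∀ U a b, (bracket U).br (e U a) b = e U ((Λ.bracket U).br a (π U b))

namespace SheafExt

variable {Λ : PoissonStructure (X ↘ Spec (.of k))} (M M' : SheafExt Λ)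

/-- Sections. -/
abbrev sec (U : X.Opens) : Type u := M.F.obj (op U)

/-- Restriction of sections. -/
abbrev rs {U V : X.Opens} (h : V ≤ U) : M.sec U →+* M.sec V := (M.F.map (homOfLE h).op).hom

theorem rs_rs {U V W : X.Opens} (h : V ≤ U) (h' : W ≤ V) (a : M.sec U) :
    M.rs h' (M.rs h a) = M.rs (h'.trans h) a := by
  have : (homOfLE (h'.trans h)).op = (homOfLE h).op ≫ (homOfLE h').op := rfl
  simp [rs, this]

theorem e_mul_e (U : X.Opens) (a b : Γ(X, U)) : M.e U a * M.e U b = 0 := by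
  rw [M.mul_e, M.π_e, zero_mul, map_zero]

theorem br_e_right (U : X.Opens) (a : M.sec U) (b : Γ(X, U)) :
    (M.bracket U).br a (M.e U b) = M.e U ((Λ.bracket U).br (M.π U a) b) := by
  rw [(M.bracket U).skew, M.br_e, (Λ.bracket U).skew, map_neg, neg_neg]

theorem sec_local {U : X.Opens} {a b : M.sec U} (h : ∀ p ∈ U, ∃ (V : X.Opens) (hV : V ≤ U), p ∈ V ∧
    M.rs hV a = M.rs hV b) : a = b := by
  choose V hV hp hab using fun p : U => h p.1 p.2
  exact TopCat.Sheaf.eq_of_locally_eq' ⟨M.F, M.isSheaf⟩ V U (fun p => homOfLE (hV p))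
    (fun p hpU => Opens.mem_iSup.2 ⟨⟨p, hpU⟩, hp _⟩) a b fun p => hab p

theorem exists_sec_glue {U : X.Opens} {ι : Type u} (V : ι → X.Opens) (hV : ∀ i, V i ≤ U)
    (hc : U ≤ ⨆ i, V i) (a : ∀ i, M.sec (V i))
    (h : ∀ i j, M.rs (inf_le_left : V i ⊓ V j ≤ V i) (a i) = M.rs inf_le_right (a j)) :
    ∃ b : M.sec U, ∀ i, M.rs (hV i) b = a i := by
  obtain ⟨s, hs, -⟩ := TopCat.Sheaf.existsUnique_gluing' ⟨M.F, M.isSheaf⟩ V U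
    (fun i => homOfLE (hV i)) hc a h
  exact ⟨s, hs⟩

/-- A splitting over `U`: a section of `π` over `U` by a morphism of sheaves of `k`-algebras. -/
structure Spl (U : X.Opens) where
  s : ∀ W : X.Opens, W ≤ U → Γ(X, W) →+* M.sec W
  π_s : ∀ W h f, M.π W (s W h f) = f
  s_res : ∀ W h W' (h' : W' ≤ W) f, M.rs h' (s W h f) = s W' (h'.trans h) (res X h' f)
  s_const : ∀ W h (c : k), s W h (algebraMap k _ c) = M.const W c

namespace Spl

variable {M M'} {U V : X.Opens}

theorem s_smul (s : M.Spl U) {W : X.Opens} (h : W ≤ U) (c : k) (f : Γ(X, W)) :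
    s.s W h (c • f) = M.const W c * s.s W h f := by
  rw [Algebra.smul_def, map_mul, s.s_const]

theorem const_mul_e (M : SheafExt Λ) {W : X.Opens} (c : k) (f : Γ(X, W)) :
    M.const W c * M.e W f = M.e W (c • f) := by
  rw [M.mul_e, M.π_const, Algebra.smul_def]

/-- Restriction of a splitting. -/
def restrict (s : M.Spl U) (h : V ≤ U) : M.Spl V where
  s W hW := s.s W (hW.trans h)
  π_s _ _ := s.π_s _ _
  s_res _ _ := s.s_res _ _
  s_const _ _ := s.s_const _ _

theorem exists_sub (t s : M.Spl U) (W : X.Opens) (h : W ≤ U) (f : Γ(X, W)) :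
    ∃ a, M.e W a = t.s W h f - s.s W h f :=
  M.exact W _ (by rw [map_sub, t.π_s, s.π_s, sub_self])

/-- The difference of two splittings, as a function. -/
noncomputable def subFun (t s : M.Spl U) (W : X.Opens) (h : W ≤ U) (f : Γ(X, W)) : Γ(X, W) :=
  (exists_sub t s W h f).choose

theorem e_subFun (t s : M.Spl U) (W : X.Opens) (h : W ≤ U) (f : Γ(X, W)) :
    M.e W (subFun t s W h f) = t.s W h f - s.s W h f :=
  (exists_sub t s W h f).choose_spec

/-- The difference of two splittings, a derivation. -/
noncomputable def sub (t s : M.Spl U) : polyDer k X 1 U :=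
  ⟨fun W v => subFun t s W.1 W.2 (v 0), by
    have hs : ∀ (W : {W : X.Opens // W ≤ U}) (f : Γ(X, W.1)),
        M.e W.1 (subFun t s W.1 W.2 f) = t.s W.1 W.2 f - s.s W.1 W.2 f :=
      fun W f => e_subFun t s W.1 W.2 f
    refine ⟨fun W => ⟨fun v i a b => ?_, fun v i c a => ?_, fun v i a b => ?_,
      fun v i j _ hij => absurd (Subsingleton.elim i j) hij⟩, fun W W' h v => ?_⟩
    · refine M.e_injective W.1 ?_
      simp only [map_add, hs, update_one, Matrix.cons_val_zero]
      ring
    · refine M.e_injective W.1 ?_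
      rw [← const_mul_e]
      simp only [hs, update_one, Matrix.cons_val_zero, s_smul]
      ring
    · refine M.e_injective W.1 ?_
      have e1 := M.mul_e W.1 (t.s W.1 W.2 a) (subFun t s W.1 W.2 b)
      have e2 := M.mul_e W.1 (s.s W.1 W.2 b) (subFun t s W.1 W.2 a)
      rw [hs, t.π_s] at e1
      rw [hs, s.π_s] at e2
      simp only [map_add, hs, update_one, Matrix.cons_val_zero, map_mul, ← e1, ← e2]
      ring
    · refine M.e_injective W'.1 ?_
      rw [← M.e_res W.1 W'.1 h, hs, hs, map_sub]
      exact congrArg₂ _ (t.s_res W.1 W.2 W'.1 h _) (s.s_res W.1 W.2 W'.1 h _)⟩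

theorem e_sub (t s : M.Spl U) (W : X.Opens) (h : W ≤ U) (f : Γ(X, W)) :
    M.e W ((sub t s).1 ⟨W, h⟩ ![f]) = t.s W h f - s.s W h f :=
  e_subFun t s W h f

theorem exists_lam (s : M.Spl U) (W : X.Opens) (h : W ≤ U) (f g : Γ(X, W)) :
    ∃ a, M.e W a = (M.bracket W).br (s.s W h f) (s.s W h g) - s.s W h ((Λ.bracket W).br f g) :=
  M.exact W _ (by rw [map_sub, M.π_br, s.π_s, s.π_s, s.π_s, sub_self])

/-- The first-order term of the bracket in a splitting, as a function. -/
noncomputable def lamFun (s : M.Spl U) (W : X.Opens) (h : W ≤ U) (f g : Γ(X, W)) : Γ(X, W) :=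
  (exists_lam s W h f g).choose

theorem e_lamFun (s : M.Spl U) (W : X.Opens) (h : W ≤ U) (f g : Γ(X, W)) :
    M.e W (lamFun s W h f g) =
      (M.bracket W).br (s.s W h f) (s.s W h g) - s.s W h ((Λ.bracket W).br f g) :=
  (exists_lam s W h f g).choose_spec

/-- The first-order term of the bracket in a splitting. -/
noncomputable def lam (s : M.Spl U) : polyDer k X 2 U :=
  ⟨fun W v => lamFun s W.1 W.2 (v 0) (v 1), by
    have hs : ∀ (W : {W : X.Opens // W ≤ U}) (f g : Γ(X, W.1)),
        M.e W.1 (lamFun s W.1 W.2 f g) = (M.bracket W.1).br (s.s W.1 W.2 f) (s.s W.1 W.2 g)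
          - s.s W.1 W.2 ((Λ.bracket W.1).br f g) :=
      fun W f g => e_lamFun s W.1 W.2 f g
    have hc : ∀ (W : {W : X.Opens // W ≤ U}) (c : k) (f : Γ(X, W.1)),
        (Λ.bracket W.1).br (c • f) = fun g => c • (Λ.bracket W.1).br f g := by
      intro W c f
      ext g
      rw [Algebra.smul_def, PoissonBracket.leibniz, algebraMap_br, mul_zero, add_zero,
        Algebra.smul_def]
    have hc' : ∀ (W : {W : X.Opens // W ≤ U}) (c : k) (f g : Γ(X, W.1)),
        (Λ.bracket W.1).br f (c • g) = c • (Λ.bracket W.1).br f g := by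
      intro W c f g
      rw [PoissonBracket.skew, hc, (Λ.bracket W.1).skew f g, smul_neg]
    have hd : ∀ (W : {W : X.Opens // W ≤ U}) (c : k) (a b : M.sec W.1),
        (M.bracket W.1).br (M.const W.1 c * a) b = M.const W.1 c * (M.bracket W.1).br a b := by
      intro W c a b
      rw [PoissonBracket.leibniz, M.bracket_const, mul_zero, add_zero]
    have hd' : ∀ (W : {W : X.Opens // W ≤ U}) (c : k) (a b : M.sec W.1),
        (M.bracket W.1).br a (M.const W.1 c * b) = M.const W.1 c * (M.bracket W.1).br a b := by
      intro W c a b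
      rw [PoissonBracket.skew, hd, (M.bracket W.1).skew a b, mul_neg]
    refine ⟨fun W => ⟨fun v i a b => ?_, fun v i c a => ?_, fun v i a b => ?_,
      fun v i j hv hij => ?_⟩, fun W W' h v => ?_⟩
    · refine M.e_injective W.1 ?_
      fin_cases i <;> simp [hs, PoissonBracket.add_left, PoissonBracket.add_right] <;> ring
    · refine M.e_injective W.1 ?_
      rw [← const_mul_e]
      fin_cases i <;> simp [hs, s_smul, hc, hc', hd, hd'] <;> ring
    · refine M.e_injective W.1 ?_
      have h1 : ∀ a f g, M.e W.1 (a * lamFun s W.1 W.2 f g) = s.s W.1 W.2 a *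
          ((M.bracket W.1).br (s.s W.1 W.2 f) (s.s W.1 W.2 g)
          - s.s W.1 W.2 ((Λ.bracket W.1).br f g)) := by
        intro a f g
        rw [← hs, M.mul_e, s.π_s]
      fin_cases i <;>
        simp [h1, hs, PoissonBracket.leibniz, PoissonBracket.leibniz_right] <;> ring
    · refine M.e_injective W.1 ?_
      have : v 0 = v 1 := by
        fin_cases i <;> fin_cases j <;> first | exact absurd rfl hij | exact hv | exact hv.symm
      rw [hs, this, PoissonBracket.self, PoissonBracket.self]
      simp
    · refine M.e_injective W'.1 ?_
      rw [← M.e_res W.1 W'.1 h, hs, hs, map_sub, M.bracket_res]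
      have e := s.s_res W.1 W.2 W'.1 h
      simp only [rs] at e
      rw [e, e, e, Λ.res_br]⟩

theorem e_lam (s : M.Spl U) (W : X.Opens) (h : W ≤ U) (f g : Γ(X, W)) :
    M.e W (s.lam.1 ⟨W, h⟩ ![f, g]) =
      (M.bracket W).br (s.s W h f) (s.s W h g) - s.s W h ((Λ.bracket W).br f g) :=
  e_lamFun s W h f g

theorem sub_unique {t s : M.Spl U} {q : polyDer k X 1 U}
    (h : ∀ W hW f, M.e W (q.1 ⟨W, hW⟩ ![f]) = t.s W hW f - s.s W hW f) : sub t s = q :=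
  polyDer_ext fun W hW v => M.e_injective W (by rw [← vec_one v, e_sub, h])

theorem lam_unique {s : M.Spl U} {l : polyDer k X 2 U}
    (h : ∀ W hW f g, M.e W (l.1 ⟨W, hW⟩ ![f, g]) =
      (M.bracket W).br (s.s W hW f) (s.s W hW g) - s.s W hW ((Λ.bracket W).br f g)) : s.lam = l :=
  polyDer_ext fun W hW v => M.e_injective W (by rw [← vec_two v, e_lam, h])

theorem sub_restrict (t s : M.Spl U) (h : V ≤ U) :
    sub (t.restrict h) (s.restrict h) = polyDerRes k h (sub t s) := rfl

theorem lam_restrict (s : M.Spl U) (h : V ≤ U) : (s.restrict h).lam = polyDerRes k h s.lam := rfl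

theorem sub_self (s : M.Spl U) : sub s s = 0 :=
  sub_unique fun W hW f => by
    rw [_root_.sub_self]
    exact map_zero _

theorem sub_add_sub (t s r : M.Spl U) : sub t s + sub s r = sub t r :=
  (sub_unique fun W hW f => by
    have : M.e W ((sub t s + sub s r).1 ⟨W, hW⟩ ![f]) =
      M.e W ((sub t s).1 ⟨W, hW⟩ ![f]) + M.e W ((sub s r).1 ⟨W, hW⟩ ![f]) := map_add _ _ _
    rw [this, e_sub, e_sub]
    ring).symm

/-- The splitting `s + ε q`. -/
noncomputable def vadd (s : M.Spl U) (q : polyDer k X 1 U) : M.Spl U where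
  s W h :=
    { toFun := fun f => s.s W h f + M.e W (q.1 ⟨W, h⟩ ![f])
      map_one' := by
        have : q.1 ⟨W, h⟩ ![1] = 0 := by
          have := (q.2.1 ⟨W, h⟩).leibniz ![1] 0 1 1
          simp only [update_one, mul_one, one_mul] at this
          simpa using this
        rw [this, map_zero, map_one, add_zero]
      map_mul' := fun a b => by
        have := (q.2.1 ⟨W, h⟩).leibniz ![1] 0 a b
        simp only [update_one] at this
        rw [this, map_add, map_mul]
        have e1 := M.mul_e W (s.s W h a) (q.1 ⟨W, h⟩ ![b])
        have e2 := M.mul_e W (s.s W h b) (q.1 ⟨W, h⟩ ![a])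
        rw [s.π_s] at e1 e2
        rw [← e1, ← e2]
        -- The only obstruction to multiplicativity is the product of two elements of the kernel,
        -- which is zero.
        linear_combination -M.e_mul_e W (q.1 ⟨W, h⟩ ![a]) (q.1 ⟨W, h⟩ ![b])
      map_zero' := by
        have := (q.2.1 ⟨W, h⟩).smul ![1] 0 0 0
        simp only [update_one, zero_smul] at this
        rw [this, map_zero, map_zero, add_zero]
      map_add' := fun a b => by
        have := (q.2.1 ⟨W, h⟩).add ![1] 0 a b
        simp only [update_one] at this
        rw [this, map_add, map_add]
        ring }
  π_s W h f := by simp [s.π_s, M.π_e]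
  s_res W h W' h' f := by
    have hq := q.2.2 ⟨W, h⟩ ⟨W', h'.trans h⟩ h' ![f]
    have : (fun i => res X h' ((![f] : Fin 1 → _) i)) = ![res X h' f] := by
      ext i; fin_cases i; rfl
    rw [this] at hq
    change M.rs h' (s.s W h f + M.e W (q.1 ⟨W, h⟩ ![f])) = s.s W' _ _ + M.e W' _
    rw [map_add, s.s_res, ← hq]
    exact congrArg _ (M.e_res W W' h' _)
  s_const W h c := by
    have : q.1 ⟨W, h⟩ ![algebraMap k _ c] = 0 := by
      have h1 := (q.2.1 ⟨W, h⟩).leibniz ![1] 0 1 1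
      have := (q.2.1 ⟨W, h⟩).smul ![1] 0 c 1
      simp only [update_one, mul_one, one_mul] at this h1
      rw [Algebra.algebraMap_eq_smul_one, this]
      have h2 : q.1 ⟨W, h⟩ ![1] = 0 := by simpa using h1
      rw [h2, smul_zero]
    change s.s W h _ + M.e W _ = _
    rw [this, map_zero, add_zero, s.s_const]

theorem sub_vadd (s : M.Spl U) (q : polyDer k X 1 U) : sub (s.vadd q) s = q :=
  sub_unique fun W hW f => by
    change _ = (s.s W hW f + M.e W _) - _
    ring

/-- Expand `{t f, t g} - {s f, s g}` as `{t f, (t - s) g} + {(t - s) f, s g}`. Both terms have an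
argument in the kernel, where the bracket is that of `Λ`; subtracting `(t - s) {f, g}` gives
`schouten_one`. -/
theorem lpd_sub (t s : M.Spl U) : lpd k Λ 1 U (sub t s) = t.lam - s.lam := by
  refine polyDer_ext fun W hW v => M.e_injective W ?_
  have e1 : (lpd k Λ 1 U (sub t s)).1 ⟨W, hW⟩ v = _ :=
    (Λ.bracket W).schouten_one ((sub t s).1 ⟨W, hW⟩) v
  have e2 : (t.lam - s.lam).1 ⟨W, hW⟩ v =
    t.lam.1 ⟨W, hW⟩ ![v 0, v 1] - s.lam.1 ⟨W, hW⟩ ![v 0, v 1] := by rw [vec_two]; rfl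
  have h1 := M.br_e_right W (t.s W hW (v 0)) ((sub t s).1 ⟨W, hW⟩ ![v 1])
  have h2 := M.br_e W ((sub t s).1 ⟨W, hW⟩ ![v 0]) (s.s W hW (v 1))
  rw [t.π_s] at h1
  rw [s.π_s] at h2
  rw [e1, e2, map_sub, map_sub, map_add, e_lam, e_lam, ← h1, ← h2, e_sub, e_sub, e_sub,
    PoissonBracket.sub_left, PoissonBracket.sub_right]
  ring

/-- The Jacobi identity of the extension, evaluated on `s a, s b, s c`, minus the image under `s` of
the Jacobi identity of `Λ`. -/
theorem lpd_lam (s : M.Spl U) : lpd k Λ 2 U s.lam = 0 := by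
  refine polyDer_ext fun W hW v => M.e_injective W ?_
  have e1 : (lpd k Λ 2 U s.lam).1 ⟨W, hW⟩ v = _ := (Λ.bracket W).schouten_two (s.lam.1 ⟨W, hW⟩) v
  have h : ∀ a b c : Γ(X, W), M.e W ((Λ.bracket W).br a (s.lam.1 ⟨W, hW⟩ ![b, c])) =
      (M.bracket W).br (s.s W hW a) ((M.bracket W).br (s.s W hW b) (s.s W hW c)) -
        (M.bracket W).br (s.s W hW a) (s.s W hW ((Λ.bracket W).br b c)) := by
    intro a b c
    have h1 := M.br_e_right W (s.s W hW a) (s.lam.1 ⟨W, hW⟩ ![b, c])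
    rw [s.π_s] at h1
    rw [← h1, e_lam, PoissonBracket.sub_right]
  have e0 : M.e W ((0 : polyDer k X 3 U).1 ⟨W, hW⟩ v) = 0 := map_zero _
  rw [e1, e0]
  generalize v 0 = a, v 1 = b, v 2 = c
  change Γ(X, W) at a b c
  simp only [map_neg, map_sub, map_add]
  rw [h, h, h, e_lam, e_lam, e_lam]
  have j1 := (M.bracket W).jacobi' (s.s W hW a) (s.s W hW b) (s.s W hW c)
  have j2 := congrArg (s.s W hW) ((Λ.bracket W).jacobi' a b c)
  rw [map_add] at j2
  have k1 := (M.bracket W).skew (s.s W hW ((Λ.bracket W).br a b)) (s.s W hW c)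
  have k2 := (M.bracket W).skew ((M.bracket W).br (s.s W hW a) (s.s W hW b)) (s.s W hW c)
  linear_combination -j1 + j2 + k1 - k2

end Spl

/-- A morphism of extensions. -/
structure Hom where
  φ : ∀ U : X.Opens, M.sec U →+* M'.sec U
  φ_res : ∀ (U V : X.Opens) (h : V ≤ U) a, M'.rs h (φ U a) = φ V (M.rs h a)
  π_φ : ∀ U a, M'.π U (φ U a) = M.π U a
  φ_e : ∀ U a, φ U (M.e U a) = M'.e U a
  φ_const : ∀ U c, φ U (M.const U c) = M'.const U c
  φ_br : ∀ U a b, φ U ((M.bracket U).br a b) = (M'.bracket U).br (φ U a) (φ U b)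

namespace Hom

variable {M M'}

/-- The image of a splitting under a morphism of extensions. -/
def mapSpl (f : M.Hom M') {U : X.Opens} (s : M.Spl U) : M'.Spl U where
  s W h := (f.φ W).comp (s.s W h)
  π_s W h a := by simp [f.π_φ, s.π_s]
  s_res W h W' h' a := by
    rw [RingHom.comp_apply, f.φ_res, s.s_res]
    rfl
  s_const W h c := by simp [f.φ_const, s.s_const]

theorem sub_mapSpl (f : M.Hom M') {U : X.Opens} (t s : M.Spl U) :
    Spl.sub (f.mapSpl t) (f.mapSpl s) = Spl.sub t s :=
  Spl.sub_unique fun W hW a => by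
    rw [← f.φ_e, Spl.e_sub, map_sub]
    rfl

theorem lam_mapSpl (f : M.Hom M') {U : X.Opens} (s : M.Spl U) :
    (f.mapSpl s).lam = s.lam :=
  Spl.lam_unique fun W hW a b => by
    rw [← f.φ_e, Spl.e_lam, map_sub, f.φ_br]
    rfl

end Hom

end SheafExt

end Extensions


/-! ### Comparison of extensions through splittings, and their classes in `HP²`. -/

namespace SheafExt

variable {k : Type u} [Field k] {X : Scheme.{u}} [X.Over (Spec (.of k))]
  {Λ : PoissonStructure (X ↘ Spec (.of k))} {M M' : SheafExt Λ}

namespace Spl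

variable {U : X.Opens}

/-- The coordinate of a section in a splitting. -/
noncomputable def coord (s : M.Spl U) (W : X.Opens) (h : W ≤ U) (a : M.sec W) : Γ(X, W) :=
  (M.exact W (a - s.s W h (M.π W a)) (by rw [map_sub, s.π_s, _root_.sub_self])).choose

theorem e_coord (s : M.Spl U) (W : X.Opens) (h : W ≤ U) (a : M.sec W) :
    M.e W (s.coord W h a) = a - s.s W h (M.π W a) :=
  (M.exact W (a - s.s W h (M.π W a)) (by rw [map_sub, s.π_s, _root_.sub_self])).choose_spec

theorem eq_add_coord (s : M.Spl U) {W : X.Opens} (h : W ≤ U) (a : M.sec W) :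
    a = s.s W h (M.π W a) + M.e W (s.coord W h a) := by
  rw [e_coord]; ring

theorem coord_eq (s : M.Spl U) {W : X.Opens} (h : W ≤ U) {a : M.sec W} {b : Γ(X, W)}
    (hb : a = s.s W h (M.π W a) + M.e W b) : s.coord W h a = b :=
  M.e_injective W (by rw [e_coord]; linear_combination hb)

theorem coord_s (s : M.Spl U) {W : X.Opens} (h : W ≤ U) (f : Γ(X, W)) :
    s.coord W h (s.s W h f) = 0 :=
  s.coord_eq h (by rw [s.π_s, map_zero, add_zero])

theorem coord_e (s : M.Spl U) {W : X.Opens} (h : W ≤ U) (f : Γ(X, W)) :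
    s.coord W h (M.e W f) = f :=
  s.coord_eq h (by rw [M.π_e, map_zero, zero_add])

theorem coord_add (s : M.Spl U) {W : X.Opens} (h : W ≤ U) (a b : M.sec W) :
    s.coord W h (a + b) = s.coord W h a + s.coord W h b :=
  s.coord_eq h (by rw [map_add, map_add, map_add, e_coord, e_coord]; ring)

theorem coord_mul (s : M.Spl U) {W : X.Opens} (h : W ≤ U) (a b : M.sec W) :
    s.coord W h (a * b) = M.π W a * s.coord W h b + M.π W b * s.coord W h a :=
  s.coord_eq h (by
    rw [map_add, ← M.mul_e, ← M.mul_e, map_mul, map_mul, e_coord, e_coord]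
    have := M.e_mul_e W (s.coord W h a) (s.coord W h b)
    rw [e_coord, e_coord] at this
    linear_combination -this)

theorem coord_one (s : M.Spl U) {W : X.Opens} (h : W ≤ U) : s.coord W h 1 = 0 :=
  s.coord_eq h (by simp)

theorem coord_zero (s : M.Spl U) {W : X.Opens} (h : W ≤ U) : s.coord W h 0 = 0 :=
  s.coord_eq h (by simp)

theorem coord_res (s : M.Spl U) {W W' : X.Opens} (h : W ≤ U) (h' : W' ≤ W) (a : M.sec W) :
    s.coord W' (h'.trans h) (M.rs h' a) = res X h' (s.coord W h a) :=
  s.coord_eq _ (by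
    rw [← M.e_res W W' h', M.π_res W W' h', ← s.s_res W h W' h', ← map_add, ← s.eq_add_coord h])

/-- The isomorphism of extensions over `U` given by splittings of both. -/
noncomputable def transport (s : M.Spl U) (s' : M'.Spl U) (W : X.Opens) (h : W ≤ U) :
    M.sec W →+* M'.sec W where
  toFun a := s'.s W h (M.π W a) + M'.e W (s.coord W h a)
  map_one' := by simp [coord_one]
  map_zero' := by simp [coord_zero]
  map_add' a b := by
    rw [map_add, map_add, coord_add, map_add]; ring
  map_mul' a b := by
    have e1 := M'.mul_e W (s'.s W h (M.π W a)) (s.coord W h b)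
    have e2 := M'.mul_e W (s'.s W h (M.π W b)) (s.coord W h a)
    rw [s'.π_s] at e1 e2
    rw [map_mul, map_mul, coord_mul, map_add, ← e1, ← e2]
    linear_combination -M'.e_mul_e W (s.coord W h a) (s.coord W h b)

variable (s t : M.Spl U) (s' t' : M'.Spl U)

theorem transport_apply {W : X.Opens} (h : W ≤ U) (a : M.sec W) :
    transport s s' W h a = s'.s W h (M.π W a) + M'.e W (s.coord W h a) := rfl

theorem transport_res {W W' : X.Opens} (h : W ≤ U) (h' : W' ≤ W) (a : M.sec W) :
    M'.rs h' (transport s s' W h a) = transport s s' W' (h'.trans h) (M.rs h' a) := by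
  rw [transport_apply, transport_apply, map_add, s'.s_res, M'.e_res W W' h', coord_res s h,
    M.π_res W W' h']

theorem π_transport {W : X.Opens} (h : W ≤ U) (a : M.sec W) :
    M'.π W (transport s s' W h a) = M.π W a := by
  rw [transport_apply, map_add, M'.π_e, add_zero, s'.π_s]

theorem transport_e {W : X.Opens} (h : W ≤ U) (a : Γ(X, W)) :
    transport s s' W h (M.e W a) = M'.e W a := by
  rw [transport_apply, M.π_e, map_zero, zero_add, coord_e]

theorem transport_s {W : X.Opens} (h : W ≤ U) (a : Γ(X, W)) :
    transport s s' W h (s.s W h a) = s'.s W h a := by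
  rw [transport_apply, s.π_s, coord_s, map_zero, add_zero]

theorem transport_const {W : X.Opens} (h : W ≤ U) (c : k) :
    transport s s' W h (M.const W c) = M'.const W c := by
  rw [← s.s_const W h, transport_s, s'.s_const]

/-- Brackets with an element of the kernel are fixed by `Λ`, so only the brackets of two elements `s
f`, `s g` matter, and their first-order terms are the bivectors. -/
theorem transport_br (hl : s.lam = s'.lam) {W : X.Opens} (h : W ≤ U) (a b : M.sec W) :
    transport s s' W h ((M.bracket W).br a b) =
      (M'.bracket W).br (transport s s' W h a) (transport s s' W h b) := by
  have key : ∀ f g : Γ(X, W), transport s s' W h ((M.bracket W).br (s.s W h f) (s.s W h g)) =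
      (M'.bracket W).br (s'.s W h f) (s'.s W h g) := by
    intro f g
    have e1 := e_lam s W h f g
    have e2 := e_lam s' W h f g
    rw [eq_sub_iff_add_eq] at e1 e2
    rw [← e1, ← e2, map_add, transport_e, transport_s, hl]
  have ha := s.eq_add_coord h a
  have hb := s.eq_add_coord h b
  generalize M.π W a = f, s.coord W h a = f', M.π W b = g, s.coord W h b = g' at ha hb
  subst ha hb
  simp only [PoissonBracket.add_left, PoissonBracket.add_right, map_add, key, transport_s,
    transport_e, M.br_e, M.br_e_right, M'.br_e, M'.br_e_right, s.π_s, s'.π_s, M.π_e, M'.π_e]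

/-- The map depends only on the pair of splittings up to a simultaneous shift of both by one
derivation. -/
theorem transport_congr (hs : sub t s = sub t' s') {W : X.Opens} (h : W ≤ U) (a : M.sec W) :
    transport t t' W h a = transport s s' W h a := by
  have ha := s.eq_add_coord h a
  generalize M.π W a = f, s.coord W h a = g at ha
  subst ha
  have e1 := e_sub t s W h f
  have e2 := e_sub t' s' W h f
  have e3 : s.s W h f = t.s W h f - M.e W ((sub t s).1 ⟨W, h⟩ ![f]) := by rw [e1]; ring
  rw [map_add, map_add, transport_s, transport_e, transport_e, e3, map_sub, transport_s,
    transport_e, hs, e2]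
  ring

end Spl

/-- Equal cocycles give isomorphic extensions: equal bivectors make the local transports Poisson,
and equal differences make them agree on overlaps. -/
theorem Hom.nonempty_of_splittings {ι : Type u} (U : ι → X.Opens) (hU : ⨆ i, U i = ⊤)
    (s : ∀ i, M.Spl (U i)) (s' : ∀ i, M'.Spl (U i)) (hl : ∀ i, (s i).lam = (s' i).lam)
    (hs : ∀ i j, Spl.sub ((s j).restrict (inf_le_right : U i ⊓ U j ≤ U j))
      ((s i).restrict inf_le_left) =
      Spl.sub ((s' j).restrict inf_le_right) ((s' i).restrict inf_le_left)) :
    Nonempty (M.Hom M') := by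
  have hcov : ∀ p : X, ∃ i, p ∈ U i := fun p => by
    have : p ∈ ⨆ i, U i := by rw [hU]; trivial
    exact Opens.mem_iSup.1 this
  have hc : ∀ i j (W : X.Opens) (hi : W ≤ U i) (hj : W ≤ U j) a,
      Spl.transport (s i) (s' i) W hi a = Spl.transport (s j) (s' j) W hj a := fun i j W hi hj a =>
    (Spl.transport_congr _ _ _ _ (hs i j) (le_inf hi hj) a).symm
  have hex : ∀ (W : X.Opens) (a : M.sec W), ∃ b : M'.sec W, ∀ i (V : X.Opens) (hV : V ≤ W)
      (hi : V ≤ U i), M'.rs hV b = Spl.transport (s i) (s' i) V hi (M.rs hV a) := by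
    intro W a
    obtain ⟨b, hb⟩ := M'.exists_sec_glue (fun i => W ⊓ U i) (fun i => inf_le_left)
      (fun p hp => by
        obtain ⟨i, hi⟩ := hcov p
        exact Opens.mem_iSup.2 ⟨i, hp, hi⟩)
      (fun i => Spl.transport (s i) (s' i) (W ⊓ U i) inf_le_right (M.rs inf_le_left a))
      (fun i j => by
        rw [Spl.transport_res, Spl.transport_res, M.rs_rs, M.rs_rs]
        exact hc _ _ _ _ _ _)
    refine ⟨b, fun i V hV hi => ?_⟩
    rw [← M'.rs_rs inf_le_left (le_inf hV hi), hb, Spl.transport_res, M.rs_rs]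
  choose φ hφ using hex
  have hloc : ∀ (W : X.Opens) (a b : M'.sec W), (∀ i (V : X.Opens) (hV : V ≤ W) (_ : V ≤ U i),
      M'.rs hV a = M'.rs hV b) → a = b := fun W a b h => M'.sec_local fun p hp => by
    obtain ⟨i, hi⟩ := hcov p
    exact ⟨W ⊓ U i, inf_le_left, ⟨hp, hi⟩, h i _ _ inf_le_right⟩
  refine ⟨⟨fun W => ⟨⟨⟨φ W, ?_⟩, ?_⟩, ?_, ?_⟩, ?_, ?_, ?_, ?_, ?_⟩⟩
  · exact hloc W _ _ fun i V hV hi => by rw [hφ W 1 i V hV hi]; simp only [map_one]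
  · exact fun a b => hloc W _ _ fun i V hV hi => by
      simp only [map_mul, hφ W _ i V hV hi]
  · exact hloc W _ _ fun i V hV hi => by
      change M'.rs hV (φ W 0) = _
      rw [hφ W 0 i V hV hi]; simp only [map_zero]
  · exact fun a b => hloc W _ _ fun i V hV hi => by
      change M'.rs hV (φ W (a + b)) = M'.rs hV (φ W a + φ W b)
      simp only [map_add, hφ W _ i V hV hi]
  · exact fun W V h a => hloc V _ _ fun i V' hV hi => by
      change M'.rs hV (M'.rs h (φ W a)) = M'.rs hV (φ V (M.rs h a))
      rw [M'.rs_rs, hφ W _ i V' _ hi, hφ V _ i V' _ hi, M.rs_rs]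
  · refine fun W a => X.sheaf.eq_of_locally_eq' (fun i => W ⊓ U i) W (fun i => homOfLE inf_le_left)
      (fun p hp => by
        obtain ⟨i, hi⟩ := hcov p
        exact Opens.mem_iSup.2 ⟨i, hp, hi⟩) _ _ fun i => ?_
    change res X inf_le_left (M'.π W (φ W a)) = res X inf_le_left (M.π W a)
    rw [← M'.π_res, ← M.π_res, hφ W a i _ inf_le_left inf_le_right, Spl.π_transport]
  · exact fun W a => hloc W _ _ fun i V hV hi => by
      change M'.rs hV (φ W (M.e W a)) = _
      rw [hφ W _ i V hV hi, M.e_res W V hV, M'.e_res W V hV, Spl.transport_e]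
  · exact fun W a => hloc W _ _ fun i V hV hi => by
      change M'.rs hV (φ W (M.const W a)) = _
      rw [hφ W _ i V hV hi, M.const_res W V hV, M'.const_res W V hV, Spl.transport_const]
  · exact fun W a b => hloc W _ _ fun i V hV hi => by
      change M'.rs hV (φ W ((M.bracket W).br a b)) = M'.rs hV ((M'.bracket W).br (φ W a) (φ W b))
      rw [hφ W _ i V hV hi, M.bracket_res W V hV, M'.bracket_res W V hV,
        Spl.transport_br _ _ (hl i), hφ W _ i V hV hi, hφ W _ i V hV hi]

/-- The extension is locally split. -/
def LocSplit (M : SheafExt Λ) : Prop := ∀ x : X, ∃ U : X.Opens, x ∈ U ∧ Nonempty (M.Spl U)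

/-- The section of the resolution underlying a cycle. -/
noncomputable def cyc (z : (globalSectionsComplex (lpResolution k Λ).I).cycles 2) :
    (resI k Λ 2).obj.obj (op ⊤) :=
  (globalSectionsComplex (lpResolution k Λ).I).iCycles 2 z

theorem resd_cyc (z : (globalSectionsComplex (lpResolution k Λ).I).cycles 2) :
    resd k Λ 2 3 ⊤ (cyc z) = 0 :=
  d_iCycles (globalSectionsComplex (lpResolution k Λ).I) 2 3 z

theorem exists_cyc (x : (resI k Λ 2).obj.obj (op ⊤)) (hx : resd k Λ 2 3 ⊤ x = 0) :
    ∃ z : (globalSectionsComplex (lpResolution k Λ).I).cycles 2, cyc z = x :=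
  exists_cycle (globalSectionsComplex (lpResolution k Λ).I) 2 3 rfl x hx

theorem class_eq_iff (z z' : (globalSectionsComplex (lpResolution k Λ).I).cycles 2) :
    (globalSectionsComplex (lpResolution k Λ).I).homologyπ 2 z =
      (globalSectionsComplex (lpResolution k Λ).I).homologyπ 2 z' ↔
    ∃ w : (resI k Λ 1).obj.obj (op ⊤), cyc z' = cyc z + resd k Λ 1 2 ⊤ w :=
  homologyπ_eq_iff (globalSectionsComplex (lpResolution k Λ).I) 1 2 rfl z z'

/-- The cocycle of a family of splittings represents the class `c`. -/
def IsMarked (M : SheafExt Λ) (c : HP k Λ 2) : Prop :=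
  ∃ (ι : Type u) (U : ι → X.Opens) (s : ∀ i, M.Spl (U i))
    (b : ∀ i, (resI k Λ 1).obj.obj (op (U i)))
    (z : (globalSectionsComplex (lpResolution k Λ).I).cycles 2), ⨆ i, U i = ⊤ ∧
    (globalSectionsComplex (lpResolution k Λ).I).homologyπ 2 z = c ∧
    (∀ i j, resRes k Λ (inf_le_right : U i ⊓ U j ≤ U j) (b j) - resRes k Λ inf_le_left (b i) =
      toRes k Λ 0 1 rfl _ (Spl.sub ((s j).restrict inf_le_right) ((s i).restrict inf_le_left))) ∧
    ∀ i, resRes k Λ le_top (cyc z) = toRes k Λ 1 2 rfl _ (s i).lam - resd k Λ 1 2 _ (b i)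

theorem IsMarked.map {c : HP k Λ 2} (h : M.IsMarked c) (f : M.Hom M') : M'.IsMarked c := by
  obtain ⟨ι, U, s, b, z, hU, hz, hb, hl⟩ := h
  refine ⟨ι, U, fun i => f.mapSpl (s i), b, z, hU, hz, fun i j => ?_, fun i => ?_⟩
  · rw [hb]
    exact congrArg _ (f.sub_mapSpl _ _).symm
  · rw [hl, f.lam_mapSpl]

theorem IsMarked.locSplit {c : HP k Λ 2} (h : M.IsMarked c) : M.LocSplit := by
  obtain ⟨ι, U, s, b, z, hU, -⟩ := h
  intro x
  have : x ∈ ⨆ i, U i := by rw [hU]; trivial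
  obtain ⟨i, hi⟩ := Opens.mem_iSup.1 this
  exact ⟨U i, hi, ⟨s i⟩⟩

theorem exists_resI_of_local {n : ℤ} {U : X.Opens}
    (P : ∀ V : X.Opens, V ≤ U → (resI k Λ n).obj.obj (op V) → Prop)
    (hP : ∀ V W (hV : V ≤ U) (hW : W ≤ V) x, P V hV x → P W (hW.trans hV) (resRes k Λ hW x))
    (hu : ∀ V hV x y, P V hV x → P V hV y → x = y)
    (he : ∀ p ∈ U, ∃ (V : X.Opens) (hV : V ≤ U) (x : _), p ∈ V ∧ P V hV x) :
    ∃ y : (resI k Λ n).obj.obj (op U), ∀ p ∈ U, ∃ (V : X.Opens) (hV : V ≤ U), p ∈ V ∧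
      P V hV (resRes k Λ hV y) :=
  exists_unique_of_local (resI k Λ n) P hP hu he

/-- The cochain `b` extends to all splittings by `B t = b i + (t - s i)`, which does not depend on
`i` because the differences add up. The cover disappears from the data, so markings can be compared
without common refinements. -/
theorem IsMarked.exists_function {c : HP k Λ 2} (h : M.IsMarked c) :
    ∃ (z : (globalSectionsComplex (lpResolution k Λ).I).cycles 2)
      (B : ∀ V : X.Opens, M.Spl V → (resI k Λ 1).obj.obj (op V)),
      (globalSectionsComplex (lpResolution k Λ).I).homologyπ 2 z = c ∧
      (∀ (V W : X.Opens) (h : W ≤ V) (s : M.Spl V), resRes k Λ h (B V s) = B W (s.restrict h)) ∧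
      (∀ V (t s : M.Spl V), B V t - B V s = toRes k Λ 0 1 rfl V (Spl.sub t s)) ∧
      ∀ V (s : M.Spl V), resRes k Λ le_top (cyc z) =
        toRes k Λ 1 2 rfl V s.lam - resd k Λ 1 2 V (B V s) := by
  obtain ⟨ι, U, s, b, z, hU, hz, hb, hl⟩ := h
  have hcov : ∀ p : X, ∃ i, p ∈ U i := fun p => by
    have : p ∈ ⨆ i, U i := by rw [hU]; trivial
    exact Opens.mem_iSup.1 this
  have hex : ∀ (V : X.Opens) (t : M.Spl V), ∃ y : (resI k Λ 1).obj.obj (op V),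
      ∀ i (W : X.Opens) (hW : W ≤ V) (hi : W ≤ U i), resRes k Λ hW y = resRes k Λ hi (b i) +
        toRes k Λ 0 1 rfl W (Spl.sub (t.restrict hW) ((s i).restrict hi)) := by
    intro V t
    have hloc : ∀ (V' : X.Opens) (x y : (resI k Λ 1).obj.obj (op V')),
        (∀ i (W : X.Opens) (hW : W ≤ V') (_ : W ≤ U i), resRes k Λ hW x = resRes k Λ hW y) →
        x = y := by
      intro V' x y hxy
      refine resI_local fun p hp => ?_
      obtain ⟨i, hi⟩ := hcov p
      exact ⟨V' ⊓ U i, inf_le_left, ⟨hp, hi⟩, hxy i _ _ inf_le_right⟩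
    obtain ⟨y, hy⟩ := exists_resI_of_local (k := k) (Λ := Λ) (n := 1) (U := V)
      (fun V' hV' y => ∀ i (W : X.Opens) (hW : W ≤ V') (hi : W ≤ U i),
        resRes k Λ hW y = resRes k Λ hi (b i) +
        toRes k Λ 0 1 rfl W (Spl.sub (t.restrict (hW.trans hV')) ((s i).restrict hi)))
      (fun V' V'' hV' hV'' x hx i W hW hi => by rw [resRes_res]; exact hx i W _ hi)
      (fun V' hV' x y hx hy => hloc V' x y fun i W hW hi => by rw [hx i W hW hi, hy i W hW hi])
      (fun p hp => by
        obtain ⟨i, hi⟩ := hcov p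
        refine ⟨V ⊓ U i, inf_le_left, resRes k Λ inf_le_right (b i) + toRes k Λ 0 1 rfl _
          (Spl.sub (t.restrict inf_le_left) ((s i).restrict inf_le_right)), ⟨hp, hi⟩, ?_⟩
        intro j W hW hj
        have hi' : W ≤ U i := hW.trans inf_le_right
        have h1 := congrArg (resRes k Λ (le_inf hi' hj)) (hb i j)
        rw [map_sub, resRes_res, resRes_res, resRes_toRes] at h1
        change _ = toRes k Λ 0 1 rfl W (Spl.sub ((s j).restrict hj) ((s i).restrict hi')) at h1
        have h2 : polyDerRes k hW (Spl.sub (t.restrict inf_le_left)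
            ((s i).restrict inf_le_right)) = Spl.sub (t.restrict (hW.trans inf_le_left))
              ((s j).restrict hj) + Spl.sub ((s j).restrict hj) ((s i).restrict hi') :=
          (Spl.sub_add_sub (t.restrict (hW.trans inf_le_left)) ((s j).restrict hj)
            ((s i).restrict hi')).symm
        rw [map_add, resRes_res, resRes_toRes, sub_eq_iff_eq_add.1 h1, h2, map_add]
        abel)
    refine ⟨y, fun i W hW hi => resI_local fun p hp => ?_⟩
    obtain ⟨V', hV', hpV', h⟩ := hy p (hW hp)
    refine ⟨W ⊓ V', inf_le_left, ⟨hp, hpV'⟩, ?_⟩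
    have := h i (W ⊓ V') inf_le_right (inf_le_left.trans hi)
    rw [resRes_res] at this
    rw [resRes_res, this, map_add, resRes_res, resRes_toRes]
    rfl
  choose B hB using hex
  have hloc : ∀ (n : ℤ) (V' : X.Opens) (x y : (resI k Λ n).obj.obj (op V')),
      (∀ i (W : X.Opens) (hW : W ≤ V') (_ : W ≤ U i), resRes k Λ hW x = resRes k Λ hW y) →
      x = y := by
    intro n V' x y hxy
    refine resI_local fun p hp => ?_
    obtain ⟨i, hi⟩ := hcov p
    exact ⟨V' ⊓ U i, inf_le_left, ⟨hp, hi⟩, hxy i _ _ inf_le_right⟩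
  refine ⟨z, B, hz, fun V W h t => ?_, fun V t r => ?_, fun V t => ?_⟩
  · refine hloc 1 W _ _ fun i W' hW' hi => ?_
    rw [resRes_res, hB _ _ i W' _ hi, hB _ _ i W' _ hi]
    rfl
  · refine hloc 1 V _ _ fun i W hW hi => ?_
    rw [map_sub, hB _ _ i W _ hi, hB _ _ i W _ hi, resRes_toRes, add_sub_add_left_eq_sub,
      ← map_sub, ← Spl.sub_restrict, ← Spl.sub_add_sub (t.restrict hW) (r.restrict hW)
        ((s i).restrict hi), add_sub_cancel_right]
  · refine hloc 2 V _ _ fun i W hW hi => ?_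
    have h1 := congrArg (resRes k Λ hi) (hl i)
    rw [map_sub, resRes_toRes, resRes_resd, resRes_res] at h1
    have h2 := Spl.lpd_sub (t.restrict hW) ((s i).restrict hi)
    have h3 := resd_toRes (Λ := Λ) (n := 0) (m := 1) (m' := 2) (h := rfl) (h' := rfl)
      (Spl.sub (t.restrict hW) ((s i).restrict hi))
    rw [map_sub, resRes_toRes, resRes_resd, resRes_res, hB _ _ i W _ hi, map_add, h3, h1]
    change _ = _ - (_ + toRes k Λ 1 2 rfl W (lpd k Λ 1 W _))
    rw [h2, map_sub, Spl.lam_restrict, Spl.lam_restrict]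
    abel

/-- The differences of local splittings form a Čech cocycle in `I¹`, hence the coboundary of some
`b`. The sections `λ_i - d (b i)` agree on overlaps by `lpd_sub`, and the section they glue to is
closed by `lpd_lam`. -/
theorem LocSplit.exists_isMarked (h : M.LocSplit) : ∃ c, M.IsMarked c := by
  choose U hx hs using h
  have s : ∀ x, M.Spl (U x) := fun x => (hs x).some
  have hU : ⨆ x : X, U x = ⊤ := by
    refine eq_top_iff.2 fun x _ => Opens.mem_iSup.2 ⟨x, hx x⟩
  obtain ⟨b, hb⟩ := cech_resI U hU (fun i j => toRes k Λ 0 1 rfl _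
    (Spl.sub ((s j).restrict (inf_le_right : U i ⊓ U j ≤ U j)) ((s i).restrict inf_le_left)))
    (fun i j l => by
      simp only [resRes_toRes, ← map_add]
      refine congrArg _ ?_
      exact (add_comm _ _).trans
        (Spl.sub_add_sub ((s l).restrict inf_le_right)
        ((s j).restrict (inf_le_left.trans inf_le_right))
        ((s i).restrict (inf_le_left.trans inf_le_left))))
  obtain ⟨z, hz⟩ := exists_gluing (resI k Λ 2) (U := ⊤) U (fun _ => le_top) hU.ge
    (fun i => toRes k Λ 1 2 rfl _ (s i).lam - resd k Λ 1 2 _ (b i)) (fun i j => by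
      change resRes k Λ inf_le_left _ = resRes k Λ inf_le_right _
      rw [map_sub, map_sub, resRes_toRes, resRes_toRes, resRes_resd, resRes_resd]
      have h1 := congrArg (resd k Λ 1 2 _) (hb i j)
      have h2 := Spl.lpd_sub ((s j).restrict (inf_le_right : U i ⊓ U j ≤ U j))
        ((s i).restrict inf_le_left)
      rw [resd_toRes (Λ := Λ) (n := 0) (m := 1) (m' := 2) (h := rfl) (h' := rfl)] at h1
      change _ = toRes k Λ 1 2 rfl _ (lpd k Λ 1 _ _) at h1
      rw [h2, map_sub, map_sub, Spl.lam_restrict, Spl.lam_restrict] at h1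
      rw [sub_eq_sub_iff_add_eq_add] at h1 ⊢
      rw [add_comm, h1, add_comm])
  change ∀ i, resRes k Λ le_top z = _ at hz
  have hdz : resd k Λ 2 3 ⊤ z = 0 := resI_local fun p _ => by
    refine ⟨U p, le_top, hx p, ?_⟩
    rw [resRes_resd, hz, map_sub, resd_resd,
      resd_toRes (Λ := Λ) (n := 1) (m := 2) (m' := 3) (h := rfl) (h' := rfl)]
    change toRes k Λ 2 3 rfl _ (lpd k Λ 2 _ _) - _ = _
    rw [Spl.lpd_lam]
    simp only [map_zero, sub_zero]
  obtain ⟨z, rfl⟩ := exists_cyc z hdz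
  exact ⟨_, X, U, s, b, z, hU, rfl, hb, hz⟩

/-- `B` and `B'` change by the same derivation when the splitting changes. Their difference is
therefore independent of the splitting and glues to a global `w`, and `z' - z = d w`. -/
theorem IsMarked.unique {c c' : HP k Λ 2} (h : M.IsMarked c) (h' : M.IsMarked c') : c = c' := by
  have hs := h.locSplit
  obtain ⟨z, B, rfl, hB1, hB2, hB3⟩ := h.exists_function
  obtain ⟨z', B', rfl, hB1', hB2', hB3'⟩ := h'.exists_function
  have hw : ∃ w : (resI k Λ 1).obj.obj (op ⊤), ∀ (V : X.Opens) (s : M.Spl V),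
      resRes k Λ le_top w = B V s - B' V s := by
    obtain ⟨w, hw⟩ := exists_resI_of_local (k := k) (Λ := Λ) (n := 1) (U := ⊤)
      (fun V hV w => ∀ (W : X.Opens) (hW : W ≤ V) (s : M.Spl W),
        resRes k Λ hW w = B W s - B' W s)
      (fun V W hV hW x hx W' hW' s => by rw [resRes_res, hx])
      (fun V hV x y hx hy => resI_local fun p hp => by
        obtain ⟨U, hpU, ⟨s⟩⟩ := hs p
        refine ⟨V ⊓ U, inf_le_left, ⟨hp, hpU⟩, ?_⟩
        rw [hx _ _ (s.restrict inf_le_right), hy _ _ (s.restrict inf_le_right)])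
      (fun p _ => by
        obtain ⟨U, hpU, ⟨s⟩⟩ := hs p
        refine ⟨U, le_top, B U s - B' U s, hpU, fun W hW t => ?_⟩
        rw [map_sub, hB1, hB1', ← sub_eq_zero]
        have h1 := hB2 W t (s.restrict hW)
        have h2 := hB2' W t (s.restrict hW)
        rw [← h2, ← sub_eq_zero, ← neg_eq_zero] at h1
        rw [← h1]
        abel)
    refine ⟨w, fun V s => resI_local fun p hp => ?_⟩
    obtain ⟨U, hU', hpU, hU⟩ := hw p trivial
    refine ⟨V ⊓ U, inf_le_left, ⟨hp, hpU⟩, ?_⟩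
    have := hU (V ⊓ U) inf_le_right (s.restrict inf_le_left)
    rw [resRes_res] at this
    rw [resRes_res, this, map_sub, hB1, hB1']
  obtain ⟨w, hw⟩ := hw
  refine (class_eq_iff z z').2 ⟨w, resI_local fun p _ => ?_⟩
  obtain ⟨U, hpU, ⟨s⟩⟩ := hs p
  refine ⟨U, le_top, hpU, ?_⟩
  rw [map_add, resRes_resd, hw U s, hB3 U s, hB3' U s, map_sub]
  abel

/-- After adding `w` to `B'`, both markings have the same `z`. Locally a splitting of `M` can be
shifted so that its bivector, and its marking modulo boundaries, match those of a splitting of `M'`.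
On overlaps the two differences then have the same image under `[Λ, -]` and the same class modulo
boundaries, so they are equal by rigidity. -/
theorem IsMarked.nonempty_hom {c : HP k Λ 2} (h : M.IsMarked c) (h' : M'.IsMarked c) :
    Nonempty (M.Hom M') := by
  have hs := h.locSplit
  have hs' := h'.locSplit
  obtain ⟨z, B, hz, hB1, hB2, hB3⟩ := h.exists_function
  obtain ⟨z', B', hz', hB1', hB2', hB3'⟩ := h'.exists_function
  obtain ⟨w, hw⟩ := (class_eq_iff z z').1 (hz.trans hz'.symm)
  have hB3'' : ∀ V (s : M'.Spl V), resRes k Λ le_top (cyc z) =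
      toRes k Λ 1 2 rfl V s.lam - resd k Λ 1 2 V (B' V s + resRes k Λ le_top w) := by
    intro V s
    have := hB3' V s
    rw [hw, map_add, resRes_resd] at this
    rw [map_add, ← sub_sub, ← this]
    abel
  have hex : ∀ x : X, ∃ (U : X.Opens) (s : M.Spl U) (s' : M'.Spl U), x ∈ U ∧ s.lam = s'.lam ∧
      bdp k Λ U (B U s) = bdp k Λ U (B' U s' + resRes k Λ le_top w) := by
    intro x
    obtain ⟨V, hxV, ⟨s⟩⟩ := hs x
    obtain ⟨V', hxV', ⟨s'⟩⟩ := hs' x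
    obtain ⟨U, rfl⟩ : ∃ U, U = V ⊓ V' := ⟨_, rfl⟩
    replace s := s.restrict (inf_le_left : V ⊓ V' ≤ V)
    replace s' := s'.restrict (inf_le_right : V ⊓ V' ≤ V')
    -- `q` is the required shift of `s`: its differential is `λ_{s'} - λ_s`, and it is congruent to
    -- the difference of the markings. The hypothesis holds because `z` is expressed through either
    -- splitting.
    obtain ⟨q, hq1, hq2⟩ := exists_derivation_of_resd (Λ := Λ) (s'.lam - s.lam)
      (by rw [map_sub, Spl.lpd_lam, Spl.lpd_lam, _root_.sub_self])
      (B' _ s' + resRes k Λ le_top w - B _ s) (by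
        have := (hB3 _ s).symm.trans (hB3'' _ s')
        rw [map_sub, map_sub]
        exact sub_eq_sub_iff_add_eq_add.2
          ((sub_eq_sub_iff_add_eq_add.1 this).symm.trans (add_comm _ _)))
    refine ⟨V ⊓ V', s.vadd q, s', ⟨hxV, hxV'⟩, ?_, ?_⟩
    · have := Spl.lpd_sub (s.vadd q) s
      rw [Spl.sub_vadd, hq1] at this
      exact (sub_left_inj.1 this).symm
    · have := hB2 _ (s.vadd q) s
      rw [Spl.sub_vadd] at this
      rw [sub_eq_iff_eq_add.1 this, map_add, ← hq2, map_sub]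
      abel
  choose U s s' hx hl hb using hex
  refine Hom.nonempty_of_splittings U
    (eq_top_iff.2 fun x _ => Opens.mem_iSup.2 ⟨x, hx x⟩) s s' hl fun i j => ?_
  refine eq_of_bdp (Λ := Λ) _ _ ?_ ?_
  · rw [Spl.lpd_sub, Spl.lpd_sub]
    simp only [Spl.lam_restrict, hl]
  · have h1 := congrArg (resRes k Λ (inf_le_left : U i ⊓ U j ≤ U i)) (hb i)
    have h2 := congrArg (resRes k Λ (inf_le_right : U i ⊓ U j ≤ U j)) (hb j)
    rw [resRes_bdp, resRes_bdp, map_add, resRes_res, hB1, hB1', map_add] at h1 h2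
    rw [← hB2, ← hB2', map_sub, map_sub, h1, h2]
    abel

end SheafExt


/-! ### The extension glued from a hyper-Čech cocycle. -/

section Cocycles

variable {k : Type u} [Field k] {X : Scheme.{u}} [X.Over (Spec (.of k))]

theorem polyDer_res_one {U : X.Opens} (q : polyDer k X 1 U) {W W' : X.Opens} (h : W ≤ U)
    (h' : W' ≤ W) (f : Γ(X, W)) :
    res X h' (q.1 ⟨W, h⟩ ![f]) = q.1 ⟨W', h'.trans h⟩ ![res X h' f] := by
  have hq := q.2.2 ⟨W, h⟩ ⟨W', h'.trans h⟩ h' ![f]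
  have : (fun i => res X h' ((![f] : Fin 1 → _) i)) = ![res X h' f] := by
    ext i; fin_cases i; rfl
  rwa [this] at hq

theorem polyDer_res_two {U : X.Opens} (q : polyDer k X 2 U) {W W' : X.Opens} (h : W ≤ U)
    (h' : W' ≤ W) (f g : Γ(X, W)) :
    res X h' (q.1 ⟨W, h⟩ ![f, g]) = q.1 ⟨W', h'.trans h⟩ ![res X h' f, res X h' g] := by
  have hq := q.2.2 ⟨W, h⟩ ⟨W', h'.trans h⟩ h' ![f, g]
  have : (fun i => res X h' ((![f, g] : Fin 2 → _) i)) = ![res X h' f, res X h' g] := by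
    ext i; fin_cases i <;> rfl
  rwa [this] at hq

theorem update_two_zero {A : Type*} (x y a : A) : Function.update ![x, y] 0 a = ![a, y] := by
  ext i; fin_cases i <;> rfl

theorem update_two_one {A : Type*} (x y a : A) : Function.update ![x, y] 1 a = ![x, a] := by
  ext i; fin_cases i <;> rfl

section

variable {A : Type*} [CommRing A] [Algebra k A]

theorem IsPolyDer.one_add {Q : (Fin 1 → A) → A} (h : IsPolyDer k Q) (a b : A) :
    Q ![a + b] = Q ![a] + Q ![b] := by
  simpa only [update_one] using h.add ![0] 0 a b

theorem IsPolyDer.one_mul {Q : (Fin 1 → A) → A} (h : IsPolyDer k Q) (a b : A) :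
    Q ![a * b] = a * Q ![b] + b * Q ![a] := by
  simpa only [update_one] using h.leibniz ![0] 0 a b

theorem IsPolyDer.one_algebraMap {Q : (Fin 1 → A) → A} (h : IsPolyDer k Q) (c : k) :
    Q ![algebraMap k A c] = 0 := by
  have h1 := h.one_mul 1 1
  have h2 : Q ![c • 1] = c • Q ![1] := by
    simpa only [update_one] using h.smul ![0] 0 c 1
  rw [Algebra.algebraMap_eq_smul_one, h2]
  have h3 : Q ![1] = 0 := by simpa using h1
  rw [h3, smul_zero]

theorem IsPolyDer.one_neg {Q : (Fin 1 → A) → A} (h : IsPolyDer k Q) (a : A) :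
    Q ![-a] = - Q ![a] := by
  have h0 : Q ![0] = 0 := by simpa using h.one_algebraMap 0
  have := h.one_add a (-a)
  rw [add_neg_cancel, h0] at this
  linear_combination -this

theorem IsPolyDer.two_add_left {Q : (Fin 2 → A) → A} (h : IsPolyDer k Q) (a b c : A) :
    Q ![a + b, c] = Q ![a, c] + Q ![b, c] := by
  simpa only [update_two_zero] using h.add ![0, c] 0 a b

theorem IsPolyDer.two_add_right {Q : (Fin 2 → A) → A} (h : IsPolyDer k Q) (a b c : A) :
    Q ![a, b + c] = Q ![a, b] + Q ![a, c] := by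
  simpa only [update_two_one] using h.add ![a, 0] 1 b c

theorem IsPolyDer.two_mul_left {Q : (Fin 2 → A) → A} (h : IsPolyDer k Q) (a b c : A) :
    Q ![a * b, c] = a * Q ![b, c] + b * Q ![a, c] := by
  simpa only [update_two_zero] using h.leibniz ![0, c] 0 a b

theorem IsPolyDer.two_self {Q : (Fin 2 → A) → A} (h : IsPolyDer k Q) (a : A) :
    Q ![a, a] = 0 := h.alt ![a, a] 0 1 rfl (by decide)

theorem IsPolyDer.two_skew {Q : (Fin 2 → A) → A} (h : IsPolyDer k Q) (a b : A) :
    Q ![a, b] = -Q ![b, a] := by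
  have := h.two_self (a + b)
  rw [h.two_add_left, h.two_add_right, h.two_add_right, h.two_self, h.two_self] at this
  linear_combination this

theorem IsPolyDer.two_algebraMap {Q : (Fin 2 → A) → A} (h : IsPolyDer k Q) (c : k) (a : A) :
    Q ![algebraMap k A c, a] = 0 := by
  have h1 := h.two_mul_left 1 1 a
  have h2 : Q ![c • 1, a] = c • Q ![1, a] := by
    simpa only [update_two_zero] using h.smul ![0, a] 0 c 1
  rw [Algebra.algebraMap_eq_smul_one, h2]
  have h3 : Q ![1, a] = 0 := by simpa using h1
  rw [h3, smul_zero]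

end

/-- A hyper-Čech `2`-cocycle of the truncated Lichnerowicz-Poisson complex. -/
structure Cocycle (Λ : PoissonStructure (X ↘ Spec (.of k))) where
  ι : Type u
  U : ι → X.Opens
  cover : ⨆ i, U i = ⊤
  p : ∀ i j, polyDer k X 1 (U i ⊓ U j)
  l : ∀ i, polyDer k X 2 (U i)
  p_add : ∀ i j m, polyDerRes k (inf_le_left : (U i ⊓ U j) ⊓ U m ≤ U i ⊓ U j) (p i j) +
    polyDerRes k (le_inf (inf_le_left.trans inf_le_right) inf_le_right) (p j m) =
    polyDerRes k (le_inf (inf_le_left.trans inf_le_left) inf_le_right) (p i m)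
  lpd_p : ∀ i j, lpd k Λ 1 _ (p i j) =
    polyDerRes k inf_le_right (l j) - polyDerRes k inf_le_left (l i)
  lpd_l : ∀ i, lpd k Λ 2 _ (l i) = 0

theorem dualNumber_ext {A : Type*} {a b : DualNumber A} (h : a.fst = b.fst) (h' : a.snd = b.snd) :
    a = b := TrivSqZeroExt.ext h h'

namespace Cocycle

variable {Λ : PoissonStructure (X ↘ Spec (.of k))} (C : Cocycle Λ)

theorem mem_cover (x : X) : ∃ i, x ∈ C.U i := by
  have : x ∈ ⨆ i, C.U i := by rw [C.cover]; trivial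
  exact Opens.mem_iSup.1 this

theorem eq_of_cover {W : X.Opens} {a b : Γ(X, W)}
    (h : ∀ i, res X (inf_le_left : W ⊓ C.U i ≤ W) a = res X inf_le_left b) : a = b :=
  X.sheaf.eq_of_locally_eq' (fun i => W ⊓ C.U i) W (fun i => homOfLE inf_le_left)
    (fun p hp => by
      obtain ⟨i, hi⟩ := C.mem_cover p
      exact Opens.mem_iSup.2 ⟨i, hp, hi⟩) a b h

/-- The difference of the `j`-th and the `i`-th splitting. -/
def P (i j : C.ι) (V : X.Opens) (hi : V ≤ C.U i) (hj : V ≤ C.U j) (f : Γ(X, V)) : Γ(X, V) :=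
  (C.p i j).1 ⟨V, le_inf hi hj⟩ ![f]

/-- The first-order term of the bracket in the `i`-th splitting. -/
def L (i : C.ι) (V : X.Opens) (hi : V ≤ C.U i) (f g : Γ(X, V)) : Γ(X, V) :=
  (C.l i).1 ⟨V, hi⟩ ![f, g]

section

variable {i j m : C.ι} {V V' : X.Opens} (hi : V ≤ C.U i) (hj : V ≤ C.U j) (hm : V ≤ C.U m)

theorem P_add (f g : Γ(X, V)) : C.P i j V hi hj (f + g) = C.P i j V hi hj f + C.P i j V hi hj g :=
  ((C.p i j).2.1 ⟨V, _⟩).one_add f g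

theorem P_neg (f : Γ(X, V)) : C.P i j V hi hj (-f) = -C.P i j V hi hj f :=
  ((C.p i j).2.1 ⟨V, _⟩).one_neg f

theorem P_mul (f g : Γ(X, V)) :
    C.P i j V hi hj (f * g) = f * C.P i j V hi hj g + g * C.P i j V hi hj f :=
  ((C.p i j).2.1 ⟨V, _⟩).one_mul f g

theorem P_algebraMap (c : k) : C.P i j V hi hj (algebraMap k _ c) = 0 :=
  ((C.p i j).2.1 ⟨V, _⟩).one_algebraMap c

theorem P_zero : C.P i j V hi hj 0 = 0 := by
  simpa using C.P_algebraMap hi hj 0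

theorem P_one : C.P i j V hi hj 1 = 0 := by
  simpa using C.P_algebraMap hi hj 1

theorem res_P (h : V' ≤ V) (f : Γ(X, V)) : res X h (C.P i j V hi hj f) =
    C.P i j V' (h.trans hi) (h.trans hj) (res X h f) :=
  polyDer_res_one _ _ _ _

theorem P_add_P (f : Γ(X, V)) :
    C.P i j V hi hj f + C.P j m V hj hm f = C.P i m V hi hm f :=
  congrFun (congrFun (congrArg Subtype.val (C.p_add i j m)) ⟨V, le_inf (le_inf hi hj) hm⟩) ![f]

theorem res_L (h : V' ≤ V) (f g : Γ(X, V)) : res X h (C.L i V hi f g) =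
    C.L i V' (h.trans hi) (res X h f) (res X h g) :=
  polyDer_res_two _ _ _ _ _

theorem L_add_left (f g r : Γ(X, V)) : C.L i V hi (f + g) r = C.L i V hi f r + C.L i V hi g r :=
  ((C.l i).2.1 ⟨V, _⟩).two_add_left f g r

theorem L_add_right (f g r : Γ(X, V)) : C.L i V hi f (g + r) = C.L i V hi f g + C.L i V hi f r :=
  ((C.l i).2.1 ⟨V, _⟩).two_add_right f g r

theorem L_mul_left (f g r : Γ(X, V)) :
    C.L i V hi (f * g) r = f * C.L i V hi g r + g * C.L i V hi f r :=
  ((C.l i).2.1 ⟨V, _⟩).two_mul_left f g r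

theorem L_self (f : Γ(X, V)) : C.L i V hi f f = 0 := ((C.l i).2.1 ⟨V, _⟩).two_self f

theorem L_skew (f g : Γ(X, V)) : C.L i V hi f g = -C.L i V hi g f := ((C.l i).2.1 ⟨V, _⟩).two_skew f g

theorem L_algebraMap (c : k) (f : Γ(X, V)) : C.L i V hi (algebraMap k _ c) f = 0 :=
  ((C.l i).2.1 ⟨V, _⟩).two_algebraMap c f

theorem L_zero (f : Γ(X, V)) : C.L i V hi 0 f = 0 := by
  simpa using C.L_algebraMap hi 0 f

theorem P_br (f g : Γ(X, V)) : (Λ.bracket V).br f (C.P i j V hi hj g) +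
    (Λ.bracket V).br (C.P i j V hi hj f) g - C.P i j V hi hj ((Λ.bracket V).br f g) =
    C.L j V hj f g - C.L i V hi f g := by
  have h1 := congrFun (congrFun (congrArg Subtype.val (C.lpd_p i j)) ⟨V, le_inf hi hj⟩) ![f, g]
  exact ((Λ.bracket V).schouten_one _ ![f, g]).symm.trans h1

theorem L_br (f g r : Γ(X, V)) : (Λ.bracket V).br f (C.L i V hi g r) -
    (Λ.bracket V).br g (C.L i V hi f r) + (Λ.bracket V).br r (C.L i V hi f g) -
    C.L i V hi ((Λ.bracket V).br f g) r - C.L i V hi g ((Λ.bracket V).br f r) +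
    C.L i V hi f ((Λ.bracket V).br g r) = 0 := by
  have h1 := congrFun (congrFun (congrArg Subtype.val (C.lpd_l i)) ⟨V, hi⟩) ![f, g, r]
  exact neg_eq_zero.1 (((Λ.bracket V).schouten_two _ ![f, g, r]).symm.trans h1)

end

/-- The functions on `W` in terms of the splittings: `f + ε g i` in the `i`-th splitting. -/
def secRing (W : X.Opens) : Subring (Γ(X, W) × ∀ i, DualNumber Γ(X, W ⊓ C.U i)) where
  carrier := {a | (∀ i, (a.2 i).fst = res X inf_le_left a.1) ∧
    -- Since `s j = s i + ε p i j`, the section `f + ε g j` of the `j`-th splitting reads `f + ε (g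
    -- j + p i j f)` in the `i`-th. Quantifying over all `V` avoids fixing a form of the triple
    -- intersection.
    ∀ i j (V : X.Opens) (hV : V ≤ W) (hi : V ≤ C.U i) (hj : V ≤ C.U j),
      res X (le_inf hV hi) (a.2 i).snd = res X (le_inf hV hj) (a.2 j).snd +
        C.P i j V hi hj (res X hV a.1)}
  mul_mem' {a b} ha hb := by
    refine ⟨fun i => by simp [ha.1, hb.1], fun i j V hV hi hj => ?_⟩
    simp only [Prod.snd_mul, Pi.mul_apply, DualNumber.snd_mul, ha.1, hb.1, Prod.fst_mul, map_add,
      map_mul, res_res, ha.2 i j V hV hi hj, hb.2 i j V hV hi hj, P_mul]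
    ring
  one_mem' := ⟨fun i => by simp, fun i j V hV hi hj => by simp [P_one]⟩
  add_mem' {a b} ha hb := by
    refine ⟨fun i => by simp [ha.1, hb.1], fun i j V hV hi hj => ?_⟩
    simp only [Prod.snd_add, Pi.add_apply, TrivSqZeroExt.snd_add, Prod.fst_add, map_add,
      ha.2 i j V hV hi hj, hb.2 i j V hV hi hj, P_add]
    ring
  zero_mem' := ⟨fun i => by simp, fun i j V hV hi hj => by simp [P_zero]⟩
  neg_mem' {a} ha := by
    refine ⟨fun i => by simp [ha.1], fun i j V hV hi hj => ?_⟩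
    simp only [Prod.snd_neg, Pi.neg_apply, TrivSqZeroExt.snd_neg, Prod.fst_neg, map_neg,
      ha.2 i j V hV hi hj, P_neg]
    ring

variable {C} {W W' : X.Opens}

/-- The underlying function. -/
def fn (a : C.secRing W) : Γ(X, W) := a.1.1

/-- The coordinate in a splitting. -/
def co (a : C.secRing W) (i : C.ι) : Γ(X, W ⊓ C.U i) := (a.1.2 i).snd

theorem co_eq (a : C.secRing W) {i j : C.ι} {V : X.Opens} (hV : V ≤ W) (hi : V ≤ C.U i)
    (hj : V ≤ C.U j) : res X (le_inf hV hi) (co a i) = res X (le_inf hV hj) (co a j) +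
      C.P i j V hi hj (res X hV (fn a)) :=
  a.2.2 i j V hV hi hj

theorem secRing_ext {a b : C.secRing W} (h : fn a = fn b) (h' : ∀ i, co a i = co b i) : a = b :=
  Subtype.ext (Prod.ext h (funext fun i => dualNumber_ext
    ((a.2.1 i).trans ((congrArg _ h).trans (b.2.1 i).symm)) (h' i)))

/-- A section with given coordinates. -/
def sect (f : Γ(X, W)) (g : ∀ i, Γ(X, W ⊓ C.U i))
    (h : ∀ i j (V : X.Opens) (hV : V ≤ W) (hi : V ≤ C.U i) (hj : V ≤ C.U j),
      res X (le_inf hV hi) (g i) = res X (le_inf hV hj) (g j) + C.P i j V hi hj (res X hV f)) :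
    C.secRing W :=
  ⟨(f, fun i => (res X inf_le_left f, g i)), fun _ => rfl, h⟩

@[simp] theorem fn_sect (f : Γ(X, W)) (g h) : fn (sect (C := C) f g h) = f := rfl
@[simp] theorem co_sect (f : Γ(X, W)) (g h) (i) : co (sect (C := C) f g h) i = g i := rfl
@[simp] theorem fn_add (a b : C.secRing W) : fn (a + b) = fn a + fn b := rfl
@[simp] theorem fn_sub (a b : C.secRing W) : fn (a - b) = fn a - fn b := rfl
@[simp] theorem fn_mul (a b : C.secRing W) : fn (a * b) = fn a * fn b := rfl
@[simp] theorem fn_zero : fn (0 : C.secRing W) = 0 := rfl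
@[simp] theorem fn_one : fn (1 : C.secRing W) = 1 := rfl
@[simp] theorem co_add (a b : C.secRing W) (i) : co (a + b) i = co a i + co b i := rfl
@[simp] theorem co_sub (a b : C.secRing W) (i) : co (a - b) i = co a i - co b i := rfl
@[simp] theorem co_zero (i) : co (0 : C.secRing W) i = 0 := rfl
@[simp] theorem co_one (i) : co (1 : C.secRing W) i = 0 := rfl
@[simp] theorem co_mul (a b : C.secRing W) (i) : co (a * b) i =
    res X inf_le_left (fn a) * co b i + res X inf_le_left (fn b) * co a i := by
  change ((a.1.2 i) * (b.1.2 i)).snd = _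
  rw [DualNumber.snd_mul, a.2.1, b.2.1]
  change _ + co a i * _ = _
  rw [mul_comm (co a i)]
  rfl

/-- Restriction of sections. -/
def secRes (h : W' ≤ W) : C.secRing W →+* C.secRing W' where
  toFun a := sect (res X h (fn a)) (fun i => res X (inf_le_inf_right _ h) (co a i))
    fun i j V hV hi hj => by
      rw [res_res, res_res, res_res]
      exact co_eq a _ _ _
  map_one' := secRing_ext (by simp) (by simp)
  map_zero' := secRing_ext (by simp) (by simp)
  map_add' a b := secRing_ext (by simp) (by simp)
  map_mul' a b := secRing_ext (by simp) (by simp [res_res])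

@[simp] theorem fn_secRes (h : W' ≤ W) (a : C.secRing W) : fn (secRes h a) = res X h (fn a) := rfl
@[simp] theorem co_secRes (h : W' ≤ W) (a : C.secRing W) (i) :
    co (secRes h a) i = res X (inf_le_inf_right _ h) (co a i) := rfl

/-- The presheaf of rings of a cocycle. -/
def presheaf (C : Cocycle Λ) : TopCat.Presheaf CommRingCat.{u} X where
  obj W := .of (C.secRing W.unop)
  map f := CommRingCat.ofHom (secRes f.unop.le)
  map_id W := by
    refine CommRingCat.hom_ext (RingHom.ext fun (a : C.secRing W.unop) =>
      secRing_ext ?_ fun i => ?_)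
    · exact res_self _ _ _
    · exact res_self _ _ _
  map_comp f g := by
    refine CommRingCat.hom_ext (RingHom.ext fun (a : C.secRing _) =>
      secRing_ext ?_ fun i => ?_)
    · exact (res_res _ _ _).symm
    · exact (res_res _ _ _).symm

theorem presheaf_isSheaf (C : Cocycle Λ) : C.presheaf.IsSheaf := by
  rw [TopCat.Presheaf.isSheaf_iff_isSheafUniqueGluing]
  intro ι V sf hsf
  have hcompf : ∀ a b, res X (inf_le_left : V a ⊓ V b ≤ V a) (fn (sf a)) =
      res X inf_le_right (fn (sf b)) := fun a b => congrArg fn (hsf a b)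
  have hcompg : ∀ a b i, res X (inf_le_inf_right (C.U i) (inf_le_left : V a ⊓ V b ≤ V a))
      (co (sf a) i) = res X (inf_le_inf_right (C.U i) (inf_le_right : V a ⊓ V b ≤ V b))
      (co (sf b) i) := fun a b i => congrArg (fun s => co s i) (hsf a b)
  have hcov : ∀ i, iSup V ⊓ C.U i ≤ ⨆ a, V a ⊓ C.U i := fun i => by rw [iSup_inf_eq]
  obtain ⟨f, hf, hfu⟩ : ∃ f : Γ(X, iSup V), (∀ a, res X (le_iSup V a) f = fn (sf a)) ∧
      ∀ y : Γ(X, iSup V), (∀ a, res X (le_iSup V a) y = fn (sf a)) → y = f :=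
    X.sheaf.existsUnique_gluing' V (iSup V) (fun a => homOfLE (le_iSup V a))
      le_rfl (fun a => fn (sf a)) hcompf
  have hg : ∀ i, ∃ g : Γ(X, iSup V ⊓ C.U i), ∀ a,
      res X (inf_le_inf_right (C.U i) (le_iSup V a)) g = co (sf a) i := by
    intro i
    obtain ⟨g, hg, -⟩ := X.sheaf.existsUnique_gluing' (fun a => V a ⊓ C.U i) (iSup V ⊓ C.U i)
      (fun a => homOfLE (inf_le_inf_right _ (le_iSup V a))) (hcov i) (fun a => co (sf a) i) (by
        intro a b
        have := congrArg (res X (le_inf (inf_le_inf inf_le_left inf_le_left)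
          (inf_le_left.trans inf_le_right) :
          (V a ⊓ C.U i) ⊓ (V b ⊓ C.U i) ≤ (V a ⊓ V b) ⊓ C.U i)) (hcompg a b i)
        rw [res_res, res_res] at this
        exact this)
    exact ⟨g, hg⟩
  choose g hg using hg
  have hloc : ∀ (T : X.Opens) (_ : T ≤ iSup V) (x y : Γ(X, T)),
      (∀ a, res X (inf_le_left : T ⊓ V a ≤ T) x = res X inf_le_left y) → x = y := by
    intro T hT x y h
    exact X.sheaf.eq_of_locally_eq' (fun a => T ⊓ V a) T (fun a => homOfLE inf_le_left)
      (by rw [← inf_iSup_eq]; exact le_inf le_rfl hT) x y h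
  refine ⟨sect f g fun i j T hT hi hj => ?_, fun a => ?_, fun s hs => ?_⟩
  · refine hloc T hT _ _ fun a => ?_
    have h1 := co_eq (sf a) (i := i) (j := j) (V := T ⊓ V a) inf_le_right (inf_le_left.trans hi)
      (inf_le_left.trans hj)
    rw [← hg, ← hg, ← hf, res_res, res_res, res_res] at h1
    rw [map_add, res_P, res_res, res_res, res_res]
    exact h1
  · exact secRing_ext (hf a) fun i => hg i a
  · have hs' : ∀ a, secRes (le_iSup V a) s = sf a := hs
    refine secRing_ext ?_ fun i => ?_
    · exact hfu (fn s) fun a => congrArg fn (hs' a)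
    · refine hloc _ inf_le_left _ _ fun a => ?_
      have h1 := congrArg (fun s => co s i) (hs' a)
      change res X _ (co s i) = _ at h1
      rw [← hg] at h1
      have h2 := congrArg (res X (le_inf inf_le_right (inf_le_left.trans inf_le_right) :
        (iSup V ⊓ C.U i) ⊓ V a ≤ V a ⊓ C.U i)) h1
      rw [res_res, res_res] at h2
      exact h2

/-- The bracket of two sections. -/
noncomputable def secBr (a b : C.secRing W) : C.secRing W :=
  sect ((Λ.bracket W).br (fn a) (fn b)) (fun i =>
    C.L i _ inf_le_right (res X inf_le_left (fn a)) (res X inf_le_left (fn b)) +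
      (Λ.bracket _).br (res X inf_le_left (fn a)) (co b i) +
      (Λ.bracket _).br (co a i) (res X inf_le_left (fn b))) fun i j V hV hi hj => by
    -- Independence of the splitting is the cocycle condition `[Λ, p i j] = l j - l i`.
    have h := C.P_br hi hj (res X hV (fn a)) (res X hV (fn b))
    simp only [map_add, res_L, Λ.res_br _ _ _, res_res, co_eq a hV hi hj, co_eq b hV hi hj,
      PoissonBracket.add_left, PoissonBracket.add_right]
    linear_combination h

@[simp] theorem fn_secBr (a b : C.secRing W) : fn (secBr a b) = (Λ.bracket W).br (fn a) (fn b) :=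
  rfl

@[simp] theorem co_secBr (a b : C.secRing W) (i) : co (secBr a b) i =
    C.L i _ inf_le_right (res X inf_le_left (fn a)) (res X inf_le_left (fn b)) +
      (Λ.bracket _).br (res X inf_le_left (fn a)) (co b i) +
      (Λ.bracket _).br (co a i) (res X inf_le_left (fn b)) := rfl

/-- The Poisson bracket on sections. -/
noncomputable def secBracket (C : Cocycle Λ) (W : X.Opens) : PoissonBracket (C.secRing W) where
  br := secBr
  add_left a b c := secRing_ext (by simp [PoissonBracket.add_left]) fun i => by
    simp [PoissonBracket.add_left, L_add_left]; ring
  add_right a b c := secRing_ext (by simp [PoissonBracket.add_right]) fun i => by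
    simp [PoissonBracket.add_right, L_add_right]; ring
  self a := secRing_ext (by simp [PoissonBracket.self]) fun i => by
    rw [co_secBr, L_self, (Λ.bracket _).skew (co a i)]; simp
  leibniz a b c := secRing_ext (by simp [PoissonBracket.leibniz]) fun i => by
    simp [PoissonBracket.leibniz, PoissonBracket.add_left, L_mul_left, Λ.res_br _ _ _]; ring
  jacobi a b c := secRing_ext (by simp [PoissonBracket.jacobi]) fun i => by
    simp only [co_add, co_secBr, fn_secBr, Λ.res_br _ _ _, co_zero, PoissonBracket.add_right]
    generalize res X inf_le_left (fn a) = a₀, res X inf_le_left (fn b) = b₀,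
      res X inf_le_left (fn c) = c₀, co a i = a', co b i = b', co c i = c'
    -- The `ε`-part of the Jacobi identity consists of `[Λ, l i] = 0` and of three Jacobi identities
    -- of `Λ`, each with one argument replaced by its coordinate.
    have h := C.L_br (inf_le_right : W ⊓ C.U i ≤ _) a₀ b₀ c₀
    have s1 := C.L_skew (inf_le_right : W ⊓ C.U i ≤ _) ((Λ.bracket _).br a₀ b₀) c₀
    have s2 := congrArg (C.L i _ (inf_le_right : W ⊓ C.U i ≤ _) b₀) ((Λ.bracket _).skew a₀ c₀)
    have s3 := congrArg ((Λ.bracket _).br b₀) (C.L_skew (inf_le_right : W ⊓ C.U i ≤ _) a₀ c₀)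
    have j1 := (Λ.bracket _).jacobi a' b₀ c₀
    have j2 := (Λ.bracket _).jacobi a₀ b' c₀
    have j3 := (Λ.bracket _).jacobi a₀ b₀ c'
    have s4 : C.L i _ (inf_le_right : W ⊓ C.U i ≤ _) b₀ (-(Λ.bracket _).br c₀ a₀) =
      - C.L i _ (inf_le_right : W ⊓ C.U i ≤ _) b₀ ((Λ.bracket _).br c₀ a₀) := by
      rw [C.L_skew, C.L_skew _ b₀]
      have := C.L_add_left (inf_le_right : W ⊓ C.U i ≤ _) (-(Λ.bracket _).br c₀ a₀)
        ((Λ.bracket _).br c₀ a₀) b₀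
      rw [neg_add_cancel, L_zero] at this
      linear_combination this
    rw [s1, s2, s3, s4, PoissonBracket.neg_right] at h
    linear_combination h + j1 + j2 + j3

/-- Multiplication by `ε`. -/
def secE (C : Cocycle Λ) (W : X.Opens) : Γ(X, W) →+ C.secRing W where
  toFun a := sect 0 (fun i => res X inf_le_left a) fun i j V hV hi hj => by
    rw [res_res, res_res, map_zero, P_zero, add_zero]
  map_zero' := secRing_ext rfl (by simp)
  map_add' a b := secRing_ext (by simp) (by simp)

@[simp] theorem fn_secE (a : Γ(X, W)) : fn (C.secE W a) = 0 := rfl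
@[simp] theorem co_secE (a : Γ(X, W)) (i) : co (C.secE W a) i = res X inf_le_left a := rfl

theorem exists_secE (a : C.secRing W) (ha : fn a = 0) : ∃ b, C.secE W b = a := by
  obtain ⟨b, hb⟩ : ∃ b : Γ(X, W), ∀ i, res X inf_le_left b = co a i := by
    obtain ⟨b, hb, -⟩ := X.sheaf.existsUnique_gluing' (fun i => W ⊓ C.U i) W
      (fun i => homOfLE inf_le_left) (fun p hp => by
        obtain ⟨i, hi⟩ := C.mem_cover p
        exact Opens.mem_iSup.2 ⟨i, hp, hi⟩) (fun i => co a i) (fun i j => by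
          have := co_eq a (i := i) (j := j)
            (inf_le_left.trans inf_le_left : (W ⊓ C.U i) ⊓ (W ⊓ C.U j) ≤ W)
            (inf_le_left.trans inf_le_right) (inf_le_right.trans inf_le_right)
          rw [ha, map_zero, P_zero, add_zero] at this
          exact this)
    exact ⟨b, hb⟩
  exact ⟨b, secRing_ext ha.symm hb⟩

/-- The constants. -/
noncomputable def secConst (C : Cocycle Λ) (W : X.Opens) : k →+* C.secRing W where
  toFun c := sect (algebraMap k _ c) (fun i => 0) fun i j V hV hi hj => by
    rw [map_zero, map_zero, res_algebraMap, P_algebraMap, add_zero]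
  map_zero' := secRing_ext (by simp) (by simp)
  map_one' := secRing_ext (by simp) (by simp)
  map_add' a b := secRing_ext (by simp) (by simp)
  map_mul' a b := secRing_ext (by simp) (by simp)

@[simp] theorem fn_secConst (c : k) : fn (C.secConst W c) = algebraMap k _ c := rfl
@[simp] theorem co_secConst (c : k) (i) : co (C.secConst W c) i = 0 := rfl

/-- The `m`-th splitting. -/
def secSpl (C : Cocycle Λ) (m : C.ι) (W : X.Opens) (h : W ≤ C.U m) : Γ(X, W) →+* C.secRing W where
  -- The coordinate is dictated by `s m = s i + ε p i m`; that the coordinates match is additivity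
  -- of `p`.
  toFun f := sect f (fun i => C.P i m _ inf_le_right (inf_le_left.trans h)
      (res X inf_le_left f)) fun i j V hV hi hj => by
    rw [res_P, res_P, res_res, res_res, add_comm]
    exact (C.P_add_P hi hj (hV.trans h) _).symm
  map_zero' := secRing_ext rfl (by simp [P_zero])
  map_one' := secRing_ext rfl (by simp [P_one])
  map_add' a b := secRing_ext rfl (by simp [P_add])
  map_mul' a b := secRing_ext rfl (by simp [P_mul])

@[simp] theorem fn_secSpl (m : C.ι) (h : W ≤ C.U m) (f : Γ(X, W)) : fn (C.secSpl m W h f) = f :=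
  rfl
@[simp] theorem co_secSpl (m : C.ι) (h : W ≤ C.U m) (f : Γ(X, W)) (i) : co (C.secSpl m W h f) i =
    C.P i m _ inf_le_right (inf_le_left.trans h) (res X inf_le_left f) :=
  rfl

theorem secRes_secE (h : W' ≤ W) (a : Γ(X, W)) : secRes h (C.secE W a) = C.secE W' (res X h a) :=
  secRing_ext (by simp) (by simp [res_res])

theorem secE_injective (C : Cocycle Λ) (W : X.Opens) : Function.Injective (C.secE W) :=
  fun _ _ h => C.eq_of_cover fun i => congrArg (fun s => co s i) h

theorem mul_secE (a : C.secRing W) (b : Γ(X, W)) : a * C.secE W b = C.secE W (fn a * b) :=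
  secRing_ext (by simp) (by simp)

theorem secRes_secConst (h : W' ≤ W) (c : k) : secRes h (C.secConst W c) = C.secConst W' c :=
  secRing_ext (res_algebraMap _ _ h c) (by simp)

theorem secRes_secBr (h : W' ≤ W) (a b : C.secRing W) :
    secRes h (secBr a b) = secBr (secRes h a) (secRes h b) :=
  secRing_ext (Λ.res_br _ _ h _ _) fun i => by
    simp only [co_secBr, map_add, res_L, Λ.res_br _ _ _, res_res, fn_secRes, co_secRes]

theorem secBr_secConst (c : k) (a : C.secRing W) : secBr (C.secConst W c) a = 0 :=
  secRing_ext (algebraMap_br k Λ W c _) fun i => by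
    simp only [co_secBr, fn_secConst, co_secConst, res_algebraMap, L_algebraMap, algebraMap_br,
      PoissonBracket.zero_left, add_zero, co_zero]

theorem secBr_secE (a : Γ(X, W)) (b : C.secRing W) :
    secBr (C.secE W a) b = C.secE W ((Λ.bracket W).br a (fn b)) :=
  secRing_ext (by simp) fun i => by
    simp only [co_secBr, fn_secE, co_secE, map_zero, L_zero, PoissonBracket.zero_left, zero_add,
      Λ.res_br _ _ _]

theorem secRes_secSpl (m : C.ι) (h : W ≤ C.U m) (h' : W' ≤ W) (f : Γ(X, W)) :
    secRes h' (C.secSpl m W h f) = C.secSpl m W' (h'.trans h) (res X h' f) :=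
  secRing_ext rfl fun i => by simp [res_P, res_res]

theorem secSpl_algebraMap (m : C.ι) (h : W ≤ C.U m) (c : k) :
    C.secSpl m W h (algebraMap k _ c) = C.secConst W c :=
  secRing_ext rfl fun i => by simp [res_algebraMap, P_algebraMap]

theorem secE_P (i j : C.ι) (hi : W ≤ C.U i) (hj : W ≤ C.U j) (f : Γ(X, W)) :
    C.secE W (C.P i j W hi hj f) = C.secSpl j W hj f - C.secSpl i W hi f :=
  secRing_ext (by simp) fun m => by
    simp only [co_secE, co_sub, co_secSpl, res_P]
    rw [eq_sub_iff_add_eq, add_comm]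
    exact C.P_add_P _ _ _ _

theorem secE_L (m : C.ι) (h : W ≤ C.U m) (f g : Γ(X, W)) : C.secE W (C.L m W h f g) =
    secBr (C.secSpl m W h f) (C.secSpl m W h g) - C.secSpl m W h ((Λ.bracket W).br f g) :=
  secRing_ext (by simp) fun i => by
    have := C.P_br (i := i) (j := m) (inf_le_right : W ⊓ C.U i ≤ C.U i) (inf_le_left.trans h)
      (res X inf_le_left f) (res X inf_le_left g)
    simp only [co_secE, co_sub, co_secBr, co_secSpl, fn_secSpl, res_L, Λ.res_br _ _ _]
    linear_combination -this

/-- The extension of `𝒪_X` with a given cocycle. -/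
noncomputable def toExt (C : Cocycle Λ) : SheafExt Λ where
  F := C.presheaf
  isSheaf := C.presheaf_isSheaf
  π W := (RingHom.fst _ _).comp (C.secRing W).subtype
  π_res _ _ _ _ := rfl
  e W := C.secE W
  e_res _ _ h a := secRes_secE h a
  π_e _ _ := rfl
  e_injective W := C.secE_injective W
  exact _ a ha := exists_secE a ha
  mul_e _ a b := mul_secE a b
  const W := C.secConst W
  const_res _ _ h c := secRes_secConst h c
  π_const _ _ := rfl
  bracket W := C.secBracket W
  bracket_res _ _ h a b := secRes_secBr h a b
  bracket_const _ c a := secBr_secConst c a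
  π_br _ _ _ := rfl
  br_e _ a b := secBr_secE a b

/-- The tautological splittings. -/
noncomputable def splitting (C : Cocycle Λ) (m : C.ι) : C.toExt.Spl (C.U m) where
  s W h := C.secSpl m W h
  π_s _ _ _ := rfl
  s_res _ h _ h' f := secRes_secSpl m h h' f
  s_const _ h c := secSpl_algebraMap m h c

theorem sub_splitting (C : Cocycle Λ) (i j : C.ι) :
    SheafExt.Spl.sub ((C.splitting j).restrict (inf_le_right : C.U i ⊓ C.U j ≤ C.U j))
      ((C.splitting i).restrict inf_le_left) = C.p i j :=
  SheafExt.Spl.sub_unique fun _ hW f =>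
    secE_P i j (hW.trans inf_le_left) (hW.trans inf_le_right) f

theorem lam_splitting (C : Cocycle Λ) (m : C.ι) : (C.splitting m).lam = C.l m :=
  SheafExt.Spl.lam_unique fun _ hW f g => secE_L m hW f g

end Cocycle

/-! ### Every class in `HP²` comes from an extension. -/

namespace SheafExt

variable {Λ : PoissonStructure (X ↘ Spec (.of k))}

/-- Surjectivity on `H²` of the complexes of sheaves writes `z` locally as `l - d b`. On overlaps,
`l y - l x` is the differential of `b y - b x`, so `exists_derivation_of_resd` gives a unique
derivation `p x y` congruent to `b y - b x`. These data form a cocycle, and its extension is marked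
by the class of `z`. -/
theorem exists_isMarked (c : HP k Λ 2) : ∃ M : SheafExt Λ, M.IsMarked c := by
  obtain ⟨z, rfl⟩ := homologyπ_surjective (globalSectionsComplex (lpResolution k Λ).I) 2 c
  choose V hV l b hxV hl hz using fun x : X =>
    toRes_surjective_two (cyc z) (resd_cyc z) (p := x) (U := ⊤) trivial
  have hcov : ⨆ x, V x = ⊤ := eq_top_iff.2 fun x _ => Opens.mem_iSup.2 ⟨x, hxV x⟩
  have hp : ∀ x y, ∃ q : polyDer k X 1 (V x ⊓ V y),
      lpd k Λ 1 _ q = polyDerRes k inf_le_right (l y) - polyDerRes k inf_le_left (l x) ∧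
      bdp k Λ _ (resRes k Λ inf_le_right (b y) - resRes k Λ inf_le_left (b x)) =
        bdp k Λ _ (toRes k Λ 0 1 rfl _ q) := by
    intro x y
    refine exists_derivation_of_resd (Λ := Λ) _ ?_ _ ?_
    · rw [map_sub, ← polyDerRes_lpd, ← polyDerRes_lpd, hl, hl, map_zero, map_zero, sub_zero]
    · have h1 := congrArg (resRes k Λ (inf_le_left : V x ⊓ V y ≤ V x)) (hz x)
      have h2 := congrArg (resRes k Λ (inf_le_right : V x ⊓ V y ≤ V y)) (hz y)
      rw [resRes_res, map_sub, resRes_toRes, resRes_resd] at h1 h2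
      rw [map_sub, map_sub]
      exact sub_eq_sub_iff_add_eq_add.2 ((sub_eq_sub_iff_add_eq_add.1
        (h1.symm.trans h2)).symm.trans (add_comm _ _))
  choose p hp hpb using hp
  -- Both sides have the same differential and the same class modulo boundaries, so rigidity
  -- applies.
  have hadd : ∀ x y m, polyDerRes k (inf_le_left : (V x ⊓ V y) ⊓ V m ≤ V x ⊓ V y) (p x y) +
      polyDerRes k (le_inf (inf_le_left.trans inf_le_right) inf_le_right) (p y m) =
      polyDerRes k (le_inf (inf_le_left.trans inf_le_left) inf_le_right) (p x m) := by
    intro x y m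
    refine eq_of_bdp (Λ := Λ) _ _ ?_ ?_
    · rw [map_add, ← polyDerRes_lpd, ← polyDerRes_lpd, ← polyDerRes_lpd, hp, hp, hp]
      simp only [map_sub, polyDerRes_res]
      abel
    · rw [map_add, map_add, ← resRes_toRes, ← resRes_toRes, ← resRes_toRes, ← resRes_bdp,
        ← resRes_bdp, ← resRes_bdp, ← hpb, ← hpb, ← hpb]
      simp only [map_sub, resRes_bdp, resRes_res]
      abel
  -- So far `p x y = b y - b x` holds only modulo boundaries. The discrepancy is a Čech cocycle of
  -- boundaries, hence the coboundary of a family `b'` of boundaries. Replacing `b` by `b + b'`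
  -- makes the equality exact and leaves `d b`, hence `z`, unchanged.
  obtain ⟨b', hb', hb'c⟩ := cech_bdp V hcov (fun x y => toRes k Λ 0 1 rfl _ (p x y) -
      (resRes k Λ inf_le_right (b y) - resRes k Λ inf_le_left (b x)))
    (fun x y m => by
      have := congrArg (toRes k Λ 0 1 rfl _) (hadd x y m)
      rw [map_add] at this
      simp only [map_sub, resRes_toRes, resRes_res]
      rw [← this]
      abel)
    (fun x y => by rw [map_sub, ← hpb, _root_.sub_self])
  let C : Cocycle Λ := ⟨X, V, hcov, p, l, hadd, hp, hl⟩
  refine ⟨C.toExt, X, V, C.splitting, fun x => b x + b' x, z, hcov, rfl, fun x y => ?_,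
    fun x => ?_⟩
  · have h := C.sub_splitting x y
    have h' := hb'c x y
    refine Eq.trans ?_ (congrArg (toRes k Λ 0 1 rfl _) h).symm
    change _ = toRes k Λ 0 1 rfl _ (p x y)
    rw [eq_sub_iff_add_eq] at h'
    rw [map_add, map_add, ← h']
    abel
  · have h := C.lam_splitting x
    refine (resRes_res (hV x) le_rfl _).symm.trans ?_
    rw [resRes_self, hz, h, map_add, ← resd_bdp (b' x), hb', map_zero, add_zero]

/-- The trivial extension, with a global splitting. -/
theorem exists_trivial : ∃ (M : SheafExt Λ) (s : M.Spl ⊤), s.lam = 0 := by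
  let C : Cocycle Λ := ⟨PUnit, fun _ => ⊤, by simp, fun _ _ => 0, fun _ => 0, by simp, by simp,
    by simp⟩
  exact ⟨C.toExt, C.splitting ⟨⟩, C.lam_splitting ⟨⟩⟩

theorem isMarked_zero {M : SheafExt Λ} (s : M.Spl ⊤) (hs : s.lam = 0) : M.IsMarked 0 := by
  obtain ⟨z, hz⟩ := exists_cyc (Λ := Λ) 0 (map_zero _)
  refine ⟨PUnit, fun _ => ⊤, fun _ => s, fun _ => 0, z, by simp, ?_, fun i j => ?_, fun i => ?_⟩
  · have h := (class_eq_iff z 0).2 ⟨0, by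
      rw [hz, map_zero, add_zero]
      exact map_zero (HomologicalComplex.iCycles
        (globalSectionsComplex (lpResolution k Λ).I) 2).hom⟩
    exact h.trans (map_zero (HomologicalComplex.homologyπ
        (globalSectionsComplex (lpResolution k Λ).I) 2).hom)
  · have : Spl.sub (s.restrict (inf_le_right : (⊤ : X.Opens) ⊓ ⊤ ≤ ⊤)) (s.restrict inf_le_left) =
      0 := Spl.sub_self _
    rw [this, map_zero, map_zero]
    exact (_root_.sub_self _)
  · rw [hz, hs, map_zero, map_zero, map_zero, _root_.sub_self]

end SheafExt

end Cocycles


/-! ### Local constructions with sections of a scheme. -/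

section Gluing

variable {Z : Scheme.{u}}

theorem sections_ext {U : Z.Opens} {x y : Γ(Z, U)}
    (h : ∀ p ∈ U, ∃ (V : Z.Opens) (hV : V ≤ U), p ∈ V ∧ res Z hV x = res Z hV y) : x = y := by
  choose V hV hp hxy using fun p : U => h p.1 p.2
  exact Z.sheaf.eq_of_locally_eq' V U (fun p => homOfLE (hV p))
    (fun p hpU => Opens.mem_iSup.2 ⟨⟨p, hpU⟩, hp _⟩) x y fun p => hxy p

theorem exists_section_of_local {U : Z.Opens} (P : ∀ V : Z.Opens, V ≤ U → Γ(Z, V) → Prop)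
    (hP : ∀ V W (hV : V ≤ U) (hW : W ≤ V) x, P V hV x → P W (hW.trans hV) (res Z hW x))
    (hu : ∀ V hV x y, P V hV x → P V hV y → x = y)
    (he : ∀ p ∈ U, ∃ (V : Z.Opens) (hV : V ≤ U) (x : Γ(Z, V)), p ∈ V ∧ P V hV x) :
    ∃ y : Γ(Z, U), ∀ p ∈ U, ∃ (V : Z.Opens) (hV : V ≤ U), p ∈ V ∧ P V hV (res Z hV y) := by
  choose V hV x hp hx using fun p : U => he p.1 p.2
  obtain ⟨y, hy, -⟩ := Z.sheaf.existsUnique_gluing' V U (fun p => homOfLE (hV p))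
    (fun p hpU => Opens.mem_iSup.2 ⟨⟨p, hpU⟩, hp _⟩) x
    (fun i j => hu _ (inf_le_left.trans (hV i)) _ _ (hP _ _ _ _ _ (hx i)) (hP _ _ _ _ _ (hx j)))
  refine ⟨y, fun p hpU => ⟨V ⟨p, hpU⟩, hV _, hp _, ?_⟩⟩
  have : res Z (hV ⟨p, hpU⟩) y = x ⟨p, hpU⟩ := hy _
  rw [this]
  exact hx _

theorem exists_affine_le {U : Z.Opens} {p : Z} (hp : p ∈ U) :
    ∃ V : Z.Opens, IsAffineOpen V ∧ V ≤ U ∧ p ∈ V := by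
  obtain ⟨_, ⟨V, hV, rfl⟩, hpV, hVU⟩ := Z.isBasis_affineOpens.exists_subset_of_mem_open hp U.2
  exact ⟨V, hV, hVU, hpV⟩

theorem res_app {X : Scheme.{u}} (i : X ⟶ Z) {V W : Z.Opens} (h : V ≤ W) (a : Γ(Z, W)) :
    res X (i.preimage_mono h) (i.app W a) = i.app V (res Z h a) := by
  have := i.naturality (homOfLE h).op
  exact (congrArg (fun f => f.hom a) this).symm

end Gluing

/-! ### Flat thickenings over `k[ε]`: the ideal of `X` and multiplication by `ε`. -/

section Thickening

variable {k : Type u} [Field k] {X Z : Scheme.{u}} (f : Z ⟶ Spec (.of (DualNumber k)))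
  {g : X ⟶ Spec (.of k)} {i : X ⟶ Z}

/-- The ring homomorphism from `k[ε]` to the sections of a `k[ε]`-scheme. -/
noncomputable def scalarOf (W : Z.Opens) : DualNumber k →+* Γ(Z, W) :=
  (f.appLE ⊤ W le_top).hom.comp (Scheme.ΓSpecIso (.of (DualNumber k))).inv.hom

theorem res_scalarOf {V W : Z.Opens} (h : V ≤ W) (c : DualNumber k) :
    res Z h (scalarOf f W c) = scalarOf f V c := by
  have := f.appLE_map (U := ⊤) (V := W) le_top (homOfLE h).op
  exact congrArg (fun f => f.hom ((Scheme.ΓSpecIso (.of (DualNumber k))).inv.hom c)) this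

/-- Multiplication by `ε`. -/
noncomputable abbrev epsOf (W : Z.Opens) : Γ(Z, W) := scalarOf f W DualNumber.eps

theorem epsOf_mul_epsOf (W : Z.Opens) : epsOf f W * epsOf f W = 0 := by
  rw [epsOf, ← map_mul, DualNumber.eps_mul_eps, map_zero]

theorem scalarOf_eq (W : Z.Opens) (c : DualNumber k) :
    scalarOf f W c = scalarOf f W (algebraMap k _ c.fst) + epsOf f W *
      scalarOf f W (algebraMap k _ c.snd) := by
  rw [epsOf, ← map_mul, ← map_add]
  congr 1
  ext <;> simp [TrivSqZeroExt.algebraMap_eq_inl]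

variable {f}

theorem app_scalarOf (H : CommSq i g f (specFst k)) (W : Z.Opens) (c : DualNumber k) :
    i.app W (scalarOf f W c) =
      g.appLE ⊤ (i ⁻¹ᵁ W) le_top ((Scheme.ΓSpecIso (.of k)).inv c.fst) := by
  have h1 : f.appLE ⊤ W le_top ≫ i.app W = (i ≫ f).appLE ⊤ (i ⁻¹ᵁ W) le_top := by
    rw [Scheme.Hom.app_eq_appLE]
    exact Scheme.Hom.appLE_comp_appLE i f ⊤ W (i ⁻¹ᵁ W) le_top le_rfl
  have h2 : (Scheme.ΓSpecIso (.of (DualNumber k))).inv ≫ (specFst k).appTop =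
      CommRingCat.ofHom (TrivSqZeroExt.fstHom k k k).toRingHom ≫ (Scheme.ΓSpecIso (.of k)).inv :=
    (Scheme.ΓSpecIso_inv_naturality _).symm
  have h3 : (i ≫ f).appLE ⊤ (i ⁻¹ᵁ W) le_top =
      (specFst k).appTop ≫ g.appLE ⊤ (i ⁻¹ᵁ W) le_top := by
    simp only [H.w]
    rw [Scheme.Hom.comp_appLE]
    rfl
  have h4 : (Scheme.ΓSpecIso (.of (DualNumber k))).inv ≫ f.appLE ⊤ W le_top ≫ i.app W =
      CommRingCat.ofHom (TrivSqZeroExt.fstHom k k k).toRingHom ≫ (Scheme.ΓSpecIso (.of k)).inv ≫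
        g.appLE ⊤ (i ⁻¹ᵁ W) le_top := by
    rw [h1, h3, reassoc_of% h2]
  exact congrArg (fun f => f.hom c) h4

theorem app_epsOf (H : CommSq i g f (specFst k)) (W : Z.Opens) : i.app W (epsOf f W) = 0 := by
  rw [app_scalarOf H]
  simp

instance : IsClosedImmersion (specFst k) :=
  IsClosedImmersion.spec_of_surjective _ TrivSqZeroExt.fst_surjective

instance : Surjective (specFst k) := by
  constructor
  intro x
  have h : x ∈ Set.range (PrimeSpectrum.comap (TrivSqZeroExt.fstHom k k k).toRingHom) := by
    rw [range_comap_of_surjective _ _ TrivSqZeroExt.fst_surjective]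
    intro a ha
    -- An element of the kernel has square zero, so it lies in every prime ideal.
    refine x.2.mem_of_pow_mem 2 ?_
    have h0 : (a : DualNumber k).fst = 0 := ha
    have : (a : DualNumber k) ^ 2 = 0 := by
      rw [pow_two]
      ext <;> simp [h0]
    rw [this]
    exact Ideal.zero_mem _
  exact h

/-- Over an affine open the cartesian square becomes a pushout of rings. The quotient by `ε`
receives compatible maps from `𝒪_Z` and `k`, so it receives one from `𝒪_X`: whatever dies on `X`
dies modulo `ε`. -/
theorem exists_eps_mul_of_app_eq_zero (H : IsPullback i g f (specFst k)) {W : Z.Opens}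
    (hW : IsAffineOpen W) (a : Γ(Z, W)) (ha : i.app W a = 0) : ∃ b, a = epsOf f W * b := by
  have hI := isIso_pushoutSection_of_isAffineOpen H.flip.flip (US := ⊤) (UT := ⊤) (UX := W) le_top
    le_top (UY := i ⁻¹ᵁ W) (by simp) (isAffineOpen_top _) (isAffineOpen_top _) hW
  have hP := (isIso_pushoutSection_iff H.flip.flip _ _ _).1 hI
  let q : Γ(Z, W) →+* Γ(Z, W) ⧸ Ideal.span {epsOf f W} := Ideal.Quotient.mk _
  have hq : q (epsOf f W) = 0 := Ideal.Quotient.eq_zero_iff_mem.2 (Ideal.subset_span rfl)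
  let r : k →+* Γ(Z, W) ⧸ Ideal.span {epsOf f W} :=
    (q.comp (scalarOf f W)).comp (algebraMap k (DualNumber k))
  have hc : f.appLE ⊤ W le_top ≫ CommRingCat.ofHom q = (specFst k).appLE ⊤ ⊤ le_top ≫
      (Scheme.ΓSpecIso (.of k)).hom ≫ CommRingCat.ofHom r := by
    rw [← cancel_epi (Scheme.ΓSpecIso (.of (DualNumber k))).inv]
    have h2 : (Scheme.ΓSpecIso (.of (DualNumber k))).inv ≫ (specFst k).appLE ⊤ ⊤ le_top =
        CommRingCat.ofHom (TrivSqZeroExt.fstHom k k k).toRingHom ≫ (Scheme.ΓSpecIso (.of k)).inv := by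
      rw [show (specFst k).appLE ⊤ ⊤ le_top = (specFst k).appTop from Scheme.Hom.appLE_eq_app _]
      exact (Scheme.ΓSpecIso_inv_naturality _).symm
    rw [reassoc_of% h2, Iso.inv_hom_id_assoc]
    refine CommRingCat.hom_ext (RingHom.ext fun c => ?_)
    change q (scalarOf f W c) = q (scalarOf f W (algebraMap k _ c.fst))
    rw [scalarOf_eq, map_add, map_mul, hq, zero_mul, add_zero]
  have h := hP.inl_desc _ _ hc
  have h' : q a = 0 := by
    have h1 : CommRingCat.Hom.hom (i.appLE W (i ⁻¹ᵁ W) le_rfl ≫ hP.desc _ _ hc) a = q a :=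
      congrArg (fun f => f.hom a) h
    have h2 : (i.appLE W (i ⁻¹ᵁ W) le_rfl).hom a = 0 := by
      rw [← Scheme.Hom.app_eq_appLE]
      exact ha
    rw [← h1]
    exact (congrArg _ h2).trans (map_zero (hP.desc _ _ hc).hom)
  obtain ⟨b, hb⟩ := Ideal.mem_span_singleton'.1 (Ideal.Quotient.eq_zero_iff_mem.1 h')
  exact ⟨b, by rw [← hb, mul_comm]⟩

/-- Equational criterion: flatness rewrites the relation `ε a = 0` as `a = ∑ c j • y j` with `ε c j
= 0`, and the annihilator of `ε` in `k[ε]` is `ε k`. -/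
theorem exists_eq_eps_mul_of_flat {A : Type u} [CommRing A] (φ : DualNumber k →+* A) (hφ : φ.Flat)
    (a : A) (ha : φ DualNumber.eps * a = 0) : ∃ b, a = φ DualNumber.eps * b := by
  algebraize [φ]
  have h := Module.Flat.isTrivialRelation_of_sum_smul_eq_zero (R := DualNumber k) (M := A)
    (ι := Unit) (f := fun _ => DualNumber.eps) (x := fun _ => a)
    (by simpa [Algebra.smul_def] using! ha)
  obtain ⟨n, c, y, h1, h2⟩ := h
  refine ⟨∑ j, φ (algebraMap k _ (c () j).snd) * y j, ?_⟩
  refine (h1 ()).trans ?_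
  rw [Finset.mul_sum]
  refine Finset.sum_congr rfl fun j _ => ?_
  have h3 : (DualNumber.eps : DualNumber k) * c () j = 0 := by simpa using h2 j
  have h4 : (c () j).fst = 0 := by
    have := congrArg TrivSqZeroExt.snd h3
    simpa using this
  have h5 : c () j = DualNumber.eps * algebraMap k _ (c () j).snd := by
    ext <;> simp [TrivSqZeroExt.algebraMap_eq_inl, h4]
  rw [← mul_assoc, ← map_mul, ← h5]
  exact Algebra.smul_def _ _

theorem flat_scalarOf [Flat f] {W : Z.Opens} (hW : IsAffineOpen W) : (scalarOf f W).Flat := by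
  have h1 := HasRingHomProperty.appLE @Flat f inferInstance ⟨⊤, isAffineOpen_top _⟩ ⟨W, hW⟩ le_top
  have h2 : (Scheme.ΓSpecIso (.of (DualNumber k))).inv.hom.Flat :=
    RingHom.Flat.of_bijective
      (ConcreteCategory.bijective_of_isIso (Scheme.ΓSpecIso (.of (DualNumber k))).inv)
  exact h2.comp h1

/-- Restriction to `X` and multiplication by `ε` have the same kernel on affine opens, namely the
multiples of `ε`. This identifies `ε 𝒪_Z` with `𝒪_X`. -/
theorem app_eq_zero_iff (H : IsPullback i g f (specFst k)) [Flat f] {W : Z.Opens}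
    (hW : IsAffineOpen W) (a : Γ(Z, W)) : i.app W a = 0 ↔ epsOf f W * a = 0 := by
  constructor
  · intro h
    obtain ⟨b, rfl⟩ := exists_eps_mul_of_app_eq_zero H hW a h
    rw [← mul_assoc, epsOf_mul_epsOf, zero_mul]
  · intro h
    obtain ⟨b, rfl⟩ := exists_eq_eps_mul_of_flat _ (flat_scalarOf hW) a h
    rw [map_mul, app_epsOf H.toCommSq, zero_mul]

theorem isClosedImmersion_of_isPullback (H : IsPullback i g f (specFst k)) : IsClosedImmersion i :=
  MorphismProperty.of_isPullback H.flip inferInstance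

theorem isHomeomorph_of_isPullback (H : IsPullback i g f (specFst k)) : IsHomeomorph i := by
  have h1 := isClosedImmersion_of_isPullback H
  have h2 : Surjective i := MorphismProperty.of_isPullback H.flip inferInstance
  exact (isHomeomorph_iff_isEmbedding_surjective).2 ⟨i.isClosedEmbedding.isEmbedding, h2.surj⟩

theorem exists_app_eq (H : IsPullback i g f (specFst k)) {W : Z.Opens} (hW : IsAffineOpen W)
    (b : Γ(X, i ⁻¹ᵁ W)) : ∃ a : Γ(Z, W), i.app W a = b :=
  have := isClosedImmersion_of_isPullback H
  i.app_surjective W hW b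

theorem eps_mul_eq_iff (H : IsPullback i g f (specFst k)) [Flat f] {W : Z.Opens}
    (hW : IsAffineOpen W) (a b : Γ(Z, W)) :
    epsOf f W * a = epsOf f W * b ↔ i.app W a = i.app W b := by
  rw [← sub_eq_zero, ← mul_sub, ← app_eq_zero_iff H hW, map_sub, sub_eq_zero]

/-- `c` is `ε` times any lift of `b`. -/
def IsEpsMul (f : Z ⟶ Spec (.of (DualNumber k))) (i : X ⟶ Z) (W : Z.Opens) (b : Γ(X, i ⁻¹ᵁ W))
    (c : Γ(Z, W)) : Prop :=
  ∀ (T : Z.Opens) (h : T ≤ W), IsAffineOpen T → ∀ a : Γ(Z, T),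
    i.app T a = res X (i.preimage_mono h) b → res Z h c = epsOf f T * a

section

variable {W : Z.Opens}

theorem IsEpsMul.res {b : Γ(X, i ⁻¹ᵁ W)} {c : Γ(Z, W)} (hc : IsEpsMul f i W b c) {V : Z.Opens}
    (h : V ≤ W) : IsEpsMul f i V (res X (i.preimage_mono h) b) (res Z h c) := by
  intro T hT hT' a ha
  rw [res_res] at ha ⊢
  exact hc T _ hT' a ha

theorem IsEpsMul.unique (H : IsPullback i g f (specFst k))
    {b : Γ(X, i ⁻¹ᵁ W)} {c c' : Γ(Z, W)} (hc : IsEpsMul f i W b c)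
    (hc' : IsEpsMul f i W b c') : c = c' := sections_ext fun p hp => by
  obtain ⟨V, hV, hVW, hpV⟩ := exists_affine_le hp
  obtain ⟨a, ha⟩ := exists_app_eq H hV (PoissonDeformation.res X (i.preimage_mono hVW) b)
  exact ⟨V, hVW, hpV, (hc V hVW hV a ha).trans (hc' V hVW hV a ha).symm⟩

theorem isEpsMul_mul (H : IsPullback i g f (specFst k)) [Flat f]
    (a : Γ(Z, W)) : IsEpsMul f i W (i.app W a) (epsOf f W * a) := by
  intro T h hT a' ha'
  rw [map_mul, res_scalarOf, eps_mul_eq_iff H hT, ha', res_app]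

theorem IsEpsMul.of_local {b : Γ(X, i ⁻¹ᵁ W)} {c : Γ(Z, W)} (h : ∀ p ∈ W, ∃ (V : Z.Opens) (hV : V ≤ W),
    p ∈ V ∧ IsEpsMul f i V (PoissonDeformation.res X (i.preimage_mono hV) b)
      (PoissonDeformation.res Z hV c)) : IsEpsMul f i W b c := by
  intro T hT hT' a ha
  refine sections_ext fun p hp => ?_
  obtain ⟨V, hV, hpV, hc⟩ := h p (hT hp)
  obtain ⟨T', hT'', hle, hpT'⟩ := exists_affine_le (U := T ⊓ V) ⟨hp, hpV⟩
  refine ⟨T', hle.trans inf_le_left, hpT', ?_⟩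
  have := hc T' (hle.trans inf_le_right) hT'' (PoissonDeformation.res Z (hle.trans inf_le_left) a)
    (by rw [← res_app, ha, res_res, res_res])
  rw [res_res] at this ⊢
  rw [this, map_mul, res_scalarOf]

/-- Lifts of `b` are available only on affine opens, and they need not agree. Their products with
`ε` do not depend on the lift, and so glue. -/
theorem exists_isEpsMul (H : IsPullback i g f (specFst k)) [Flat f]
    (b : Γ(X, i ⁻¹ᵁ W)) : ∃ c, IsEpsMul f i W b c := by
  obtain ⟨c, hc⟩ := exists_section_of_local (U := W)
    (fun V hV c => IsEpsMul f i V (res X (i.preimage_mono hV) b) c)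
    (fun V V' hV hV' c hc => by
      have := hc.res hV'
      rwa [res_res] at this)
    (fun V hV x y hx hy => IsEpsMul.unique H hx hy)
    (fun p hp => by
      obtain ⟨V, hV, hVW, hpV⟩ := exists_affine_le hp
      obtain ⟨a, ha⟩ := exists_app_eq H hV (PoissonDeformation.res X (i.preimage_mono hVW) b)
      exact ⟨V, hVW, epsOf f V * a, hpV, by rw [← ha]; exact isEpsMul_mul H a⟩)
  exact ⟨c, IsEpsMul.of_local hc⟩

theorem IsEpsMul.app_eq_zero (H : IsPullback i g f (specFst k))
    {b : Γ(X, i ⁻¹ᵁ W)} {c : Γ(Z, W)} (hc : IsEpsMul f i W b c) :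
    i.app W c = 0 := by
  refine sections_ext fun p hp => ?_
  obtain ⟨V, hV, hVW, hpV⟩ := exists_affine_le (U := W) (p := i p) hp
  obtain ⟨a, ha⟩ := exists_app_eq H hV (PoissonDeformation.res X (i.preimage_mono hVW) b)
  refine ⟨i ⁻¹ᵁ V, i.preimage_mono hVW, hpV, ?_⟩
  rw [res_app _ hVW, hc V hVW hV a ha, map_mul, app_epsOf H.toCommSq, zero_mul, map_zero]

theorem IsEpsMul.eq_zero (H : IsPullback i g f (specFst k)) [Flat f]
    {b : Γ(X, i ⁻¹ᵁ W)} (hc : IsEpsMul f i W b 0) : b = 0 := by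
  refine sections_ext fun p hp => ?_
  obtain ⟨V, hV, hVW, hpV⟩ := exists_affine_le (U := W) (p := i p) hp
  obtain ⟨a, ha⟩ := exists_app_eq H hV (PoissonDeformation.res X (i.preimage_mono hVW) b)
  refine ⟨i ⁻¹ᵁ V, i.preimage_mono hVW, hpV, ?_⟩
  have := hc V hVW hV a ha
  rw [map_zero] at this
  rw [map_zero, ← ha]
  exact (app_eq_zero_iff H hV a).2 this.symm

/-- Near each point `a` is `ε y`. The lifts `y` may differ, but `ε y` determines the restriction of
`y` to `X`, so the restrictions glue. -/
theorem exists_isEpsMul_of_app_eq_zero (H : IsPullback i g f (specFst k)) [Flat f]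
    (a : Γ(Z, W)) (ha : i.app W a = 0) : ∃ b, IsEpsMul f i W b a := by
  have hex : ∀ p : W, ∃ (V : Z.Opens) (hV : V ≤ W) (y : Γ(Z, V)), p.1 ∈ V ∧
      res Z hV a = epsOf f V * y := by
    intro p
    obtain ⟨V, hV, hVW, hpV⟩ := exists_affine_le p.2
    obtain ⟨y, hy⟩ := exists_eps_mul_of_app_eq_zero H hV (res Z hVW a)
      (by rw [← res_app, ha, map_zero])
    exact ⟨V, hVW, y, hpV, hy⟩
  choose V hV y hpV hy using hex
  obtain ⟨b, hb⟩ : ∃ b : Γ(X, i ⁻¹ᵁ W), ∀ p, res X (i.preimage_mono (hV p)) b =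
      i.app (V p) (y p) := by
    obtain ⟨b, hb, -⟩ := X.sheaf.existsUnique_gluing' (fun p => i ⁻¹ᵁ (V p)) (i ⁻¹ᵁ W)
      (fun p => homOfLE (i.preimage_mono (hV p)))
      (fun x hx => Opens.mem_iSup.2 ⟨⟨i x, hx⟩, hpV _⟩) (fun p => i.app (V p) (y p)) (by
        intro p q
        refine sections_ext fun x hx => ?_
        obtain ⟨T, hT, hle, hxT⟩ := exists_affine_le (U := V p ⊓ V q) (p := i x) hx
        refine ⟨i ⁻¹ᵁ T, i.preimage_mono hle, hxT, ?_⟩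
        change res X (i.preimage_mono hle) (res X (i.preimage_mono inf_le_left) _) =
          res X (i.preimage_mono hle) (res X (i.preimage_mono inf_le_right) _)
        rw [res_app i inf_le_left, res_app i inf_le_right, res_app i hle, res_app i hle,
          ← eps_mul_eq_iff H hT, res_res, res_res]
        have h1 := congrArg (res Z (hle.trans inf_le_left)) (hy p)
        have h2 := congrArg (res Z (hle.trans inf_le_right)) (hy q)
        rw [map_mul, res_res, res_scalarOf] at h1 h2
        rw [← h1, ← h2])
    exact ⟨b, hb⟩
  refine ⟨b, IsEpsMul.of_local fun p hp => ⟨V ⟨p, hp⟩, hV _, hpV _, ?_⟩⟩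
  rw [hb, hy]
  exact isEpsMul_mul H _

end

end Thickening


/-! ### Morphisms and isomorphisms of schemes from maps on sections. -/

section MkHom

/-- A morphism of locally ringed spaces from a continuous map and maps on sections. -/
def mkLRSHom {Z Y : LocallyRingedSpace.{u}} (ψ : Z.toTopCat ⟶ Y.toTopCat)
    (φ : ∀ W : Opens Y, Y.presheaf.obj (op W) →+* Z.presheaf.obj (op ((Opens.map ψ).obj W)))
    (hφ : ∀ (W W' : Opens Y) (h : W' ≤ W) a, (Z.presheaf.map ((Opens.map ψ).map (homOfLE h)).op).hom
      (φ W a) = φ W' ((Y.presheaf.map (homOfLE h).op).hom a))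
    (hl : ∀ (W : Opens Y) (a : Y.presheaf.obj (op W)) (z : Z) (h : ψ z ∈ W),
      IsUnit (Z.presheaf.germ ((Opens.map ψ).obj W) z h (φ W a)) →
        IsUnit (Y.presheaf.germ W (ψ z) h a)) : Z ⟶ Y where
  base := ψ
  c :=
    { app := fun W => CommRingCat.ofHom (φ W.unop)
      naturality := fun W W' f =>
        CommRingCat.hom_ext (RingHom.ext fun a => (hφ W.unop W'.unop f.unop.le a).symm) }
  prop z := by
    refine ⟨fun s hs => ?_⟩
    obtain ⟨W, hW, a, rfl⟩ := Y.presheaf.exists_germ_eq s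
    refine hl W a z hW ?_
    have := PresheafedSpace.stalkMap_germ_apply (X := Z.toPresheafedSpace)
      (Y := Y.toPresheafedSpace) ⟨ψ, ⟨fun W => CommRingCat.ofHom (φ W.unop), fun W W' f =>
        CommRingCat.hom_ext (RingHom.ext fun a => (hφ W.unop W'.unop f.unop.le a).symm)⟩⟩ W z hW a
    exact this ▸ hs

variable {Z Y : Scheme.{u}}

/-- A morphism of schemes from a continuous map and maps on sections. -/
def mkHom (ψ : Z.carrier ⟶ Y.carrier)
    (φ : ∀ W : Y.Opens, Γ(Y, W) →+* Γ(Z, (Opens.map ψ).obj W))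
    (hφ : ∀ (W W' : Y.Opens) (h : W' ≤ W) a, res Z (((Opens.map ψ).map (homOfLE h)).le) (φ W a) =
      φ W' (res Y h a))
    (hl : ∀ (W : Y.Opens) (a : Γ(Y, W)) (z : Z) (h : ψ z ∈ W),
      IsUnit (Z.presheaf.germ ((Opens.map ψ).obj W) z h (φ W a)) →
        IsUnit (Y.presheaf.germ W (ψ z) h a)) : Z ⟶ Y :=
  ⟨mkLRSHom ψ φ hφ hl⟩

theorem isIso_of_components (φ : Z ⟶ Y) (h : IsHomeomorph φ)
    (h' : ∀ W, Function.Bijective (φ.app W)) : IsIso φ := by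
  have h1 : IsIso φ.toLRSHom.toHom.base := (TopCat.isIso_iff_isHomeomorph _).2 h
  have h2 : ∀ W, IsIso (φ.toLRSHom.toHom.c.app W) := fun W =>
    (ConcreteCategory.isIso_iff_bijective _).2 (h' W.unop)
  have h3 : IsIso φ.toLRSHom.toHom.c := NatIso.isIso_of_isIso_app _
  have h4 : IsIso φ.toLRSHom.toHom := PresheafedSpace.isIso_of_components _
  have h5 : IsIso (SheafedSpace.forgetToPresheafedSpace.map
    (LocallyRingedSpace.forgetToSheafedSpace.map φ.toLRSHom)) := h4
  have h6 : IsIso (LocallyRingedSpace.forgetToSheafedSpace.map φ.toLRSHom) :=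
    isIso_of_reflects_iso _ SheafedSpace.forgetToPresheafedSpace
  have h7 : IsIso (Scheme.forgetToLocallyRingedSpace.map φ) :=
    isIso_of_reflects_iso φ.toLRSHom LocallyRingedSpace.forgetToSheafedSpace
  exact isIso_of_reflects_iso φ Scheme.forgetToLocallyRingedSpace

theorem res_app_congr {f g : Z ⟶ Y} (h : f = g) {W : Y.Opens} {V : Z.Opens} (hf : V ≤ f ⁻¹ᵁ W)
    (hg : V ≤ g ⁻¹ᵁ W) (a : Γ(Y, W)) : res Z hf (f.app W a) = res Z hg (g.app W a) := by
  subst h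
  rfl

theorem comp_app' {X : Scheme.{u}} (i : X ⟶ Z) (φ : Z ⟶ Y) (W : Y.Opens) (a : Γ(Y, W)) :
    (i ≫ φ).app W a = i.app (φ ⁻¹ᵁ W) (φ.app W a) := by
  rw [Scheme.Hom.comp_app]
  rfl

end MkHom

/-! ### Morphisms of thickenings, and products recognised by retractions. -/

section Thickening

variable {k : Type u} [Field k] {X Z Z' : Scheme.{u}}
  {g : X ⟶ Spec (.of k)} {i : X ⟶ Z}

theorem app_scalar (f' : Z' ⟶ Spec (.of (DualNumber k))) (φ : Z ⟶ Z') (W : Z'.Opens)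
    (c : DualNumber k) : φ.app W (scalarOf f' W c) = scalarOf (φ ≫ f') (φ ⁻¹ᵁ W) c := by
  have h1 : f'.appLE ⊤ W le_top ≫ φ.app W = (φ ≫ f').appLE ⊤ (φ ⁻¹ᵁ W) le_top := by
    rw [Scheme.Hom.app_eq_appLE]
    exact Scheme.Hom.appLE_comp_appLE φ f' ⊤ W (φ ⁻¹ᵁ W) le_top le_rfl
  exact congrArg (fun f => f.hom ((Scheme.ΓSpecIso (.of (DualNumber k))).inv.hom c)) h1

theorem IsEpsMul.map {f' : Z' ⟶ Spec (.of (DualNumber k))} {φ : Z ⟶ Z'}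
    (H : IsPullback i g (φ ≫ f') (specFst k)) (H' : IsPullback (i ≫ φ) g f' (specFst k))
    [Flat (φ ≫ f')] {W : Z'.Opens} {b : Γ(X, (i ≫ φ) ⁻¹ᵁ W)} {c : Γ(Z', W)}
    (h : IsEpsMul f' (i ≫ φ) W b c) : IsEpsMul (φ ≫ f') i (φ ⁻¹ᵁ W) b (φ.app W c) := by
  refine IsEpsMul.of_local fun p hp => ?_
  obtain ⟨V, hV, hVW, hpV⟩ := exists_affine_le (U := W) (p := φ p) hp
  obtain ⟨a, ha⟩ := exists_app_eq H' hV (PoissonDeformation.res X ((i ≫ φ).preimage_mono hVW) b)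
  refine ⟨φ ⁻¹ᵁ V, φ.preimage_mono hVW, hpV, ?_⟩
  rw [res_app φ hVW, h V hVW hV a ha, map_mul, app_scalar]
  have e : i.app (φ ⁻¹ᵁ V) (φ.app V a) =
      PoissonDeformation.res X (i.preimage_mono (φ.preimage_mono hVW)) b :=
    (comp_app' i φ V a).symm.trans ha
  rw [← e]
  exact isEpsMul_mul H _

/-- A morphism of thickenings is an isomorphism. -/
theorem isIso_of_thickenings {f' : Z' ⟶ Spec (.of (DualNumber k))} {φ : Z ⟶ Z'}
    (H : IsPullback i g (φ ≫ f') (specFst k)) (H' : IsPullback (i ≫ φ) g f' (specFst k))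
    [Flat (φ ≫ f')] [Flat f'] : IsIso φ := by
  have hi := isHomeomorph_of_isPullback H
  have hi' := isHomeomorph_of_isPullback H'
  have hφ : IsHomeomorph φ := by
    have e : (φ : Z → Z') = (i ≫ φ : X → Z') ∘ (hi.homeomorph i).symm := by
      ext z
      obtain ⟨x, rfl⟩ := hi.surjective z
      have : (hi.homeomorph i).symm (i x) = x := (hi.homeomorph i).symm_apply_apply x
      simp [this]
    rw [e]
    exact hi'.comp (hi.homeomorph i).symm.isHomeomorph
  -- The five lemma by hand. An element of the kernel of `φ` vanishes on `X`, so it is `ε b`; its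
  -- image is `ε b` on `Z`, and `ε` is injective on functions of `X`.
  have hinj : ∀ W, Function.Injective (φ.app W) := by
    intro W
    refine (injective_iff_map_eq_zero _).2 fun a ha => ?_
    obtain ⟨b, hb⟩ := exists_isEpsMul_of_app_eq_zero H' a ((comp_app' i φ W a).trans ((congrArg _ ha).trans (map_zero (i.app (φ ⁻¹ᵁ W)).hom)))
    have h0 := hb.map H H'
    rw [ha] at h0
    have := h0.eq_zero H
    rw [this] at hb
    have h1 := isEpsMul_mul H' (0 : Γ(Z', W))
    rw [map_zero, mul_zero] at h1
    exact hb.unique H' h1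
  -- Affineness of `W` is used to lift the restriction of `c` to `X`. The error is some `ε b`, which
  -- comes from `Z'`.
  have hsurj : ∀ W, IsAffineOpen W → Function.Surjective (φ.app W) := by
    intro W hW c
    obtain ⟨a, ha⟩ := exists_app_eq H' hW (i.app (φ ⁻¹ᵁ W) c)
    obtain ⟨b, hb⟩ := exists_isEpsMul_of_app_eq_zero H (c - φ.app W a) (by
      rw [map_sub, ← ha, comp_app', sub_self])
    obtain ⟨d, hd⟩ := exists_isEpsMul H' (W := W) b
    refine ⟨a + d, ?_⟩
    rw [map_add, (hd.map H H').unique H hb]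
    ring
  refine isIso_of_components φ hφ fun W => ⟨hinj W, fun c => ?_⟩
  obtain ⟨y, hy⟩ := exists_section_of_local (U := W)
    (fun V hV y => φ.app V y = res Z (φ.preimage_mono hV) c)
    (fun V V' hV hV' x hx => by rw [← res_app φ hV', hx, res_res])
    (fun V hV x y hx hy => hinj V (hx.trans hy.symm))
    (fun p hp => by
      obtain ⟨V, hV, hVW, hpV⟩ := exists_affine_le hp
      obtain ⟨a, ha⟩ := hsurj V hV (res Z (φ.preimage_mono hVW) c)
      exact ⟨V, hVW, a, hpV, ha⟩)
  refine ⟨y, sections_ext fun p hp => ?_⟩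
  obtain ⟨V, hV, hpV, h⟩ := hy (φ p) hp
  exact ⟨φ ⁻¹ᵁ V, φ.preimage_mono hV, hpV, by rw [res_app φ hV, h]⟩

theorem specFst_specDual : specFst k ≫ specDual k = 𝟙 _ := by
  rw [specFst, specDual, ← Spec.map_comp, ← CommRingCat.ofHom_comp]
  have : ((TrivSqZeroExt.fstHom k k k).toRingHom.comp (algebraMap k (DualNumber k))) =
      RingHom.id k := by
    ext c; rfl
  rw [this]
  exact Spec.map_id _

/-- The left square is cartesian by pasting: the right square is the defining one of the product,
and the outer rectangle has identities as horizontal sides. -/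
theorem isPullback_trivial (g : X ⟶ Spec (.of k)) : ∃ i : X ⟶ Limits.pullback g (specDual k),
    i ≫ Limits.pullback.fst g (specDual k) = 𝟙 X ∧
      IsPullback i g (Limits.pullback.snd g (specDual k)) (specFst k) := by
  refine ⟨Limits.pullback.lift (𝟙 X) (g ≫ specFst k)
    (by rw [Category.assoc, specFst_specDual, Category.id_comp, Category.comp_id]),
    Limits.pullback.lift_fst _ _ _, ?_⟩
  refine IsPullback.of_right (h₁₂ := Limits.pullback.fst g (specDual k)) (v₁₃ := g)
    (h₂₂ := specDual k) ?_ (Limits.pullback.lift_snd _ _ _) (IsPullback.of_hasPullback _ _)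
  rw [Limits.pullback.lift_fst, specFst_specDual]
  exact IsPullback.of_horiz_isIso ⟨by simp⟩

theorem flat_of_field (g : X ⟶ Spec (.of k)) : Flat g := inferInstance

/-- A thickening with a retraction is a product. -/
theorem isPullback_of_retraction {f : Z ⟶ Spec (.of (DualNumber k))}
    (H : IsPullback i g f (specFst k)) [Flat f] (r : Z ⟶ X) (hr : i ≫ r = 𝟙 X)
    (hf : r ≫ g = f ≫ specDual k) : IsPullback r f g (specDual k) := by
  obtain ⟨i', h1, H'⟩ := isPullback_trivial g
  have hg := flat_of_field g
  -- The map to the product is compatible with both inclusions of `X`, hence is a morphism of flat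
  -- thickenings and an isomorphism.
  let φ : Z ⟶ Limits.pullback g (specDual k) := Limits.pullback.lift r f hf
  have e : i ≫ φ = i' := by
    apply Limits.pullback.hom_ext
    · rw [Category.assoc, Limits.pullback.lift_fst, h1, hr]
    · rw [Category.assoc, Limits.pullback.lift_snd, H'.w, H.w]
  have e' : φ ≫ Limits.pullback.snd g (specDual k) = f := Limits.pullback.lift_snd _ _ _
  have : Flat (φ ≫ Limits.pullback.snd g (specDual k)) := by rwa [e']
  have : IsIso φ := isIso_of_thickenings (i := i) (g := g)
    (f' := Limits.pullback.snd g (specDual k)) (by rwa [e']) (by rwa [e])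
  exact IsPullback.of_iso_pullback ⟨hf⟩ (asIso φ) (Limits.pullback.lift_fst _ _ _) e'

end Thickening


/-! ### Compatibility of multiplication by `ε` with sums, products and brackets. -/

section

variable {k : Type u} [Field k] {X Z : Scheme.{u}} {f : Z ⟶ Spec (.of (DualNumber k))}
  {g : X ⟶ Spec (.of k)} {i : X ⟶ Z} {W : Z.Opens}

theorem IsEpsMul.of_affine (H : IsPullback i g f (specFst k)) [Flat f] {b : Γ(X, i ⁻¹ᵁ W)}
    {c : Γ(Z, W)} (h : ∀ (V : Z.Opens) (hV : V ≤ W), IsAffineOpen V → ∃ y : Γ(Z, V),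
      PoissonDeformation.res X (i.preimage_mono hV) b = i.app V y ∧
      PoissonDeformation.res Z hV c = epsOf f V * y) : IsEpsMul f i W b c :=
  IsEpsMul.of_local fun p hp => by
    obtain ⟨V, hV, hVW, hpV⟩ := exists_affine_le hp
    obtain ⟨y, h1, h2⟩ := h V hVW hV
    refine ⟨V, hVW, hpV, ?_⟩
    rw [h1, h2]
    exact isEpsMul_mul H y

theorem IsEpsMul.exists_lift (H : IsPullback i g f (specFst k)) {b : Γ(X, i ⁻¹ᵁ W)}
    {c : Γ(Z, W)} (h : IsEpsMul f i W b c) {V : Z.Opens} (hV : V ≤ W) (hV' : IsAffineOpen V) :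
    ∃ y : Γ(Z, V), i.app V y = PoissonDeformation.res X (i.preimage_mono hV) b ∧
      PoissonDeformation.res Z hV c = epsOf f V * y := by
  obtain ⟨y, hy⟩ := exists_app_eq H hV' (PoissonDeformation.res X (i.preimage_mono hV) b)
  exact ⟨y, hy, h V hV hV' y hy⟩

theorem IsEpsMul.add (H : IsPullback i g f (specFst k)) [Flat f] 
    {b b' : Γ(X, i ⁻¹ᵁ W)} {c c' : Γ(Z, W)} (h : IsEpsMul f i W b c)
    (h' : IsEpsMul f i W b' c') : IsEpsMul f i W (b + b') (c + c') :=
  IsEpsMul.of_affine H fun V hV hV' => by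
    obtain ⟨y, h1, h2⟩ := h.exists_lift H hV hV'
    obtain ⟨y', h1', h2'⟩ := h'.exists_lift H hV hV'
    exact ⟨y + y', by rw [map_add, map_add, h1, h1'], by rw [map_add, mul_add, h2, h2']⟩

theorem IsEpsMul.mul (H : IsPullback i g f (specFst k)) [Flat f] 
    {b : Γ(X, i ⁻¹ᵁ W)} {c : Γ(Z, W)} (h : IsEpsMul f i W b c) (a : Γ(Z, W)) :
    IsEpsMul f i W (i.app W a * b) (a * c) :=
  IsEpsMul.of_affine H fun V hV hV' => by
    obtain ⟨y, h1, h2⟩ := h.exists_lift H hV hV'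
    exact ⟨PoissonDeformation.res Z hV a * y, by rw [map_mul, map_mul, h1, res_app],
      by rw [map_mul, h2]; ring⟩

/-- `ε` is central for the bracket, so `{ε y, a} = ε {y, a}`. -/
theorem IsEpsMul.br (H : IsPullback i g f (specFst k)) [Flat f] 
    {S : Scheme.{u}} {g' : X ⟶ S} {P : PoissonStructure f}
    {Q : PoissonStructure g'} (hi : IsPoissonHom Q P i) {b : Γ(X, i ⁻¹ᵁ W)} {c : Γ(Z, W)}
    (h : IsEpsMul f i W b c) (a : Γ(Z, W)) :
    IsEpsMul f i W ((Q.bracket _).br b (i.app W a)) ((P.bracket W).br c a) :=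
  IsEpsMul.of_affine H fun V hV hV' => by
    obtain ⟨y, h1, h2⟩ := h.exists_lift H hV hV'
    refine ⟨(P.bracket V).br y (PoissonDeformation.res Z hV a), ?_, ?_⟩
    · rw [hi, h1, Q.res_br _ _ _, res_app]
    · have h3 : (P.bracket V).br (epsOf f V) (PoissonDeformation.res Z hV a) = 0 :=
        P.base_br ⊤ V le_top _ _
      rw [P.res_br _ _ _, h2, PoissonBracket.leibniz, h3, mul_zero, add_zero]

end

/-! ### The extension of sheaves on `X` underlying a deformation. -/

namespace FirstOrderDeformation

variable {k : Type u} [Field k] {X : Scheme.{u}} [X.Over (Spec (.of k))]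
  {Λ : PoissonStructure (X ↘ Spec (.of k))} (ξ : FirstOrderDeformation Λ)

theorem isHomeomorph_incl : IsHomeomorph ξ.incl := isHomeomorph_of_isPullback ξ.isPullback

/-- The inverse of the inclusion of `X`, a continuous map. -/
noncomputable def inv : ξ.total.carrier ⟶ X.carrier :=
  TopCat.ofHom ⟨(ξ.isHomeomorph_incl.homeomorph ξ.incl).symm, Homeomorph.continuous _⟩

theorem inv_incl (x : X) : ξ.inv (ξ.incl x) = x :=
  (ξ.isHomeomorph_incl.homeomorph ξ.incl).symm_apply_apply x

theorem incl_inv (z : ξ.total) : ξ.incl (ξ.inv z) = z :=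
  (ξ.isHomeomorph_incl.homeomorph ξ.incl).apply_symm_apply z

/-- The open subset of the total space corresponding to an open subset of `X`. -/
noncomputable def up (U : X.Opens) : ξ.total.Opens := (Opens.map ξ.inv).obj U

theorem mem_up {U : X.Opens} {z : ξ.total} : z ∈ ξ.up U ↔ ξ.inv z ∈ U := Iff.rfl

theorem incl_mem_up {U : X.Opens} {x : X} : ξ.incl x ∈ ξ.up U ↔ x ∈ U := by
  rw [mem_up, inv_incl]

theorem incl_up (U : X.Opens) : ξ.incl ⁻¹ᵁ ξ.up U = U := by
  ext x
  exact ξ.incl_mem_up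

theorem up_incl (W : ξ.total.Opens) : ξ.up (ξ.incl ⁻¹ᵁ W) = W := by
  ext z
  change ξ.incl (ξ.inv z) ∈ W ↔ z ∈ W
  rw [incl_inv]

theorem up_mono {U V : X.Opens} (h : V ≤ U) : ξ.up V ≤ ξ.up U := fun _ hz => h hz

/-- Restriction of functions to `X`. -/
noncomputable def toX (U : X.Opens) : Γ(ξ.total, ξ.up U) →+* Γ(X, U) :=
  (res X (ξ.incl_up U).ge).comp (ξ.incl.app (ξ.up U)).hom

theorem toX_apply (U : X.Opens) (a : Γ(ξ.total, ξ.up U)) :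
    ξ.toX U a = res X (ξ.incl_up U).ge (ξ.incl.app (ξ.up U) a) := rfl

theorem app_eq_toX (U : X.Opens) (a : Γ(ξ.total, ξ.up U)) :
    ξ.incl.app (ξ.up U) a = res X (ξ.incl_up U).le (ξ.toX U a) := by
  rw [toX_apply, res_res, res_self]

theorem toX_res {U V : X.Opens} (h : V ≤ U) (a : Γ(ξ.total, ξ.up U)) :
    ξ.toX V (res ξ.total (ξ.up_mono h) a) = res X h (ξ.toX U a) := by
  rw [toX_apply, toX_apply, ← res_app ξ.incl (ξ.up_mono h), res_res, res_res]

/-- `c` is `ε` times any lift of `b`. -/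
def IsEps (U : X.Opens) (b : Γ(X, U)) (c : Γ(ξ.total, ξ.up U)) : Prop :=
  IsEpsMul ξ.proj ξ.incl (ξ.up U) (res X (ξ.incl_up U).le b) c

theorem exists_isEps {U : X.Opens} (b : Γ(X, U)) : ∃ c, ξ.IsEps U b c :=
  have := ξ.flat
  exists_isEpsMul ξ.isPullback _

theorem isEps_mul {U : X.Opens} (a : Γ(ξ.total, ξ.up U)) :
    ξ.IsEps U (ξ.toX U a) (epsOf ξ.proj _ * a) := by
  have := ξ.flat
  unfold IsEps
  rw [← app_eq_toX]
  exact isEpsMul_mul ξ.isPullback a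

variable {ξ}

theorem IsEps.unique {U : X.Opens} {b : Γ(X, U)} {c c' : Γ(ξ.total, ξ.up U)} (h : ξ.IsEps U b c)
    (h' : ξ.IsEps U b c') : c = c' := IsEpsMul.unique ξ.isPullback h h'

theorem IsEps.res {U V : X.Opens} (hV : V ≤ U) {b : Γ(X, U)} {c : Γ(ξ.total, ξ.up U)}
    (h : ξ.IsEps U b c) : ξ.IsEps V (PoissonDeformation.res X hV b)
      (PoissonDeformation.res ξ.total (ξ.up_mono hV) c) := by
  have := IsEpsMul.res h (ξ.up_mono hV)
  rw [res_res] at this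
  unfold IsEps
  rwa [res_res]

variable (ξ)

/-- Multiplication by `ε`. -/
noncomputable def mulEps (U : X.Opens) : Γ(X, U) →+ Γ(ξ.total, ξ.up U) :=
  AddMonoidHom.mk' (fun b => (ξ.exists_isEps b).choose) fun a b => by
    have := ξ.flat
    have h := (ξ.exists_isEps (a + b)).choose_spec
    refine IsEps.unique h ?_
    unfold IsEps
    rw [map_add]
    exact IsEpsMul.add ξ.isPullback (ξ.exists_isEps a).choose_spec (ξ.exists_isEps b).choose_spec

theorem isEps_mulEps {U : X.Opens} (b : Γ(X, U)) : ξ.IsEps U b (ξ.mulEps U b) :=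
  (ξ.exists_isEps b).choose_spec

variable {ξ}

theorem IsEps.eq {U : X.Opens} {b : Γ(X, U)} {c : Γ(ξ.total, ξ.up U)} (h : ξ.IsEps U b c) :
    c = ξ.mulEps U b := h.unique (ξ.isEps_mulEps b)

variable (ξ)

theorem mulEps_toX {U : X.Opens} (a : Γ(ξ.total, ξ.up U)) :
    ξ.mulEps U (ξ.toX U a) = epsOf ξ.proj _ * a := (ξ.isEps_mul a).eq.symm

theorem toX_mulEps {U : X.Opens} (b : Γ(X, U)) : ξ.toX U (ξ.mulEps U b) = 0 := by
  have := ξ.flat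
  rw [toX_apply, IsEpsMul.app_eq_zero ξ.isPullback (ξ.isEps_mulEps b), map_zero]

theorem mulEps_injective (U : X.Opens) : Function.Injective (ξ.mulEps U) :=
  (injective_iff_map_eq_zero _).2 fun a ha => by
    have := ξ.flat
    have h := ξ.isEps_mulEps a
    rw [ha] at h
    have h1 := IsEpsMul.eq_zero ξ.isPullback h
    have := congrArg (PoissonDeformation.res X (ξ.incl_up U).ge) h1
    rwa [res_res, res_self, map_zero] at this

theorem exists_mulEps_eq {U : X.Opens} (a : Γ(ξ.total, ξ.up U)) (ha : ξ.toX U a = 0) :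
    ∃ b, ξ.mulEps U b = a := by
  have := ξ.flat
  obtain ⟨b, hb⟩ := exists_isEpsMul_of_app_eq_zero ξ.isPullback (W := ξ.up U) a
    (by rw [app_eq_toX, ha, map_zero])
  refine ⟨res X (ξ.incl_up U).ge b, (IsEps.eq ?_).symm⟩
  unfold IsEps
  rwa [res_res, res_self]

theorem mul_mulEps {U : X.Opens} (a : Γ(ξ.total, ξ.up U)) (b : Γ(X, U)) :
    a * ξ.mulEps U b = ξ.mulEps U (ξ.toX U a * b) :=
  IsEps.eq (by
    have := ξ.flat
    unfold IsEps
    rw [map_mul, ← app_eq_toX]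
    exact IsEpsMul.mul ξ.isPullback (ξ.isEps_mulEps b) a)

theorem toX_scalar {U : X.Opens} (c : k) :
    ξ.toX U (ξ.scalar (ξ.up U) (algebraMap k _ c)) = algebraMap k Γ(X, U) c := by
  change ξ.toX U (scalarOf ξ.proj _ _) = _
  rw [toX_apply, app_scalarOf ξ.isPullback.toCommSq]
  exact res_algebraMap k X _ c

theorem toX_br {U : X.Opens} (a b : Γ(ξ.total, ξ.up U)) :
    ξ.toX U ((ξ.poisson.bracket _).br a b) = (Λ.bracket U).br (ξ.toX U a) (ξ.toX U b) := by
  rw [toX_apply, ξ.incl_poisson, Λ.res_br _ _ _]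
  rfl

theorem br_mulEps {U : X.Opens} (a : Γ(X, U)) (b : Γ(ξ.total, ξ.up U)) :
    (ξ.poisson.bracket _).br (ξ.mulEps U a) b =
      ξ.mulEps U ((Λ.bracket U).br a (ξ.toX U b)) :=
  IsEps.eq (by
    have := ξ.flat
    unfold IsEps
    rw [Λ.res_br _ _ (ξ.incl_up U).le, ← app_eq_toX]
    exact IsEpsMul.br ξ.isPullback ξ.incl_poisson (ξ.isEps_mulEps a) b)

/-- The sheaf-theoretic deformation underlying a deformation. -/
noncomputable def ext : SheafExt Λ where
  F := (TopCat.Presheaf.pushforward CommRingCat ξ.inv).obj ξ.total.presheaf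
  isSheaf := TopCat.Sheaf.pushforward_sheaf_of_sheaf ξ.inv ξ.total.IsSheaf
  π U := ξ.toX U
  π_res _ _ h a := ξ.toX_res h a
  e U := ξ.mulEps U
  e_res _ _ h a := ((ξ.isEps_mulEps a).res h).eq
  π_e _ a := ξ.toX_mulEps a
  e_injective U := ξ.mulEps_injective U
  exact _ a ha := ξ.exists_mulEps_eq a ha
  mul_e _ a b := ξ.mul_mulEps a b
  const U := (ξ.scalar (ξ.up U)).comp (algebraMap k _)
  const_res _ _ _ _ := res_scalarOf _ _ _
  π_const _ c := ξ.toX_scalar c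
  bracket U := ξ.poisson.bracket (ξ.up U)
  bracket_res _ _ _ _ _ := ξ.poisson.res_br _ _ _ _ _
  bracket_const _ _ _ := ξ.poisson.base_br ⊤ _ le_top _ _
  π_br _ a b := ξ.toX_br a b
  br_e _ a b := ξ.br_mulEps a b

end FirstOrderDeformation


/-! ### Constructing morphisms out of a thickening, and scalars of schemes over a ring. -/

section

variable {X Z Z' : Scheme.{u}}

/-- The sections `f.app W a` and `g.app W a` live over different preimages; restricting to any `V`
inside both allows a comparison without transport. -/
theorem hom_ext_of_res {f g : X ⟶ Z} (h : ∀ x, f x = g x)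
    (h' : ∀ (W : Z.Opens) (V : X.Opens) (hf : V ≤ f ⁻¹ᵁ W) (hg : V ≤ g ⁻¹ᵁ W) (a : Γ(Z, W)),
      res X hf (f.app W a) = res X hg (g.app W a)) : f = g := by
  have hb : ∀ W : Z.Opens, g ⁻¹ᵁ W ≤ f ⁻¹ᵁ W := fun W x hx => by
    change f x ∈ W
    rw [h]
    exact hx
  refine Scheme.Hom.ext (TopCat.hom_ext (ContinuousMap.ext h)) fun W => ?_
  refine CommRingCat.hom_ext (RingHom.ext fun a => ?_)
  exact (h' W _ (hb W) le_rfl a).trans (res_self _ _ _)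

/-- A morphism out of a homeomorphic thickening is given by its restriction and maps on sections. -/
theorem exists_hom_of_isHomeomorph {i : X ⟶ Z} (hi : IsHomeomorph i) (j : X ⟶ Z')
    (φ : ∀ (W : Z.Opens) (V : Z'.Opens), i ⁻¹ᵁ W ≤ j ⁻¹ᵁ V → Γ(Z', V) →+* Γ(Z, W))
    (hφ : ∀ W V h a, i.app W (φ W V h a) = res X h (j.app V a))
    (hr : ∀ W V h W' V' h' (hW : W' ≤ W) (hV : V' ≤ V) a,
      res Z hW (φ W V h a) = φ W' V' h' (res Z' hV a)) :
    ∃ ψ : Z ⟶ Z', i ≫ ψ = j ∧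
      ∀ W V (h : W ≤ ψ ⁻¹ᵁ V) h' a, res Z h (ψ.app V a) = φ W V h' a := by
  let c : Z.carrier ⟶ X.carrier := TopCat.ofHom ⟨(hi.homeomorph i).symm, Homeomorph.continuous _⟩
  have hci : ∀ x, c (i x) = x := (hi.homeomorph i).symm_apply_apply
  have hic : ∀ z, i (c z) = z := (hi.homeomorph i).apply_symm_apply
  let b : Z.carrier ⟶ Z'.carrier := c ≫ j.base
  have hb : ∀ z, b z = j (c z) := fun z => rfl
  have hle : ∀ V : Z'.Opens, i ⁻¹ᵁ ((Opens.map b).obj V) ≤ j ⁻¹ᵁ V := fun V x hx => by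
    change b (i x) ∈ V at hx
    rw [hb, hci] at hx
    exact hx
  let ψ : Z ⟶ Z' := mkHom b (fun V => φ ((Opens.map b).obj V) V (hle V))
    (fun V V' h a => hr _ _ _ _ _ _ _ _ _) (fun V a z h hz => by
      -- Locality on stalks: an image that is invertible at `z` stays invertible after restriction
      -- to `X`, where it is `j.app V a`. As `j` is a morphism of schemes, `a` is invertible at the
      -- image point.
      have h1 : z ∈ Z.basicOpen (φ ((Opens.map b).obj V) V (hle V) a) :=
        (Z.mem_basicOpen _ z h).2 hz
      have h2 : c z ∈ i ⁻¹ᵁ Z.basicOpen (φ ((Opens.map b).obj V) V (hle V) a) := by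
        change i (c z) ∈ Z.basicOpen (φ ((Opens.map b).obj V) V (hle V) a)
        rwa [hic]
      rw [Scheme.preimage_basicOpen, hφ] at h2
      have h3 : c z ∈ X.basicOpen (j.app V a) := 
        ((X.basicOpen_res (j.app V a) (homOfLE (hle V)).op).le h2 : c z ∈ _ ⊓ _).2
      rw [← Scheme.preimage_basicOpen] at h3
      exact (Z'.mem_basicOpen a (b z) h).1 h3)
  have key : ∀ W V (h : W ≤ ψ ⁻¹ᵁ V) h' a, res Z h (ψ.app V a) = φ W V h' a := by
    intro W V h h' a
    refine (hr ((Opens.map b).obj V) V (hle V) W V h' h le_rfl a).trans ?_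
    rw [res_self]
  refine ⟨ψ, hom_ext_of_res (fun x => ?_) fun V U h1 h2 a => ?_, key⟩
  · change j (c (i x)) = j x
    rw [hci]
  · rw [comp_app' i ψ V a]
    have h3 : ψ.app V a = φ (ψ ⁻¹ᵁ V) V (hle V) a :=
      (res_self _ le_rfl _).symm.trans (key _ V le_rfl _ a)
    have h4 := hφ (ψ ⁻¹ᵁ V) V (hle V) a
    exact (congrArg (res X h1) ((congrArg _ h3).trans h4)).trans (res_res _ _ _)

end

section Scalars

variable {R : CommRingCat.{u}} {X Z : Scheme.{u}}

/-- The ring homomorphism from `R` to the sections of an `R`-scheme. -/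
noncomputable def fnOf (f : Z ⟶ Spec R) (W : Z.Opens) : R →+* Γ(Z, W) :=
  (f.appLE ⊤ W le_top).hom.comp (Scheme.ΓSpecIso R).inv.hom

theorem res_fnOf (f : Z ⟶ Spec R) {V W : Z.Opens} (h : V ≤ W) (c : R) :
    res Z h (fnOf f W c) = fnOf f V c := by
  have := f.appLE_map (U := ⊤) (V := W) le_top (homOfLE h).op
  exact congrArg (fun f => f.hom ((Scheme.ΓSpecIso R).inv.hom c)) this

theorem app_fnOf (f : Z ⟶ Spec R) (φ : X ⟶ Z) (W : Z.Opens) (c : R) :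
    φ.app W (fnOf f W c) = fnOf (φ ≫ f) (φ ⁻¹ᵁ W) c := by
  have h1 : f.appLE ⊤ W le_top ≫ φ.app W = (φ ≫ f).appLE ⊤ (φ ⁻¹ᵁ W) le_top := by
    rw [Scheme.Hom.app_eq_appLE]
    exact Scheme.Hom.appLE_comp_appLE φ f ⊤ W (φ ⁻¹ᵁ W) le_top le_rfl
  exact congrArg (fun f => f.hom ((Scheme.ΓSpecIso R).inv.hom c)) h1

theorem fnOf_ι (f : Z ⟶ Spec R) (V : Z.Opens) (W : V.toScheme.Opens) (c : R) :
    fnOf (V.ι ≫ f) W c = fnOf f (V.ι ''ᵁ W) c := by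
  have h := app_fnOf f V.ι (V.ι ''ᵁ W) c
  rw [Scheme.Opens.ι_app] at h
  have h2 := congrArg (res V.toScheme (V := W) (V.ι.preimage_image_eq W).ge) h
  rw [res_fnOf] at h2
  refine h2.symm.trans ?_
  have h3 := res_self (V.ι ''ᵁ W) le_rfl (fnOf f (V.ι ''ᵁ W) c)
  refine Eq.trans ?_ h3
  exact res_res (V.ι.image_mono (V.ι.preimage_image_eq W).le)
    (V.ι.image_mono (V.ι.preimage_image_eq W).ge) _

theorem fnOf_ext {f g : Z ⟶ Spec R} (h : ∀ c, fnOf f ⊤ c = fnOf g ⊤ c) : f = g := by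
  refine ext_of_isAffine ?_
  have : (Scheme.ΓSpecIso R).inv ≫ f.appTop = (Scheme.ΓSpecIso R).inv ≫ g.appTop := by
    refine CommRingCat.hom_ext (RingHom.ext fun c => ?_)
    have e : ∀ f : Z ⟶ Spec R, f.appLE ⊤ ⊤ le_top = f.appTop := fun f => f.app_eq_appLE.symm
    have := h c
    rw [fnOf, fnOf, e, e] at this
    exact this
  exact (cancel_epi _).1 this

theorem fnOf_comp_map {S : CommRingCat.{u}} (f : Z ⟶ Spec R) (φ : S ⟶ R) (W : Z.Opens) (c : S) :
    fnOf (f ≫ Spec.map φ) W c = fnOf f W (φ c) := by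
  have h1 : (f ≫ Spec.map φ).appLE ⊤ W le_top = (Spec.map φ).appTop ≫ f.appLE ⊤ W le_top :=
    Scheme.Hom.comp_appLE f (Spec.map φ) ⊤ W le_top
  have h2 := Scheme.ΓSpecIso_inv_naturality φ
  have h3 : (Scheme.ΓSpecIso S).inv ≫ (f ≫ Spec.map φ).appLE ⊤ W le_top =
      φ ≫ (Scheme.ΓSpecIso R).inv ≫ f.appLE ⊤ W le_top := by
    rw [h1, ← Category.assoc, ← h2, Category.assoc]
  exact congrArg (fun f => f.hom c) h3

end Scalars

section Retraction

variable {k : Type u} [Field k] {X Z : Scheme.{u}} {f : Z ⟶ Spec (.of (DualNumber k))}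
  {g : X ⟶ Spec (.of k)} {i : X ⟶ Z}

/-- A splitting of a thickening of `X` gives a retraction to `X`. -/
theorem exists_retraction (H : IsPullback i g f (specFst k)) [Flat f]
    (φ : ∀ (W : Z.Opens) (V : X.Opens), i ⁻¹ᵁ W ≤ V → Γ(X, V) →+* Γ(Z, W))
    (hφ : ∀ W V h a, i.app W (φ W V h a) = res X h a)
    (hr : ∀ W V h W' V' h' (hW : W' ≤ W) (hV : V' ≤ V) a,
      res Z hW (φ W V h a) = φ W' V' h' (res X hV a))
    (hc : ∀ W V h (c : k), φ W V h (fnOf g V c) = fnOf f W (algebraMap k (DualNumber k) c)) :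
    ∃ r : Z ⟶ X, IsPullback r f g (specDual k) ∧ i ≫ r = 𝟙 X ∧
      ∀ W V (h : W ≤ r ⁻¹ᵁ V) h' a, res Z h (r.app V a) = φ W V h' a := by
  obtain ⟨r, h1, h2⟩ := exists_hom_of_isHomeomorph (isHomeomorph_of_isPullback H) (𝟙 X) φ
    (fun W V h a => hφ W V h a) hr
  refine ⟨r, isPullback_of_retraction H r h1 (fnOf_ext fun c => ?_), h1, h2⟩
  have h3 := (h2 ⊤ ⊤ le_top le_rfl (fnOf g ⊤ c)).trans (hc ⊤ ⊤ le_rfl c)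
  have h4 : res Z (le_top : ⊤ ≤ r ⁻¹ᵁ ⊤) (r.app ⊤ (fnOf g ⊤ c)) = fnOf (r ≫ g) ⊤ c :=
    (congrArg _ (app_fnOf g r ⊤ c)).trans (res_fnOf (r ≫ g) (V := ⊤) (W := ⊤) le_top c)
  exact h4.symm.trans (h3.trans (fnOf_comp_map f _ ⊤ c).symm)

end Retraction


/-! ### Isomorphisms of deformations as morphisms of extensions. -/

namespace FirstOrderDeformation

variable {k : Type u} [Field k] {X : Scheme.{u}} [X.Over (Spec (.of k))]
  {Λ : PoissonStructure (X ↘ Spec (.of k))} (ξ η : FirstOrderDeformation Λ)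

theorem exists_toX_eq {U : X.Opens} {x : X} (hx : x ∈ U) (b : Γ(X, U)) :
    ∃ (V : X.Opens) (hV : V ≤ U) (y : Γ(ξ.total, ξ.up V)), x ∈ V ∧ ξ.toX V y = res X hV b := by
  obtain ⟨V, hV, hVU, hxV⟩ := exists_affine_le (ξ.incl_mem_up.2 hx)
  have hVU' : ξ.incl ⁻¹ᵁ V ≤ U := (ξ.incl.preimage_mono hVU).trans (ξ.incl_up U).le
  obtain ⟨y, hy⟩ := exists_app_eq ξ.isPullback hV (res X hVU' b)
  refine ⟨ξ.incl ⁻¹ᵁ V, hVU', res ξ.total (ξ.up_incl V).le y, hxV, ?_⟩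
  rw [toX_apply, ← res_app ξ.incl (ξ.up_incl V).le, hy, res_res, res_res]

theorem mulEps_one (U : X.Opens) : ξ.mulEps U 1 = epsOf ξ.proj _ := by
  have := ξ.mulEps_toX (U := U) 1
  rwa [map_one, mul_one] at this

variable {ξ η}

/-- Locally `a` lifts to some `y`, and `ε a` is the product `ε * y`, which a ring homomorphism
fixing `ε` and commuting with restriction to `X` respects. -/
theorem map_mulEps_of_map_eps {φ : ∀ U, Γ(η.total, η.up U) →+* Γ(ξ.total, ξ.up U)}
    (hr : ∀ U V (h : V ≤ U) a, res ξ.total (ξ.up_mono h) (φ U a) =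
      φ V (res η.total (η.up_mono h) a))
    (hφ : ∀ U a, ξ.toX U (φ U a) = η.toX U a)
    (he : ∀ U, φ U (epsOf η.proj _) = epsOf ξ.proj _) (U : X.Opens) (a : Γ(X, U)) :
    φ U (η.mulEps U a) = ξ.mulEps U a :=
  ξ.ext.sec_local fun x hx => by
    obtain ⟨V, hV, y, hxV, hy⟩ := η.exists_toX_eq hx a
    refine ⟨V, hV, hxV, ?_⟩
    have h1 : res η.total (η.up_mono hV) (η.mulEps U a) = epsOf η.proj _ * y := by
      rw [← mulEps_toX, hy]
      exact η.ext.e_res U V hV a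
    have h2 : res ξ.total (ξ.up_mono hV) (φ U (η.mulEps U a)) = epsOf ξ.proj _ * φ V y := by
      rw [hr U V hV, h1, map_mul, he]
    refine h2.trans ?_
    rw [← mulEps_toX, hφ, hy]
    exact (ξ.ext.e_res U V hV a).symm

theorem Equivalent.nonempty_hom (h : ξ.Equivalent η) : Nonempty (η.ext.Hom ξ.ext) := by
  obtain ⟨φ, h1, h2, h3⟩ := h
  have hle : ∀ U, ξ.up U ≤ φ.hom ⁻¹ᵁ η.up U := fun U z hz => by
    change φ.hom z ∈ η.up U
    rw [← ξ.incl_inv z] at hz ⊢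
    have : φ.hom (ξ.incl (ξ.inv z)) = η.incl (ξ.inv z) := by rw [← h2]; rfl
    rw [this, incl_mem_up]
    rwa [incl_mem_up] at hz
  let Φ : ∀ U, Γ(η.total, η.up U) →+* Γ(ξ.total, ξ.up U) := fun U =>
    (res ξ.total (hle U)).comp (φ.hom.app (η.up U)).hom
  have hΦ : ∀ U a, Φ U a = res ξ.total (hle U) (φ.hom.app (η.up U) a) := fun U a => rfl
  have hr : ∀ U V (h : V ≤ U) a, res ξ.total (ξ.up_mono h) (Φ U a) =
      Φ V (res η.total (η.up_mono h) a) := fun U V h a => by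
    rw [hΦ, hΦ, ← res_app φ.hom (η.up_mono h), res_res, res_res]
  have hX : ∀ U a, ξ.toX U (Φ U a) = η.toX U a := fun U a => by
    rw [toX_apply, toX_apply, hΦ, ← res_app ξ.incl (hle U), res_res]
    exact (congrArg _ (comp_app' ξ.incl φ.hom (η.up U) a)).symm.trans
      (res_app_congr h2 _ (η.incl_up U).ge a)
  have hs : ∀ U c, Φ U (scalarOf η.proj _ c) = scalarOf ξ.proj _ c := fun U c => by
    rw [hΦ]
    have : φ.hom.app (η.up U) (scalarOf η.proj _ c) = scalarOf ξ.proj (φ.hom ⁻¹ᵁ η.up U) c := by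
      rw [← h1]
      exact app_scalar η.proj φ.hom _ c
    rw [this, res_scalarOf]
  exact ⟨⟨Φ, hr, hX, map_mulEps_of_map_eps hr hX fun U => hs U _, fun U c => hs U _,
    fun U a b => by
      refine (congrArg _ (h3 _ _ _)).trans (ξ.poisson.res_br _ _ (hle U) _ _)⟩⟩

/-- The morphism of schemes goes against `Φ`. Invertibility of `Φ` need not be given, since
morphisms of flat thickenings are isomorphisms. -/
theorem equivalent_of_hom (Φ : η.ext.Hom ξ.ext) : ξ.Equivalent η := by
  have hle : ∀ {W : ξ.total.Opens} {V : η.total.Opens}, ξ.incl ⁻¹ᵁ W ≤ η.incl ⁻¹ᵁ V →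
      η.up (ξ.incl ⁻¹ᵁ W) ≤ V := fun h => (η.up_mono h).trans (η.up_incl _).le
  let Ψ : ∀ U, Γ(η.total, η.up U) →+* Γ(ξ.total, ξ.up U) := Φ.φ
  have hΨr : ∀ U V (h : V ≤ U) a, res ξ.total (ξ.up_mono h) (Ψ U a) =
      Ψ V (res η.total (η.up_mono h) a) := Φ.φ_res
  have hΨX : ∀ U a, ξ.toX U (Ψ U a) = η.toX U a := Φ.π_φ
  have hΨc : ∀ U (c : k), Ψ U (scalarOf η.proj _ (algebraMap k _ c)) =
    scalarOf ξ.proj _ (algebraMap k _ c) := Φ.φ_const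
  have hΨe : ∀ U, Ψ U (epsOf η.proj _) = epsOf ξ.proj _ := fun U => by
    rw [← mulEps_one, ← mulEps_one]
    exact Φ.φ_e U 1
  have hΨs : ∀ U c, Ψ U (scalarOf η.proj _ c) = scalarOf ξ.proj _ c := fun U c => by
    rw [scalarOf_eq η.proj, scalarOf_eq ξ.proj, map_add, map_mul, hΨc, hΨc, hΨe]
  have hΨb : ∀ U a b, Ψ U ((η.poisson.bracket _).br a b) =
    (ξ.poisson.bracket _).br (Ψ U a) (Ψ U b) := Φ.φ_br
  -- `Φ` is indexed by open subsets of `X`: restrict from `V` to the part of the total space of `η`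
  -- over `ξ.incl ⁻¹ᵁ W`, apply `Φ`, and identify `ξ.up (ξ.incl ⁻¹ᵁ W)` with `W`.
  let φ : ∀ (W : ξ.total.Opens) (V : η.total.Opens), ξ.incl ⁻¹ᵁ W ≤ η.incl ⁻¹ᵁ V →
      Γ(η.total, V) →+* Γ(ξ.total, W) := fun W V h =>
    (res ξ.total (ξ.up_incl W).ge).comp ((Ψ (ξ.incl ⁻¹ᵁ W)).comp (res η.total (hle h)))
  have hφ : ∀ W V h a, φ W V h a =
    res ξ.total (ξ.up_incl W).ge (Ψ (ξ.incl ⁻¹ᵁ W) (res η.total (hle h) a)) := fun W V h a => rfl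
  obtain ⟨ψ, h1, h2⟩ := exists_hom_of_isHomeomorph ξ.isHomeomorph_incl η.incl φ
    (fun W V h a => by
      rw [hφ W V h, ← res_app ξ.incl (ξ.up_incl W).ge]
      have h3 := hΨX (ξ.incl ⁻¹ᵁ W) (res η.total (hle h) a)
      rw [app_eq_toX, h3, toX_apply, ← res_app η.incl (hle h), res_res, res_res, res_res])
    (fun W V h W' V' h' hW hV a => by
      rw [hφ W V h, hφ W' V' h', res_res, res_res,
        ← res_res (hle h) (η.up_mono (ξ.incl.preimage_mono hW)),
        ← hΨr _ _ (ξ.incl.preimage_mono hW), res_res])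
  have h3 : ψ ≫ η.proj = ξ.proj := fnOf_ext fun c => by
    have h4 := h2 ⊤ ⊤ le_top le_rfl (scalarOf η.proj ⊤ c)
    rw [hφ ⊤ ⊤ le_rfl, res_scalarOf, hΨs, res_scalarOf] at h4
    refine Eq.trans ?_ h4
    exact ((congrArg _ (app_fnOf η.proj ψ ⊤ c)).trans
      (res_fnOf (ψ ≫ η.proj) (V := ⊤) (W := ⊤) le_top c)).symm
  have : Flat (ψ ≫ η.proj) := by rw [h3]; exact ξ.flat
  have := η.flat
  have : IsIso ψ := isIso_of_thickenings (i := ξ.incl) (g := X ↘ Spec (.of k)) (f' := η.proj)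
    (by rw [h3]; exact ξ.isPullback) (by rw [h1]; exact η.isPullback)
  have hV : ∀ V, ξ.incl ⁻¹ᵁ ψ ⁻¹ᵁ V ≤ η.incl ⁻¹ᵁ V := by
    intro V
    rw [← h1]
    rfl
  have h4 : ∀ V a, ψ.app V a = φ (ψ ⁻¹ᵁ V) V (hV V) a := by
    intro V a
    exact (res_self _ le_rfl _).symm.trans (h2 _ V le_rfl (hV V) a)
  have h5 : IsPoissonHom ξ.poisson η.poisson ψ := fun V a b => by
    rw [h4, h4, h4, hφ _ _ (hV V), hφ _ _ (hV V), hφ _ _ (hV V), η.poisson.res_br _ _ (hle (hV V)),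
      hΨb, ξ.poisson.res_br _ _ (ξ.up_incl _).ge]
  exact ⟨asIso ψ, h3, h1, h5⟩

theorem equivalent_iff : ξ.Equivalent η ↔ Nonempty (η.ext.Hom ξ.ext) :=
  ⟨Equivalent.nonempty_hom, fun ⟨Φ⟩ => equivalent_of_hom Φ⟩

end FirstOrderDeformation


/-! ### Trivial and locally trivial deformations in terms of splittings. -/

namespace FirstOrderDeformation

variable {k : Type u} [Field k] {X : Scheme.{u}} [X.Over (Spec (.of k))]
  {Λ : PoissonStructure (X ↘ Spec (.of k))} {ξ : FirstOrderDeformation Λ}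

/-- The ring homomorphisms of a splitting. -/
def splHom {U : X.Opens} (s : ξ.ext.Spl U) (W : X.Opens) (h : W ≤ U) :
    Γ(X, W) →+* Γ(ξ.total, ξ.up W) := s.s W h

theorem toX_splHom {U : X.Opens} (s : ξ.ext.Spl U) (W : X.Opens) (h : W ≤ U) (f : Γ(X, W)) :
    ξ.toX W (splHom s W h f) = f := s.π_s W h f

theorem res_splHom {U : X.Opens} (s : ξ.ext.Spl U) {W : X.Opens} (h : W ≤ U) {W' : X.Opens}
    (h' : W' ≤ W) (f : Γ(X, W)) : res ξ.total (ξ.up_mono h') (splHom s W h f) =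
      splHom s W' (h'.trans h) (res X h' f) := s.s_res W h W' h' f

theorem splHom_fnOf {U : X.Opens} (s : ξ.ext.Spl U) {W : X.Opens} (h : W ≤ U) (c : k) :
    splHom s W h (fnOf (X ↘ Spec (.of k)) W c) = scalarOf ξ.proj (ξ.up W) (algebraMap k _ c) :=
  s.s_const W h c

variable (ξ) in
theorem exists_splHom_eq {U : X.Opens} (φ : ∀ W, W ≤ U → Γ(X, W) →+* Γ(ξ.total, ξ.up W))
    (hφ : ∀ W h f, ξ.toX W (φ W h f) = f)
    (hr : ∀ W h W' (h' : W' ≤ W) f, res ξ.total (ξ.up_mono h') (φ W h f) =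
      φ W' (h'.trans h) (res X h' f))
    (hc : ∀ W h (c : k), φ W h (fnOf (X ↘ Spec (.of k)) W c) =
      scalarOf ξ.proj (ξ.up W) (algebraMap k _ c)) :
    ∃ s : ξ.ext.Spl U, ∀ W h f, splHom s W h f = φ W h f :=
  ⟨⟨φ, hφ, hr, hc⟩, fun _ _ _ => rfl⟩

theorem lam_eq_zero_iff {U : X.Opens} (s : ξ.ext.Spl U) : s.lam = 0 ↔
    ∀ W (h : W ≤ U) f g, (ξ.poisson.bracket _).br (splHom s W h f) (splHom s W h g) =
      splHom s W h ((Λ.bracket W).br f g) := by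
  constructor
  · intro h W hW f g
    have h1 := s.e_lam W hW f g
    rw [h] at h1
    exact (sub_eq_zero.1 (h1.symm.trans (map_zero (ξ.ext.e W))))
  · intro h
    refine SheafExt.Spl.lam_unique fun W hW f g => ?_
    exact (map_zero (ξ.ext.e W)).trans (sub_eq_zero.2 (h W hW f g)).symm

theorem up_le_preimage {r : ξ.total ⟶ X} (hr : ξ.incl ≫ r = 𝟙 X) (W : X.Opens) :
    ξ.up W ≤ r ⁻¹ᵁ W := fun z hz => by
  rw [← ξ.incl_inv z] at hz ⊢
  rw [incl_mem_up] at hz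
  have : r (ξ.incl (ξ.inv z)) = ξ.inv z := by
    change (ξ.incl ≫ r) (ξ.inv z) = _
    rw [hr]
    rfl
  change r (ξ.incl (ξ.inv z)) ∈ W
  rwa [this]

theorem IsTrivial.exists_spl (h : ξ.IsTrivial) : ∃ s : ξ.ext.Spl ⊤, s.lam = 0 := by
  obtain ⟨r, H, hr, hP⟩ := h
  have hle := up_le_preimage hr
  obtain ⟨s, hs⟩ := ξ.exists_splHom_eq (U := ⊤)
    (fun W _ => (res ξ.total (hle W)).comp (r.app W).hom)
    (fun W _ f => by
      rw [toX_apply, RingHom.comp_apply, ← res_app ξ.incl (hle W), res_res]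
      exact (congrArg _ (comp_app' ξ.incl r W f)).symm.trans
        ((res_app_congr hr _ le_rfl f).trans (res_self _ _ _)))
    (fun W _ W' h' f => by
      rw [RingHom.comp_apply, RingHom.comp_apply, res_res]
      have := res_app r h' f
      refine Eq.trans ?_ (congrArg _ this)
      rw [res_res])
    (fun W _ c => by
      rw [RingHom.comp_apply]
      have h1 : r.app W (fnOf (X ↘ Spec (.of k)) W c) =
        fnOf (ξ.proj ≫ specDual k) (r ⁻¹ᵁ W) c := by
        rw [← H.w]
        exact app_fnOf (R := .of k) _ r W c
      have h2 := fnOf_comp_map ξ.proj (CommRingCat.ofHom (algebraMap k (DualNumber k))) (r ⁻¹ᵁ W) c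
      refine (congrArg (res ξ.total (hle W)) (h1.trans h2)).trans ?_
      exact res_scalarOf _ _ _)
  refine ⟨s, (lam_eq_zero_iff s).2 fun W h f g => ?_⟩
  rw [hs, hs, hs]
  refine ((ξ.poisson.res_br _ _ (hle W) _ _).symm).trans ?_
  exact congrArg _ (hP W f g).symm

theorem isTrivial_of_spl (s : ξ.ext.Spl ⊤) (hs : s.lam = 0) : ξ.IsTrivial := by
  rw [lam_eq_zero_iff] at hs
  have := ξ.flat
  let φ : ∀ (W : ξ.total.Opens) (V : X.Opens), ξ.incl ⁻¹ᵁ W ≤ V → Γ(X, V) →+* Γ(ξ.total, W) :=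
    fun W V h => (res ξ.total ((ξ.up_incl W).ge.trans (ξ.up_mono h))).comp (splHom s V le_top)
  have hφ : ∀ W V h a, φ W V h a = res ξ.total ((ξ.up_incl W).ge.trans (ξ.up_mono h))
    (splHom s V le_top a) := fun W V h a => rfl
  obtain ⟨r, h1, h2, h3⟩ := exists_retraction ξ.isPullback φ
    (fun W V h a => by
      have h4 := toX_splHom s V le_top a
      rw [hφ W V h, ← res_app ξ.incl, app_eq_toX, h4, res_res])
    (fun W V h W' V' h' hW hV a => by
      have h4 := res_splHom s (le_top : V ≤ ⊤) hV a
      rw [hφ W V h, hφ W' V' h', ← h4, res_res, res_res])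
    (fun W V h c => by
      have h4 := splHom_fnOf s (le_top : V ≤ ⊤) c
      rw [hφ W V h, h4, res_scalarOf]
      rfl)
  have hle := up_le_preimage h2
  have hle' : ∀ V, ξ.incl ⁻¹ᵁ r ⁻¹ᵁ V ≤ V := fun V => by
    rw [← Scheme.Hom.comp_preimage, h2]
    exact le_rfl
  refine ⟨r, h1, h2, fun V a b => ?_⟩
  have h4 : ∀ a, r.app V a = φ (r ⁻¹ᵁ V) V (hle' V) a := fun a =>
    (res_self _ le_rfl _).symm.trans (h3 _ V le_rfl (hle' V) a)
  rw [h4, h4, h4, hφ _ V (hle' V), hφ _ V (hle' V), hφ _ V (hle' V), ← hs]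
  exact ξ.poisson.res_br _ _ _ _ _

/-- A retraction of the total space onto `X` over `k` is a global splitting on sections. It is a
Poisson morphism exactly when the bivector of the splitting vanishes, and the cartesian condition is
automatic by `isPullback_of_retraction`. -/
theorem isTrivial_iff : ξ.IsTrivial ↔ ∃ s : ξ.ext.Spl ⊤, s.lam = 0 :=
  ⟨IsTrivial.exists_spl, fun ⟨s, hs⟩ => isTrivial_of_spl s hs⟩

theorem isPullback_restrict (V : ξ.total.Opens) : IsPullback (ξ.incl ∣_ V)
    ((ξ.incl ⁻¹ᵁ V).ι ≫ X ↘ Spec (.of k)) (V.ι ≫ ξ.proj) (specFst k) :=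
  (isPullback_morphismRestrict ξ.incl V).paste_vert ξ.isPullback

theorem morphismRestrict_app_eq (V : ξ.total.Opens) (W : V.toScheme.Opens)
    (a : Γ(ξ.total, V.ι ''ᵁ W)) : (ξ.incl ∣_ V).app W a =
      res X (image_morphismRestrict_preimage ξ.incl V W).le (ξ.incl.app (V.ι ''ᵁ W) a) := by
  rw [morphismRestrict_app]
  rfl

theorem IsLocallyTrivial.locSplit (h : ξ.IsLocallyTrivial) : ξ.ext.LocSplit := fun x => by
  obtain ⟨V, hxV, r, H, hr⟩ := h x
  refine ⟨ξ.incl ⁻¹ᵁ V, hxV, ?_⟩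
  let U := ξ.incl ⁻¹ᵁ V
  let t : V.toScheme ⟶ X := r ≫ U.ι
  have ht : (ξ.incl ∣_ V) ≫ t = U.ι := by rw [← Category.assoc, hr, Category.id_comp]
  -- `t` restricts to the inclusion on `X`, so the points over `W` lie in the preimage of `W` under
  -- `t`.
  have hle : ∀ W, W ≤ U → ξ.up W ≤ V.ι ''ᵁ (t ⁻¹ᵁ W) := fun W hW z hz => by
    rw [← ξ.incl_inv z] at hz ⊢
    rw [incl_mem_up] at hz
    have hV : ξ.inv z ∈ U := hW hz
    refine ⟨⟨ξ.incl (ξ.inv z), hV⟩, ?_, rfl⟩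
    have h1 : (ξ.incl ∣_ V) ⟨ξ.inv z, hV⟩ = ⟨ξ.incl (ξ.inv z), hV⟩ :=
      Subtype.ext (morphismRestrict_base_coe ξ.incl V ⟨ξ.inv z, hV⟩)
    rw [← h1]
    change ((ξ.incl ∣_ V) ≫ t) ⟨ξ.inv z, hV⟩ ∈ W
    rw [ht]
    exact hz
  have hsc : ∀ W (c : k), t.app W (fnOf (X ↘ Spec (.of k)) W c) =
      scalarOf ξ.proj (V.ι ''ᵁ (t ⁻¹ᵁ W)) (algebraMap k _ c) := fun W c => by
    have e : t ≫ (X ↘ Spec (.of k)) = (V.ι ≫ ξ.proj) ≫ specDual k := by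
      rw [← H.w, Category.assoc]
    have h1 : t.app W (fnOf (X ↘ Spec (.of k)) W c) =
        fnOf ((V.ι ≫ ξ.proj) ≫ specDual k) (t ⁻¹ᵁ W) c := by
      rw [← e]
      exact app_fnOf (R := .of k) _ t W c
    have h2 := fnOf_comp_map (V.ι ≫ ξ.proj) (CommRingCat.ofHom (algebraMap k (DualNumber k)))
      (t ⁻¹ᵁ W) c
    exact (h1.trans h2).trans (fnOf_ι ξ.proj V (t ⁻¹ᵁ W) _)
  let T : ∀ W : X.Opens, Γ(X, W) →+* Γ(ξ.total, V.ι ''ᵁ (t ⁻¹ᵁ W)) := fun W => (t.app W).hom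
  have hT : ∀ W f, T W f = t.app W f := fun W f => rfl
  obtain ⟨s, -⟩ := ξ.exists_splHom_eq (U := U) (fun W hW => (res ξ.total (hle W hW)).comp (T W))
    (fun W hW f => by
      have hWU : W ≤ U.ι ''ᵁ (U.ι ⁻¹ᵁ W) := fun z hz => ⟨⟨z, hW hz⟩, hz, rfl⟩
      have hf : U.ι ⁻¹ᵁ W ≤ ((ξ.incl ∣_ V) ≫ t) ⁻¹ᵁ W := by rw [ht]
      have e1 : res X (hWU.trans (U.ι.image_mono hf)) ((ξ.incl ∣_ V).app (t ⁻¹ᵁ W) (T W f)) = f := by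
        have e2 := congrArg (res X hWU) (res_app_congr ht hf le_rfl f)
        refine ((congrArg _ (comp_app' (ξ.incl ∣_ V) t W f)).symm.trans
          (res_res (U.ι.image_mono hf) hWU _).symm).trans (e2.trans ?_)
        rw [Scheme.Opens.ι_app]
        refine (congrArg _ (res_self (X := U.toScheme) _ _ _)).trans ?_
        exact (res_res _ _ _).trans (res_self _ le_rfl f)
      rw [toX_apply, RingHom.comp_apply, ← res_app ξ.incl (hle W hW), res_res]
      refine Eq.trans ?_ e1
      rw [morphismRestrict_app_eq]
      exact (res_res _ _ _).symm)
    (fun W hW W' h' f => by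
      rw [RingHom.comp_apply, RingHom.comp_apply, res_res]
      have e1 := congrArg (res ξ.total (hle W' (h'.trans hW))) (res_app t h' f)
      refine Eq.trans ?_ e1
      exact (res_res (V.ι.image_mono (t.preimage_mono h')) (hle W' (h'.trans hW)) (T W f)).symm)
    (fun W hW c => by
      rw [RingHom.comp_apply, hT]
      exact (congrArg (res ξ.total (hle W hW)) (hsc W c)).trans (res_scalarOf _ _ _))
  exact ⟨s⟩

theorem isLocallyTrivial_of_locSplit (h : ξ.ext.LocSplit) : ξ.IsLocallyTrivial := fun x => by
  obtain ⟨U, hxU, ⟨s⟩⟩ := h x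
  refine ⟨ξ.up U, ξ.incl_mem_up.2 hxU, ?_⟩
  let V := ξ.up U
  let U' := ξ.incl ⁻¹ᵁ V
  have := ξ.flat
  have hU : ∀ P : U'.toScheme.Opens, U'.ι ''ᵁ P ≤ U := fun P =>
    (U'.ι_image_le P).trans (ξ.incl_up U).le
  have hle : ∀ (W : V.toScheme.Opens) (P : U'.toScheme.Opens), (ξ.incl ∣_ V) ⁻¹ᵁ W ≤ P →
      V.ι ''ᵁ W ≤ ξ.up (U'.ι ''ᵁ P) := fun W P h =>
    (ξ.up_incl (V.ι ''ᵁ W)).ge.trans (ξ.up_mono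
      ((image_morphismRestrict_preimage ξ.incl V W).ge.trans (U'.ι.image_mono h)))
  let φ : ∀ (W : V.toScheme.Opens) (P : U'.toScheme.Opens), (ξ.incl ∣_ V) ⁻¹ᵁ W ≤ P →
      Γ(X, U'.ι ''ᵁ P) →+* Γ(ξ.total, V.ι ''ᵁ W) :=
    fun W P h => (res ξ.total (hle W P h)).comp (splHom s (U'.ι ''ᵁ P) (hU P))
  have hφ : ∀ W P h a, φ W P h a = res ξ.total (hle W P h) (splHom s (U'.ι ''ᵁ P) (hU P) a) :=
    fun W P h a => rfl
  have hX : ∀ W P h (a : Γ(X, U'.ι ''ᵁ P)),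
      res X (image_morphismRestrict_preimage ξ.incl V W).le
        (ξ.incl.app (V.ι ''ᵁ W) (φ W P h a)) = res X (U'.ι.image_mono h) a := fun W P h a => by
    have h4 := toX_splHom s _ (hU P) a
    rw [hφ W P h, ← res_app ξ.incl (hle W P h), app_eq_toX, h4, res_res, res_res]
  obtain ⟨r, h1, h2, -⟩ := exists_retraction (ξ.isPullback_restrict V) φ
    (fun W P h a => (morphismRestrict_app_eq V W (φ W P h a)).trans (hX W P h a))
    (fun W P h W' P' h' hW hP a => by
      have h4 := res_splHom s (hU P) (U'.ι.image_mono hP) a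
      refine (congrArg (res ξ.total (V.ι.image_mono hW)) (hφ W P h a)).trans ?_
      refine Eq.trans ?_ (hφ W' P' h' (res X (U'.ι.image_mono hP) a)).symm
      rw [← h4, res_res, res_res])
    (fun W P h c => by
      have h4 := splHom_fnOf s (hU P) c
      refine (congrArg (φ W P h) (fnOf_ι (R := .of k) _ U' P c)).trans ?_
      rw [hφ W P h, h4, res_scalarOf]
      exact (fnOf_ι ξ.proj V W _).symm)
  exact ⟨r, h1, h2⟩

theorem isLocallyTrivial_iff : ξ.IsLocallyTrivial ↔ ξ.ext.LocSplit :=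
  ⟨IsLocallyTrivial.locSplit, isLocallyTrivial_of_locSplit⟩

end FirstOrderDeformation


/-! ### Kodaira–Spencer data and the classes they represent. -/

namespace FirstOrderDeformation

variable {k : Type u} [Field k] {X : Scheme.{u}} [X.Over (Spec (.of k))]
  {Λ : PoissonStructure (X ↘ Spec (.of k))} {ξ : FirstOrderDeformation Λ}

/-- An extension marked by 0 receives a morphism from the trivial extension, also marked by 0, and
this morphism carries over the global splitting with zero bivector. -/
theorem isMarked_zero_iff : ξ.ext.IsMarked 0 ↔ ξ.IsTrivial := by
  rw [isTrivial_iff]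
  constructor
  · intro h
    obtain ⟨M, s, hs⟩ := SheafExt.exists_trivial (Λ := Λ)
    obtain ⟨f⟩ := (SheafExt.isMarked_zero s hs).nonempty_hom h
    exact ⟨f.mapSpl s, by rw [f.lam_mapSpl, hs]⟩
  · rintro ⟨s, hs⟩
    exact SheafExt.isMarked_zero s hs

theorem mulEps_sub_apply {U : X.Opens} (t s : ξ.ext.Spl U) (W : X.Opens) (h : W ≤ U)
    (f : Γ(X, W)) : ξ.mulEps W ((SheafExt.Spl.sub t s).1 ⟨W, h⟩ ![f]) =
      splHom t W h f - splHom s W h f := SheafExt.Spl.e_sub t s W h f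

theorem mulEps_lam_apply {U : X.Opens} (s : ξ.ext.Spl U) (W : X.Opens) (h : W ≤ U)
    (f g : Γ(X, W)) : ξ.mulEps W (s.lam.1 ⟨W, h⟩ ![f, g]) =
      (ξ.poisson.bracket _).br (splHom s W h f) (splHom s W h g) -
        splHom s W h ((Λ.bracket W).br f g) := SheafExt.Spl.e_lam s W h f g

/-- The ring homomorphisms of a splitting, on the open subsets of the total space. -/
noncomputable def splHom' {V : ξ.total.Opens} (s : ξ.ext.Spl (ξ.incl ⁻¹ᵁ V)) (W : ξ.total.Opens)
    (h : W ≤ V) : Γ(X, ξ.incl ⁻¹ᵁ W) →+* Γ(ξ.total, W) :=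
  (res ξ.total (ξ.up_incl W).ge).comp (splHom s (ξ.incl ⁻¹ᵁ W) (ξ.incl.preimage_mono h))

theorem splHom'_apply {V : ξ.total.Opens} (s : ξ.ext.Spl (ξ.incl ⁻¹ᵁ V)) (W : ξ.total.Opens)
    (h : W ≤ V) (f : Γ(X, ξ.incl ⁻¹ᵁ W)) : splHom' s W h f = res ξ.total (ξ.up_incl W).ge
      (splHom s (ξ.incl ⁻¹ᵁ W) (ξ.incl.preimage_mono h) f) := rfl

theorem res_mulEps {V : ξ.total.Opens} (s : ξ.ext.Spl (ξ.incl ⁻¹ᵁ V)) (W : ξ.total.Opens)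
    (h : W ≤ V) (a : Γ(X, ξ.incl ⁻¹ᵁ W)) :
    res ξ.total (ξ.up_incl W).ge (ξ.mulEps _ a) = epsOf ξ.proj W * splHom' s W h a := by
  have h1 := ξ.mulEps_toX (splHom s (ξ.incl ⁻¹ᵁ W) (ξ.incl.preimage_mono h) a)
  rw [toX_splHom] at h1
  rw [h1, map_mul, res_scalarOf, splHom'_apply]

/-- The Kodaira-Spencer datum of a family of splittings. -/
noncomputable def datumOfSpl {ι : Type u} (V : ι → ξ.total.Opens) (hV : ⨆ i, V i = ⊤)
    (s : ∀ i, ξ.ext.Spl (ξ.incl ⁻¹ᵁ V i)) : ξ.KodairaSpencerDatum where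
  ι := ι
  V := V
  cover := hV
  s i := splHom' (s i)
  s_incl i W h f := by
    have h1 := toX_splHom (s i) (ξ.incl ⁻¹ᵁ W) (ξ.incl.preimage_mono h) f
    rw [splHom'_apply, ← res_app ξ.incl (ξ.up_incl W).ge, app_eq_toX, h1, res_res, res_self]
  s_res i W h W' h' f := by
    have h1 := res_splHom (s i) (ξ.incl.preimage_mono h) (ξ.incl.preimage_mono h') f
    rw [splHom'_apply, splHom'_apply, ← h1, res_res, res_res]
  s_const i W h c := by
    have h1 := splHom_fnOf (s i) (ξ.incl.preimage_mono h) c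
    refine (congrArg (res ξ.total (ξ.up_incl W).ge) h1).trans (res_scalarOf _ _ _)
  p i j := SheafExt.Spl.sub ((s j).restrict (ξ.incl.preimage_mono inf_le_right))
    ((s i).restrict (ξ.incl.preimage_mono inf_le_left))
  Λ' i := (s i).lam
  s_sub i j W hi hj f := by
    have h1 := congrArg (res ξ.total (ξ.up_incl W).ge) (mulEps_sub_apply
      ((s j).restrict (ξ.incl.preimage_mono (inf_le_right : V i ⊓ V j ≤ _)))
      ((s i).restrict (ξ.incl.preimage_mono inf_le_left)) (ξ.incl ⁻¹ᵁ W)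
      (ξ.incl.preimage_mono (le_inf hi hj)) f)
    rw [res_mulEps (s i) W hi, map_sub] at h1
    exact sub_eq_iff_eq_add'.1 h1.symm
  s_br i W h f g := by
    have h1 := congrArg (res ξ.total (ξ.up_incl W).ge) (mulEps_lam_apply (s i) (ξ.incl ⁻¹ᵁ W)
      (ξ.incl.preimage_mono h) f g)
    rw [res_mulEps (s i) W h, map_sub, ξ.poisson.res_br] at h1
    exact sub_eq_iff_eq_add'.1 h1.symm

theorem nonempty_datum (h : ξ.ext.LocSplit) : Nonempty ξ.KodairaSpencerDatum := by
  choose U hx s using h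
  refine ⟨datumOfSpl (fun x => ξ.up (U x)) ?_ fun x => (s x).some.restrict (ξ.incl_up _).le⟩
  refine eq_top_iff.2 fun z _ => Opens.mem_iSup.2 ⟨ξ.inv z, ?_⟩
  rw [← ξ.incl_inv z, incl_mem_up, inv_incl]
  exact hx _

namespace KodairaSpencerDatum

variable (D : ξ.KodairaSpencerDatum)

theorem up_le (i : D.ι) {W : X.Opens} (h : W ≤ ξ.incl ⁻¹ᵁ D.V i) : ξ.up W ≤ D.V i :=
  (ξ.up_mono h).trans (ξ.up_incl _).le

/-- The datum is indexed by opens of the total space and splittings by opens of `X`; the two are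
matched through `up`. -/
theorem exists_spl (i : D.ι) : ∃ s : ξ.ext.Spl (ξ.incl ⁻¹ᵁ D.V i), ∀ W h f,
    splHom s W h f = D.s i (ξ.up W) (D.up_le i h) (res X (ξ.incl_up W).le f) := by
  obtain ⟨s, hs⟩ := ξ.exists_splHom_eq (U := ξ.incl ⁻¹ᵁ D.V i)
    (fun W h => (D.s i (ξ.up W) (D.up_le i h)).comp (res X (ξ.incl_up W).le))
    (fun W h f => by
      rw [toX_apply, RingHom.comp_apply, D.s_incl, res_res, res_self])
    (fun W h W' h' f => by
      rw [RingHom.comp_apply, RingHom.comp_apply, D.s_res, res_res, res_res])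
    (fun W h c => by
      rw [RingHom.comp_apply]
      refine Eq.trans (congrArg _ ?_) (D.s_const i (ξ.up W) (D.up_le i h) c)
      exact res_fnOf (R := .of k) _ _ _)
  exact ⟨s, hs⟩

/-- The splittings of a Kodaira-Spencer datum. -/
noncomputable def spl (i : D.ι) : ξ.ext.Spl (ξ.incl ⁻¹ᵁ D.V i) := (D.exists_spl i).choose

theorem splHom_spl (i : D.ι) (W : X.Opens) (h : W ≤ ξ.incl ⁻¹ᵁ D.V i) (f : Γ(X, W)) :
    splHom (D.spl i) W h f = D.s i (ξ.up W) (D.up_le i h) (res X (ξ.incl_up W).le f) :=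
  (D.exists_spl i).choose_spec W h f

theorem mulEps_eq (i : D.ι) (W : X.Opens) (h : W ≤ ξ.incl ⁻¹ᵁ D.V i) (a : Γ(X, W)) :
    ξ.mulEps W a = epsOf ξ.proj _ * D.s i (ξ.up W) (D.up_le i h) (res X (ξ.incl_up W).le a) := by
  rw [← D.splHom_spl i W h, ← mulEps_toX, toX_splHom]

/-- Multiplication by `ε` is injective on `𝒪_X`, so `s_sub` determines `p`. In `lam_spl`, `s_br`
determines `Λ'` in the same way: a datum carries no more than its splittings. -/
theorem sub_spl (i j : D.ι) : SheafExt.Spl.sub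
    ((D.spl j).restrict (ξ.incl.preimage_mono (inf_le_right : D.V i ⊓ D.V j ≤ _)))
    ((D.spl i).restrict (ξ.incl.preimage_mono inf_le_left)) = D.p i j := by
  refine SheafExt.Spl.sub_unique fun W hW f => ?_
  have hi : ξ.up W ≤ D.V i := D.up_le i (hW.trans (ξ.incl.preimage_mono inf_le_left))
  have hj : ξ.up W ≤ D.V j := D.up_le j (hW.trans (ξ.incl.preimage_mono inf_le_right))
  have h1 := D.s_sub i j (ξ.up W) hi hj (res X (ξ.incl_up W).le f)
  have h2 := polyDer_res_one (D.p i j) hW (ξ.incl_up W).le f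
  have h3 := D.mulEps_eq i W (hW.trans (ξ.incl.preimage_mono inf_le_left))
    ((D.p i j).1 ⟨W, hW⟩ ![f])
  rw [h2] at h3
  have h4 := D.splHom_spl i W (hW.trans (ξ.incl.preimage_mono inf_le_left)) f
  have h5 := D.splHom_spl j W (hW.trans (ξ.incl.preimage_mono inf_le_right)) f
  refine h3.trans (Eq.trans ?_ (congrArg₂ (· - ·) h5 h4).symm)
  exact (sub_eq_iff_eq_add'.2 h1).symm

theorem lam_spl (i : D.ι) : (D.spl i).lam = D.Λ' i := by
  refine SheafExt.Spl.lam_unique fun W hW f g => ?_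
  have h1 := D.s_br i (ξ.up W) (D.up_le i hW) (res X (ξ.incl_up W).le f)
    (res X (ξ.incl_up W).le g)
  have h2 := polyDer_res_two (D.Λ' i) hW (ξ.incl_up W).le f g
  have h3 := D.mulEps_eq i W hW ((D.Λ' i).1 ⟨W, hW⟩ ![f, g])
  rw [h2] at h3
  have h4 := D.splHom_spl i W hW f
  have h5 := D.splHom_spl i W hW g
  have h6 := D.splHom_spl i W hW ((Λ.bracket W).br f g)
  rw [Λ.res_br _ _ (ξ.incl_up W).le] at h6
  refine h3.trans (Eq.trans (sub_eq_iff_eq_add'.2 h1).symm ?_)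
  rw [← h4, ← h5, ← h6]
  rfl

/-- The function `B` of a marking is defined on all splittings, so evaluating it on those of `D`
yields the cochain `b`, whatever the datum. -/
theorem represents {c : HP k Λ 2} (h : ξ.ext.IsMarked c) : D.Represents c := by
  obtain ⟨z, B, hz, hB1, hB2, hB3⟩ := h.exists_function
  refine ⟨z, fun i => B _ (D.spl i), hz, fun i j => ?_, fun i => ?_⟩
  · have h1 := congrArg₂ (· - ·) (hB1 _ (ξ.incl ⁻¹ᵁ (D.V i ⊓ D.V j))
      (ξ.incl.preimage_mono inf_le_right) (D.spl j)) (hB1 _ (ξ.incl ⁻¹ᵁ (D.V i ⊓ D.V j))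
      (ξ.incl.preimage_mono inf_le_left) (D.spl i))
    refine h1.trans ((hB2 _ _ _).trans ?_)
    rw [sub_spl]
    rfl
  · have h1 := hB3 _ (D.spl i)
    rw [lam_spl] at h1
    exact h1

end KodairaSpencerDatum

end FirstOrderDeformation


/-! ### The scheme of a locally split extension: local rings and charts. -/

namespace SheafExt

variable {k : Type u} [Field k] {X : Scheme.{u}} [X.Over (Spec (.of k))]
  {Λ : PoissonStructure (X ↘ Spec (.of k))} {M : SheafExt Λ}

/-- The morphism to the structure sheaf. -/
noncomputable def piHom (M : SheafExt Λ) : M.F ⟶ X.presheaf where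
  app U := CommRingCat.ofHom (M.π U.unop)
  naturality U V f := CommRingCat.hom_ext (RingHom.ext fun a =>
    M.π_res U.unop V.unop f.unop.le a)

/-- The morphism to the structure sheaf on stalks. -/
noncomputable def piStalk (M : SheafExt Λ) (x : X) : M.F.stalk x →+* X.presheaf.stalk x :=
  ((TopCat.Presheaf.stalkFunctor CommRingCat x).map M.piHom).hom

theorem piStalk_germ (U : X.Opens) {x : X} (hx : x ∈ U) (a : M.sec U) :
    M.piStalk x (M.F.germ U x hx a) = X.presheaf.germ U x hx (M.π U a) :=
  TopCat.Presheaf.stalkFunctor_map_germ_apply U x hx M.piHom a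

/-- Near `x`, lift an inverse of `π a` by a local splitting. The product with `a` is `1 + e d`,
whose inverse is `1 - e d` because the kernel has square zero. -/
theorem isUnit_germ_iff (hM : M.LocSplit) (U : X.Opens) {x : X} (hx : x ∈ U) (a : M.sec U) :
    IsUnit (M.F.germ U x hx a) ↔ IsUnit (X.presheaf.germ U x hx (M.π U a)) := by
  constructor
  · intro h
    rw [← piStalk_germ]
    exact h.map _
  · intro h
    obtain ⟨V, hxV, ⟨s⟩⟩ := hM x
    have hxD : x ∈ X.basicOpen (M.π U a) := (X.mem_basicOpen _ x hx).2 h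
    have hDU : X.basicOpen (M.π U a) ≤ U := X.basicOpen_le _
    have hWU : V ⊓ X.basicOpen (M.π U a) ≤ U := inf_le_right.trans hDU
    have h1 : IsUnit (res X hWU (M.π U a)) := by
      have : IsUnit (res X hDU (M.π U a)) := RingedSpace.isUnit_res_basicOpen _ _
      rw [← res_res hDU inf_le_right]
      exact this.map _
    obtain ⟨b, hb⟩ := h1.exists_right_inv
    rw [← M.π_res U _ hWU] at hb
    have h2 : M.π _ (M.rs hWU a * s.s _ inf_le_left b - 1) = 0 := by
      rw [map_sub, map_mul, s.π_s, hb, map_one, sub_self]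
    obtain ⟨d, hd⟩ := M.exact _ _ h2
    have h3 : M.rs hWU a * (s.s _ inf_le_left b * (1 - M.e _ d)) = 1 := by
      have := M.e_mul_e _ d d
      linear_combination (1 - M.e _ d) * hd.symm - this
    have h4 := (IsUnit.of_mul_eq_one _ h3).map
      (M.F.germ (V ⊓ X.basicOpen (M.π U a)) x ⟨hxV, hxD⟩).hom
    have h5 := M.F.germ_res_apply (homOfLE hWU) x ⟨hxV, hxD⟩ a
    exact h5 ▸ h4

theorem isLocalRing_stalk (hM : M.LocSplit) (x : X) : IsLocalRing (M.F.stalk x) := by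
  have : IsLocalHom (M.piStalk x) := ⟨fun s hs => by
    obtain ⟨U, hU, a, rfl⟩ := M.F.exists_germ_eq s
    rw [piStalk_germ] at hs
    exact (isUnit_germ_iff hM U hU a).2 hs⟩
  exact (M.piStalk x).domain_isLocalRing

/-- The locally ringed space of a locally split extension. -/
noncomputable def lrs (M : SheafExt Λ) (hM : M.LocSplit) : LocallyRingedSpace.{u} where
  carrier := X.carrier
  presheaf := M.F
  IsSheaf := M.isSheaf
  isLocalRing := isLocalRing_stalk hM

section Chart

variable {U : X.Opens} (s : M.Spl U) {Y : Scheme.{u}} {f : Y ⟶ Spec (.of (DualNumber k))}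
  (t : Y ⟶ X)

variable (f) in
/-- Sections over open subsets of `U` as functions on a chart. -/
noncomputable def chartFun' (W : X.Opens) (hW : W ≤ U) : M.sec W →+* Γ(Y, t ⁻¹ᵁ W) where
  toFun a := t.app W (M.π W a) + epsOf f _ * t.app W (s.coord W hW a)
  map_one' := by rw [s.coord_one, map_one, map_one, map_zero, mul_zero, add_zero]
  map_zero' := by rw [s.coord_zero, map_zero, map_zero, mul_zero, add_zero]
  map_add' a b := by rw [s.coord_add, map_add, map_add, map_add]; ring
  map_mul' a b := by
    rw [s.coord_mul, map_mul, map_mul, map_add, map_mul, map_mul]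
    have := epsOf_mul_epsOf f (t ⁻¹ᵁ W)
    linear_combination -(t.app W (s.coord W hW a) * t.app W (s.coord W hW b)) * this

theorem chartFun'_apply (W : X.Opens) (hW : W ≤ U) (a : M.sec W) : chartFun' s f t W hW a =
    t.app W (M.π W a) + epsOf f _ * t.app W (s.coord W hW a) := rfl

theorem res_chartFun' {W : X.Opens} (hW : W ≤ U) {W' : X.Opens} (h : W' ≤ W) (a : M.sec W) :
    res Y (t.preimage_mono h) (chartFun' s f t W hW a) =
      chartFun' s f t W' (h.trans hW) (M.rs h a) := by
  have h1 := M.π_res W W' h a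
  have h2 := s.coord_res hW h a
  rw [chartFun'_apply, chartFun'_apply, map_add, map_mul, res_app, res_app, res_scalarOf, h1, h2]

theorem preimage_le_inf {t : Y ⟶ X} (ht : ∀ y, t y ∈ U) (W : X.Opens) :
    t ⁻¹ᵁ W ≤ t ⁻¹ᵁ (W ⊓ U) := fun y hy => ⟨hy, ht y⟩

variable (f) in
/-- Sections as functions on a chart. -/
noncomputable def chartFun {t : Y ⟶ X} (ht : ∀ y, t y ∈ U) (W : X.Opens) :
    M.sec W →+* Γ(Y, t ⁻¹ᵁ W) :=
  -- The splitting exists only over `U`; as `t` lands in `U`, nothing is lost by passing to `W ⊓ U`.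
  (res Y (preimage_le_inf ht W)).comp ((chartFun' s f t (W ⊓ U) inf_le_right).comp
    (M.rs inf_le_left))

theorem chartFun_apply {t : Y ⟶ X} (ht : ∀ y, t y ∈ U) (W : X.Opens) (a : M.sec W) :
    chartFun s f ht W a = res Y (preimage_le_inf ht W)
      (chartFun' s f t (W ⊓ U) inf_le_right (M.rs inf_le_left a)) := rfl

theorem chartFun_of_le {t : Y ⟶ X} (ht : ∀ y, t y ∈ U) {W : X.Opens} (hW : W ≤ U) (a : M.sec W) :
    chartFun s f ht W a = chartFun' s f t W hW a := by
  rw [chartFun_apply, ← res_chartFun' s t hW inf_le_left, res_res, res_self]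

theorem res_chartFun {t : Y ⟶ X} (ht : ∀ y, t y ∈ U) {W W' : X.Opens} (h : W' ≤ W)
    (a : M.sec W) : res Y (t.preimage_mono h) (chartFun s f ht W a) =
      chartFun s f ht W' (M.rs h a) := by
  have h1 := res_chartFun' (f := f) s t (inf_le_right : W ⊓ U ≤ U)
    (le_inf (inf_le_left.trans h) inf_le_right : W' ⊓ U ≤ W ⊓ U) (M.rs inf_le_left a)
  have h2 := M.rs_rs (inf_le_left : W ⊓ U ≤ W)
    (le_inf (inf_le_left.trans h) inf_le_right : W' ⊓ U ≤ W ⊓ U) a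
  have h3 := M.rs_rs h (inf_le_left : W' ⊓ U ≤ W') a
  rw [chartFun_apply, chartFun_apply, h3, ← h2, ← h1, res_res, res_res]

theorem exists_chartFun_eq {t : Y ⟶ X} (ht : ∀ y, t y ∈ U) (W : X.Opens) (a : M.sec W) :
    ∃ n, chartFun s f ht W a = t.app W (M.π W a) + n ∧ n * n = 0 := by
  refine ⟨res Y (preimage_le_inf ht W) (epsOf f _ * t.app _
    (s.coord _ inf_le_right (M.rs inf_le_left a))), ?_, ?_⟩
  · have h1 := M.π_res W (W ⊓ U) inf_le_left a
    rw [chartFun_apply, chartFun'_apply, map_add, h1, ← res_app t inf_le_left, res_res, res_self]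
  · rw [← map_mul, mul_mul_mul_comm, epsOf_mul_epsOf, zero_mul, map_zero]

theorem isUnit_add_of_sq {R : Type*} [CommRing R] {a n : R} (hn : n * n = 0)
    (h : IsUnit (a + n)) : IsUnit a := by
  obtain ⟨b, hb⟩ := h.exists_right_inv
  -- From `(a + n) * b = 1` follows `a * b = 1 - n * b`, whose inverse is `1 + n * b`.
  refine IsUnit.of_mul_eq_one (b * (1 + n * b)) ?_
  linear_combination (1 + n * b) * hb - b * b * hn

theorem isUnit_germ_of_chartFun {t : Y ⟶ X} (ht : ∀ y, t y ∈ U) (W : X.Opens) (a : M.sec W)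
    (y : Y) (hy : t y ∈ W) (h : IsUnit (Y.presheaf.germ (t ⁻¹ᵁ W) y hy (chartFun s f ht W a))) :
    IsUnit (X.presheaf.germ W (t y) hy (M.π W a)) := by
  obtain ⟨n, hn, hn'⟩ := exists_chartFun_eq (f := f) s ht W a
  rw [hn, map_add] at h
  have h2 := isUnit_add_of_sq (by rw [← map_mul, hn', map_zero]) h
  have h3 : y ∈ Y.basicOpen (t.app W (M.π W a)) := (Y.mem_basicOpen _ y hy).2 h2
  rw [← Scheme.preimage_basicOpen] at h3
  exact (X.mem_basicOpen _ (t y) hy).1 h3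

/-- The morphism of locally ringed spaces given by a splitting. -/
noncomputable def chart (hM : M.LocSplit) (f : Y ⟶ Spec (.of (DualNumber k))) {t : Y ⟶ X}
    (ht : ∀ y, t y ∈ U) : Y.toLocallyRingedSpace ⟶ M.lrs hM :=
  mkLRSHom (Z := Y.toLocallyRingedSpace) (Y := M.lrs hM) t.base (fun W => chartFun s f ht W)
    (fun _ _ h a => res_chartFun s ht h a) (fun W a y hy h =>
      (isUnit_germ_iff hM W hy a).2 (isUnit_germ_of_chartFun s ht W a y hy h))

variable {g : U.toScheme ⟶ Spec (.of k)} {i : U.toScheme ⟶ Y}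

theorem bijective_app (hi : i ≫ t = U.ι) {W : X.Opens} (hW : W ≤ U) :
    Function.Bijective fun a => i.app (t ⁻¹ᵁ W) (t.app W a) := by
  have h1 : ∀ j : U.toScheme ⟶ X, j = U.ι → Function.Bijective (j.app W) := by
    rintro _ rfl
    have := U.ι.isIso_app W (by simpa using hW)
    exact ConcreteCategory.bijective_of_isIso (U.ι.app W)
  have h2 : (fun a => i.app (t ⁻¹ᵁ W) (t.app W a)) = (i ≫ t).app W := by
    ext a
    exact (comp_app' i t W a).symm
  rw [h2]
  exact h1 _ hi

/-- The map compares two extensions of `𝒪_X` by itself over `W`: sections of `M`, and functions on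
the thickening `Y`. It is the identity on sub and quotient, so the five lemma applies. -/
theorem bijective_chartFun' (H : IsPullback i g f (specFst k)) [Flat f] (hi : i ≫ t = U.ι)
    {W : X.Opens} (hW : W ≤ U) : Function.Bijective (chartFun' s f t W hW) := by
  have hb := bijective_app t hi hW
  constructor
  · refine (injective_iff_map_eq_zero _).2 fun a ha => ?_
    rw [chartFun'_apply] at ha
    have h1 : M.π W a = 0 := by
      refine hb.1 ?_
      have := congrArg (i.app (t ⁻¹ᵁ W)) ha
      rw [map_add, map_mul, app_epsOf H.toCommSq, zero_mul, add_zero] at this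
      simpa using this
    rw [h1, map_zero, zero_add] at ha
    have h2 := isEpsMul_mul H (t.app W (s.coord W hW a))
    rw [ha] at h2
    have h3 : s.coord W hW a = 0 := by
      refine hb.1 ?_
      simpa using h2.eq_zero H
    rw [s.eq_add_coord hW a, h1, h3, map_zero, map_zero, add_zero]
  · intro F
    obtain ⟨a, ha⟩ := hb.2 (i.app _ F)
    obtain ⟨b, hb'⟩ := exists_isEpsMul_of_app_eq_zero H (F - t.app W a) (by
      rw [map_sub]
      exact sub_eq_zero.2 ha.symm)
    obtain ⟨c, hc⟩ := hb.2 b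
    refine ⟨s.s W hW a + M.e W c, ?_⟩
    have h1 := isEpsMul_mul H (t.app W c)
    have h2 : i.app (t ⁻¹ᵁ W) (t.app W c) = b := hc
    rw [h2] at h1
    rw [chartFun'_apply, s.coord_add, s.coord_s, s.coord_e, zero_add, map_add, s.π_s, M.π_e,
      add_zero, ← hb'.unique H h1]
    ring

theorem isOpenImmersion_chart (hM : M.LocSplit) {t : Y ⟶ X} (ht : ∀ y, t y ∈ U)
    (H : IsPullback i g f (specFst k)) [Flat f] (hi : i ≫ t = U.ι) :
    LocallyRingedSpace.IsOpenImmersion (chart s hM f ht) := by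
  have h1 : Topology.IsOpenEmbedding t := by
    have hh := isHomeomorph_of_isPullback H
    have e : (t : Y → X) = U.ι ∘ (hh.homeomorph i).symm := by
      ext y
      obtain ⟨x, rfl⟩ := hh.surjective y
      have h2 : (hh.homeomorph i).symm (i x) = x := (hh.homeomorph i).symm_apply_apply x
      rw [Function.comp_apply, h2, ← hi]
      rfl
    rw [e]
    exact U.ι.isOpenEmbedding.comp (hh.homeomorph i).symm.isOpenEmbedding
  refine ⟨h1, fun O => (ConcreteCategory.isIso_iff_bijective _).2 ?_⟩
  have hO : h1.functor.obj O ≤ U := by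
    rintro _ ⟨y, -, rfl⟩
    exact ht y
  have h2 := bijective_chartFun' s t H hi hO
  have h3 : ⇑(chartFun s f ht (h1.functor.obj O)) = chartFun' s f t _ hO :=
    funext fun a => chartFun_of_le s ht hO a
  rw [← h3] at h2
  exact h2

end Chart

end SheafExt


/-! ### The scheme of a locally split extension: structure over `k[ε]` and inclusion of `X`. -/

namespace SheafExt

variable {k : Type u} [Field k] {X : Scheme.{u}} [X.Over (Spec (.of k))]
  {Λ : PoissonStructure (X ↘ Spec (.of k))} {M : SheafExt Λ}

/-- The chart is the trivial thickening of an open set over which the extension splits. -/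
theorem exists_chart (hM : M.LocSplit) (x : X) : ∃ (U : X.Opens) (_ : M.Spl U) (Y : Scheme.{u})
    (f : Y ⟶ Spec (.of (DualNumber k))) (t : Y ⟶ X) (i : U.toScheme ⟶ Y), x ∈ U ∧
      (∀ y, t y ∈ U) ∧ IsPullback i (U.ι ≫ X ↘ Spec (.of k)) f (specFst k) ∧ Flat f ∧
      i ≫ t = U.ι ∧ t ≫ (X ↘ Spec (.of k)) = f ≫ specDual k := by
  obtain ⟨U, hx, ⟨s⟩⟩ := hM x
  obtain ⟨i, hi, H⟩ := isPullback_trivial (U.ι ≫ X ↘ Spec (.of k))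
  have := flat_of_field (U.ι ≫ X ↘ Spec (.of k))
  refine ⟨U, s, _, Limits.pullback.snd _ _, Limits.pullback.fst _ _ ≫ U.ι, i, hx, fun y => ?_, H,
    inferInstance, by rw [← Category.assoc, hi, Category.id_comp], ?_⟩
  · exact (Limits.pullback.fst (U.ι ≫ X ↘ Spec (.of k)) (specDual k) y).2
  · rw [Category.assoc]
    exact Limits.pullback.condition

theorem exists_affine_chart (hM : M.LocSplit) (x : X) : ∃ (R : CommRingCat.{u})
    (c : Spec.toLocallyRingedSpace.obj (op R) ⟶ M.lrs hM),
      (x ∈ Set.range c.base :) ∧ LocallyRingedSpace.IsOpenImmersion c := by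
  obtain ⟨U, s, Y, f, t, i, hx, ht, H, hf, hi, -⟩ := exists_chart hM x
  have h1 := isOpenImmersion_chart s hM ht H hi
  obtain ⟨V, hV, -, hxV⟩ := exists_affine_le (U := (⊤ : Y.Opens)) (p := i ⟨x, hx⟩) trivial
  have h2 : LocallyRingedSpace.IsOpenImmersion hV.fromSpec.toLRSHom :=
    inferInstanceAs (IsOpenImmersion hV.fromSpec)
  refine ⟨Γ(Y, V), hV.fromSpec.toLRSHom ≫ chart s hM f ht, ?_,
    LocallyRingedSpace.IsOpenImmersion.comp hV.fromSpec.toLRSHom (chart s hM f ht)⟩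
  have h3 : i ⟨x, hx⟩ ∈ Set.range hV.fromSpec := by rwa [hV.range_fromSpec]
  obtain ⟨p, hp⟩ := h3
  refine ⟨p, ?_⟩
  change t (hV.fromSpec p) = x
  rw [hp]
  change (i ≫ t) ⟨x, hx⟩ = x
  rw [hi]
  rfl

/-- The scheme of a locally split extension. -/
noncomputable def scheme (M : SheafExt Λ) (hM : M.LocSplit) : Scheme.{u} :=
  LocallyRingedSpace.IsOpenImmersion.scheme (M.lrs hM) (exists_affine_chart hM)

/-- The inclusion of `X`. -/
noncomputable def schemeIncl (hM : M.LocSplit) : X ⟶ M.scheme hM :=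
  -- The space of the new scheme is that of `X`, so the inclusion is the identity on points.
  ⟨mkLRSHom (Z := X.toLocallyRingedSpace) (Y := M.lrs hM) (𝟙 X.carrier) (fun W => M.π W)
    (fun W W' h a => (M.π_res W W' h a).symm)
    (fun W a _ hx h => (isUnit_germ_iff hM W hx a).2 h)⟩

theorem schemeIncl_app (hM : M.LocSplit) (W : X.Opens) (a : M.sec W) :
    (schemeIncl hM).app W a = M.π W a := rfl

variable (M) in
/-- The `k[ε]`-algebra structure. -/
noncomputable def dualConst (W : X.Opens) : DualNumber k →+* M.sec W where
  toFun c := M.const W c.fst + M.e W (algebraMap k _ c.snd)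
  map_one' := by simp
  map_zero' := by simp
  map_add' a b := by simp; ring
  map_mul' a b := by
    have h1 := M.mul_e W (M.const W a.fst) (algebraMap k _ b.snd)
    have h2 := M.mul_e W (M.const W b.fst) (algebraMap k _ a.snd)
    rw [M.π_const, ← map_mul] at h1 h2
    have h3 := M.e_mul_e W (algebraMap k _ a.snd) (algebraMap k _ b.snd)
    rw [TrivSqZeroExt.fst_mul, DualNumber.snd_mul, mul_comm a.snd, map_add, map_add, ← h1, ← h2,
      map_mul]
    linear_combination -h3

theorem dualConst_apply (W : X.Opens) (c : DualNumber k) :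
    M.dualConst W c = M.const W c.fst + M.e W (algebraMap k _ c.snd) := rfl

theorem rs_dualConst {W W' : X.Opens} (h : W' ≤ W) (c : DualNumber k) :
    M.rs h (M.dualConst W c) = M.dualConst W' c := by
  rw [dualConst_apply, dualConst_apply, map_add, M.const_res W W' h, M.e_res W W' h,
    res_algebraMap]

theorem dualConst_eps (W : X.Opens) : M.dualConst W DualNumber.eps = M.e W 1 := by
  simp [dualConst_apply]

theorem dualConst_algebraMap (W : X.Opens) (c : k) :
    M.dualConst W (algebraMap k _ c) = M.const W c := by
  simp [dualConst_apply, TrivSqZeroExt.algebraMap_eq_inl]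

/-- The structure morphism to `Spec k[ε]`. -/
noncomputable def schemeProj (hM : M.LocSplit) :
    M.scheme hM ⟶ Spec (.of (DualNumber k)) :=
  (M.scheme hM).toSpecΓ ≫ Spec.map (CommRingCat.ofHom (M.dualConst ⊤))

theorem fnOf_toSpecΓ (Z : Scheme.{u}) (W : Z.Opens) (a : Γ(Z, ⊤)) :
    fnOf Z.toSpecΓ W a = res Z le_top a := by
  have h1 : fnOf Z.toSpecΓ ⊤ a = a := by
    have e : Z.toSpecΓ.appLE ⊤ ⊤ le_top = Z.toSpecΓ.appTop := Z.toSpecΓ.app_eq_appLE.symm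
    rw [fnOf, e, Scheme.toSpecΓ_appTop]
    exact congrArg (fun f => f.hom a) (Scheme.ΓSpecIso Γ(Z, ⊤)).inv_hom_id
  rw [← res_fnOf Z.toSpecΓ (le_top : W ≤ ⊤), h1]

theorem fnOf_schemeProj (hM : M.LocSplit) (W : X.Opens) (c : DualNumber k) :
    fnOf (schemeProj hM) W c = M.dualConst W c := by
  have h1 := fnOf_comp_map (M.scheme hM).toSpecΓ (CommRingCat.ofHom (M.dualConst ⊤)) W c
  refine h1.trans ((fnOf_toSpecΓ (M.scheme hM) W (M.dualConst ⊤ c)).trans ?_)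
  exact rs_dualConst le_top c

/-- A chart, as a morphism of schemes. -/
noncomputable def chartHom (hM : M.LocSplit) {U : X.Opens} (s : M.Spl U) {Y : Scheme.{u}}
    (f : Y ⟶ Spec (.of (DualNumber k))) {t : Y ⟶ X} (ht : ∀ y, t y ∈ U) : Y ⟶ M.scheme hM :=
  ⟨chart s hM f ht⟩

theorem chartFun_dualConst {U : X.Opens} (s : M.Spl U) {Y : Scheme.{u}}
    {f : Y ⟶ Spec (.of (DualNumber k))} {t : Y ⟶ X} (ht : ∀ y, t y ∈ U)
    (h : t ≫ (X ↘ Spec (.of k)) = f ≫ specDual k) (W : X.Opens) (c : DualNumber k) :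
    chartFun s f ht W (M.dualConst W c) = scalarOf f (t ⁻¹ᵁ W) c := by
  have h1 : ∀ (V : X.Opens) (c : k), t.app V (algebraMap k Γ(X, V) c) =
      scalarOf f (t ⁻¹ᵁ V) (algebraMap k _ c) := fun V c => by
    have h2 : t.app V (fnOf (X ↘ Spec (.of k)) V c) = fnOf (f ≫ specDual k) (t ⁻¹ᵁ V) c := by
      rw [← h]
      exact app_fnOf (R := .of k) _ t V c
    exact h2.trans (fnOf_comp_map f (CommRingCat.ofHom (algebraMap k (DualNumber k))) _ c)
  have h3 : M.π (W ⊓ U) (M.dualConst (W ⊓ U) c) = algebraMap k _ c.fst := by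
    rw [dualConst_apply, map_add, M.π_const, M.π_e, add_zero]
  have h4 : s.coord (W ⊓ U) inf_le_right (M.dualConst (W ⊓ U) c) = algebraMap k _ c.snd := by
    rw [dualConst_apply, s.coord_add, ← s.s_const _ inf_le_right, s.coord_s, s.coord_e, zero_add]
  rw [chartFun_apply, rs_dualConst, chartFun'_apply, h3, h4, h1, h1, ← scalarOf_eq, res_scalarOf]

/-- Wherever there is a splitting, an element of the kernel is a multiple of `e 1`, the image of
`ε`. So the ideal of `X` is locally generated by `ε`. -/
theorem rs_e_eq_mul {U : X.Opens} (s : M.Spl U) {V W : X.Opens} (h : V ≤ W) (h' : V ≤ U)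
    (d : Γ(X, W)) : M.rs h (M.e W d) = s.s V h' (res X h d) * M.e V 1 := by
  rw [M.mul_e, s.π_s, mul_one, M.e_res W V h]

theorem chartHom_schemeProj (hM : M.LocSplit) {U : X.Opens} (s : M.Spl U) {Y : Scheme.{u}}
    {f : Y ⟶ Spec (.of (DualNumber k))} {t : Y ⟶ X} (ht : ∀ y, t y ∈ U)
    (h : t ≫ (X ↘ Spec (.of k)) = f ≫ specDual k) :
    chartHom hM s f ht ≫ schemeProj hM = f := fnOf_ext fun c => by
  have h1 := app_fnOf (schemeProj hM) (chartHom hM s f ht) ⊤ c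
  refine h1.symm.trans ((congrArg _ (fnOf_schemeProj hM ⊤ c)).trans ?_)
  exact chartFun_dualConst s ht h ⊤ c

theorem flat_schemeProj (hM : M.LocSplit) : Flat (schemeProj hM) := by
  choose U s Y f t i hx ht H hf hi h using exists_chart hM
  have h1 : ∀ x, IsOpenImmersion (chartHom hM (s x) (f x) (ht x)) := fun x =>
    have := hf x
    isOpenImmersion_chart (s x) hM (ht x) (H x) (hi x)
  have hpt : ∀ x : X, t x (i x ⟨x, hx x⟩) = x := fun x => by
    change (i x ≫ t x) ⟨x, hx x⟩ = x
    rw [hi]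
    rfl
  have := HasRingHomProperty.instIsZariskiLocalAtSource (P := @Flat.{u})
  refine IsZariskiLocalAtSource.of_iSup_eq_top (P := @Flat)
    (fun x : X => (chartHom hM (s x) (f x) (ht x)).opensRange) ?_ fun x => ?_
  · refine eq_top_iff.2 fun x _ => Opens.mem_iSup.2 ⟨(x : X), i x ⟨x, hx x⟩, ?_⟩
    exact hpt x
  · have h2 := IsOpenImmersion.isoOfRangeEq_hom_fac
      (chartHom hM (s x) (f x) (ht x)).opensRange.ι (chartHom hM (s x) (f x) (ht x)) (by simp)
    rw [← h2, Category.assoc, chartHom_schemeProj hM (s x) (ht x) (h x)]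
    have := hf x
    infer_instance

theorem isClosedImmersion_schemeIncl (hM : M.LocSplit) : IsClosedImmersion (schemeIncl hM) where
  isClosedEmbedding := Topology.IsClosedEmbedding.id
  stalkMap_surjective x b := by
    obtain ⟨W, hW, b, rfl⟩ := X.presheaf.exists_germ_eq b
    obtain ⟨U, hxU, ⟨s⟩⟩ := hM x
    refine ⟨(M.scheme hM).presheaf.germ (W ⊓ U) x ⟨hW, hxU⟩
      (s.s _ inf_le_right (res X inf_le_left b)), ?_⟩
    refine (Scheme.Hom.germ_stalkMap_apply (schemeIncl hM) (W ⊓ U) x ⟨hW, hxU⟩ _).trans ?_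
    refine (congrArg _ (s.π_s _ inf_le_right _)).trans ?_
    exact X.presheaf.germ_res_apply (homOfLE inf_le_left) x ⟨hW, hxU⟩ b

/-- A morphism whose composite to `Spec k[ε]` factors through `Spec k` kills `ε`, hence the ideal of
`X`, which is locally generated by `ε`; so it factors through the closed immersion of `X`. -/
theorem isPullback_schemeIncl (hM : M.LocSplit) :
    IsPullback (schemeIncl hM) (X ↘ Spec (.of k)) (schemeProj hM) (specFst k) := by
  have hw : schemeIncl hM ≫ schemeProj hM = (X ↘ Spec (.of k)) ≫ specFst k := fnOf_ext fun c => by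
    have h1 := app_fnOf (schemeProj hM) (schemeIncl hM) ⊤ c
    refine h1.symm.trans ((congrArg _ (fnOf_schemeProj hM ⊤ c)).trans ?_)
    refine Eq.trans ?_ (fnOf_comp_map (X ↘ Spec (.of k))
      (CommRingCat.ofHom (TrivSqZeroExt.fstHom k k k).toRingHom) ⊤ c).symm
    refine (schemeIncl_app hM ⊤ (M.dualConst ⊤ c)).trans ?_
    rw [dualConst_apply, map_add, M.π_const, M.π_e, add_zero]
    rfl
  have := isClosedImmersion_schemeIncl hM
  have hker : ∀ {Z : Scheme.{u}} (a : Z ⟶ M.scheme hM) (b : Z ⟶ Spec (.of k)),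
      a ≫ schemeProj hM = b ≫ specFst k → (schemeIncl hM).ker ≤ a.ker := by
    intro Z a b hab
    have heps : ∀ W, a.app W (M.e W 1) = 0 := fun W => by
      have h1 := app_fnOf (schemeProj hM) a W DualNumber.eps
      rw [hab] at h1
      have h2 := (congrArg (a.app W)
        ((fnOf_schemeProj hM W DualNumber.eps).trans (dualConst_eps (M := M) W))).symm.trans h1
      refine h2.trans ((fnOf_comp_map b
        (CommRingCat.ofHom (TrivSqZeroExt.fstHom k k k).toRingHom) _ _).trans ?_)
      have : (CommRingCat.ofHom (TrivSqZeroExt.fstHom k k k).toRingHom) DualNumber.eps = 0 := by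
        simp
      rw [this, map_zero]
    refine (Scheme.IdealSheafData.le_ofIdeals_iff).2 fun W => ?_
    rw [Scheme.Hom.ker_apply]
    intro c hc
    obtain ⟨d, rfl⟩ := M.exact W.1 c hc
    refine RingHom.mem_ker.2 (sections_ext fun z hz => ?_)
    obtain ⟨U, hzU, ⟨s⟩⟩ := hM (a z)
    refine ⟨a ⁻¹ᵁ (W.1 ⊓ U), a.preimage_mono inf_le_left, ⟨hz, hzU⟩, ?_⟩
    have h2 := rs_e_eq_mul s (inf_le_left : W.1 ⊓ U ≤ W.1) inf_le_right d
    have h3 : a.app (W.1 ⊓ U) (M.rs (inf_le_left : W.1 ⊓ U ≤ W.1) (M.e W.1 d)) = 0 := by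
      refine (congrArg _ h2).trans ((map_mul (a.app (W.1 ⊓ U)).hom _ _).trans ?_)
      exact (congrArg _ (heps _)).trans (mul_zero _)
    rw [map_zero]
    exact (res_app a (inf_le_left : W.1 ⊓ U ≤ W.1) (M.e W.1 d)).trans h3
  refine ⟨⟨hw⟩, ⟨Limits.PullbackCone.IsLimit.mk _
    (fun c => IsClosedImmersion.lift (schemeIncl hM) c.fst (hker c.fst c.snd c.condition))
    (fun c => IsClosedImmersion.lift_fac _ _ _) (fun c => ?_) fun c m h1 _ => ?_⟩⟩
  · rw [← cancel_mono (specFst k), Category.assoc, ← hw, IsClosedImmersion.lift_fac_assoc,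
      c.condition]
  · rw [← cancel_mono (schemeIncl hM), h1, IsClosedImmersion.lift_fac]

end SheafExt


/-! ### The deformation of a locally split extension, and its extension. -/

/-- `Spec k[ε]` is a single point. Centrality of the base functions thus has to be checked only for
global ones. -/
theorem eq_top_of_mem_spec_dualNumber {k : Type u} [Field k]
    {V : (Spec (.of (DualNumber k))).Opens} {p : Spec (.of (DualNumber k))} (hp : p ∈ V) :
    V = ⊤ := by
  have h : ∀ q, q = p := fun q => by
    obtain ⟨a, rfl⟩ := (specFst k).surjective q
    obtain ⟨b, rfl⟩ := (specFst k).surjective p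
    have : Subsingleton (Spec (.of k)) := inferInstanceAs (Subsingleton (PrimeSpectrum k))
    rw [Subsingleton.elim a b]
  refine eq_top_iff.2 fun q _ => ?_
  rw [h q]
  exact hp

namespace SheafExt

variable {k : Type u} [Field k] {X : Scheme.{u}} [X.Over (Spec (.of k))]
  {Λ : PoissonStructure (X ↘ Spec (.of k))} {M : SheafExt Λ}

theorem surjective_schemeProj [Nonempty X] (hM : M.LocSplit) : Surjective (schemeProj hM) := by
  constructor
  intro q
  obtain ⟨x⟩ := ‹Nonempty X›
  refine ⟨schemeIncl hM x, ?_⟩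
  by_contra hne
  obtain ⟨a, rfl⟩ := (specFst k).surjective q
  obtain ⟨b, hb⟩ := (specFst k).surjective (schemeProj hM (schemeIncl hM x))
  have : Subsingleton (Spec (.of k)) := inferInstanceAs (Subsingleton (PrimeSpectrum k))
  rw [← hb, Subsingleton.elim a b] at hne
  exact hne rfl

theorem bracket_dualConst (W : X.Opens) (c : DualNumber k) (a : M.sec W) :
    (M.bracket W).br (M.dualConst W c) a = 0 := by
  rw [dualConst_apply, PoissonBracket.add_left, M.bracket_const, M.br_e, algebraMap_br, map_zero,
    add_zero]

/-- The Poisson structure on the scheme of an extension. -/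
noncomputable def schemePoisson (hM : M.LocSplit) : PoissonStructure (schemeProj hM) where
  bracket W := M.bracket W
  res_br W V h a b := M.bracket_res W V h a b
  base_br V W h a b := by
    refine M.sec_local fun x hx => ?_
    -- A point of `W` maps into `V`, so `V` is everything; over an empty `V` there is no point to
    -- check.
    obtain rfl : V = ⊤ := eq_top_of_mem_spec_dualNumber (h hx)
    obtain ⟨c, rfl⟩ : ∃ c, (Scheme.ΓSpecIso (.of (DualNumber k))).inv c = a :=
      ⟨(Scheme.ΓSpecIso (.of (DualNumber k))).hom a,
        congrArg (fun f => f.hom a) (Scheme.ΓSpecIso (.of (DualNumber k))).hom_inv_id⟩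
    refine ⟨W, le_rfl, hx, congrArg _ ?_⟩
    refine (congrArg (fun y => (M.bracket W).br y b) (fnOf_schemeProj hM W c)).trans ?_
    exact bracket_dualConst (M := M) W c b

/-- The deformation of a locally split extension. -/
noncomputable def toDeformation [Nonempty X] (hM : M.LocSplit) : FirstOrderDeformation Λ where
  total := M.scheme hM
  proj := schemeProj hM
  incl := schemeIncl hM
  isPullback := isPullback_schemeIncl hM
  flat := flat_schemeProj hM
  surjective := surjective_schemeProj hM
  poisson := schemePoisson hM
  incl_poisson W a b := M.π_br W a b

/-- The two open sets have the same points, the inclusion of `X` being the identity on points.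
Restriction along this inequality compares `M` with the extension of its deformation. -/
theorem up_toDeformation [Nonempty X] (hM : M.LocSplit) (W : X.Opens) :
    (toDeformation hM).up W ≤ W := fun z hz => by
  have h : (toDeformation hM).inv z = z := (toDeformation hM).incl_inv z
  have h1 : (toDeformation hM).inv z ∈ W := hz
  rw [h] at h1
  exact h1

/-- The comparison map on sections. -/
noncomputable def toDeformationFun [Nonempty X] (hM : M.LocSplit) (W : X.Opens) :
    M.sec W →+* Γ((toDeformation hM).total, (toDeformation hM).up W) :=
  M.rs (up_toDeformation hM W)

theorem toX_toDeformationFun [Nonempty X] (hM : M.LocSplit) (W : X.Opens) (a : M.sec W) :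
    (toDeformation hM).toX W (toDeformationFun hM W a) = M.π W a := by
  have h1 : (toDeformation hM).incl.app ((toDeformation hM).up W) (toDeformationFun hM W a) =
      res X (up_toDeformation hM W) (M.π W a) := M.π_res W _ (up_toDeformation hM W) a
  rw [FirstOrderDeformation.toX_apply, h1]
  exact (res_res _ _ _).trans (res_self _ le_rfl _)

theorem res_toDeformationFun [Nonempty X] (hM : M.LocSplit) {W V : X.Opens} (h : V ≤ W)
    (a : M.sec W) : res (toDeformation hM).total ((toDeformation hM).up_mono h)
      (toDeformationFun hM W a) = toDeformationFun hM V (M.rs h a) :=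
  (M.rs_rs (up_toDeformation hM W) ((toDeformation hM).up_mono h) a).trans
    (M.rs_rs h (up_toDeformation hM V) a).symm

theorem toDeformationFun_dualConst [Nonempty X] (hM : M.LocSplit) (W : X.Opens)
    (c : DualNumber k) : toDeformationFun hM W (M.dualConst W c) =
      scalarOf (toDeformation hM).proj _ c :=
  (rs_dualConst (M := M) (up_toDeformation hM W) c).trans (fnOf_schemeProj hM _ c).symm

/-- Locally both sides are `ε` times the lift of `a` given by a splitting. -/
theorem toDeformationFun_e [Nonempty X] (hM : M.LocSplit) (W : X.Opens) (a : Γ(X, W)) :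
    toDeformationFun hM W (M.e W a) = (toDeformation hM).mulEps W a := by
  refine (toDeformation hM).ext.sec_local fun x hx => ?_
  obtain ⟨U, hxU, ⟨s⟩⟩ := hM x
  refine ⟨W ⊓ U, inf_le_left, ⟨hx, hxU⟩, ?_⟩
  have h1 := res_toDeformationFun hM (inf_le_left : W ⊓ U ≤ W) (M.e W a)
  have h2 := congrArg (toDeformationFun hM (W ⊓ U))
    (rs_e_eq_mul s (inf_le_left : W ⊓ U ≤ W) inf_le_right a)
  have h3 := toDeformationFun_dualConst hM (W ⊓ U) DualNumber.eps
  rw [dualConst_eps] at h3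
  rw [map_mul, h3, mul_comm] at h2
  have h4 := (toDeformation hM).mulEps_toX
    (toDeformationFun hM (W ⊓ U) (s.s _ inf_le_right (res X inf_le_left a)))
  rw [toX_toDeformationFun, s.π_s] at h4
  refine (h1.trans (h2.trans h4.symm)).trans ?_
  exact ((toDeformation hM).ext.e_res W (W ⊓ U) inf_le_left a).symm

theorem nonempty_hom_ext [Nonempty X] (hM : M.LocSplit) :
    Nonempty (M.Hom (toDeformation hM).ext) :=
  ⟨⟨toDeformationFun hM, fun _ _ h a => res_toDeformationFun hM h a, toX_toDeformationFun hM,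
    toDeformationFun_e hM, fun W c => by
      rw [← dualConst_algebraMap]
      exact toDeformationFun_dualConst hM W _,
    fun W a b => M.bracket_res W _ (up_toDeformation hM W) a b⟩⟩

end SheafExt


/-! ### Smooth schemes: local triviality of all deformations. -/

/-- The kernel of `q` has square zero, so formal smoothness lifts the identity of `A` to an
`R`-algebra section of `q`. -/
theorem exists_ringHom_section {R A B : Type u} [CommRing R] [CommRing A] [CommRing B]
    (a : R →+* A) (b : R →+* B) (q : B →+* A) (ha : a.Smooth) (hq : q.comp b = a)
    (hs : Function.Surjective q) (hn : ∀ x y, q x = 0 → q y = 0 → x * y = 0) :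
    ∃ s : A →+* B, q.comp s = RingHom.id A ∧ s.comp a = b := by
  algebraize [a, b]
  have : Algebra.FormallySmooth R A := Algebra.Smooth.formallySmooth
  let q' : B →ₐ[R] A := { q with commutes' := fun r => DFunLike.congr_fun hq r }
  have hI : IsNilpotent (RingHom.ker (q' : B →+* A)) :=
    ⟨2, by
      rw [pow_two]
      exact le_bot_iff.1 (Ideal.mul_le.2 fun x hx y hy => hn x y hx hy)⟩
  let s := Algebra.FormallySmooth.liftOfSurjective (AlgHom.id R A) q' hs hI
  exact ⟨s.toRingHom,
    RingHom.ext fun x => Algebra.FormallySmooth.liftOfSurjective_apply (AlgHom.id R A) q' hs hI x,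
    RingHom.ext fun r => s.commutes r⟩

theorem exists_hom_appTop_eq {Z X : Scheme.{u}} [IsAffine X] (s : Γ(X, ⊤) ⟶ Γ(Z, ⊤)) :
    ∃ r : Z ⟶ X, r.appTop = s := by
  refine ⟨Z.toSpecΓ ≫ Spec.map s ≫ X.isoSpec.inv, ?_⟩
  have h : X.isoSpec.inv.appTop ≫ (Scheme.ΓSpecIso Γ(X, ⊤)).hom = 𝟙 _ := by
    have := congrArg Scheme.Hom.appTop X.isoSpec.hom_inv_id
    rwa [Scheme.Hom.comp_appTop, Scheme.Hom.id_appTop, Scheme.isoSpec_hom,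
      Scheme.toSpecΓ_appTop] at this
  rw [Scheme.Hom.comp_appTop, Scheme.Hom.comp_appTop, Scheme.toSpecΓ_appTop, Category.assoc,
    Scheme.ΓSpecIso_naturality, ← Category.assoc, h, Category.id_comp]

variable {k : Type u} [Field k] {X Z : Scheme.{u}} {f : Z ⟶ Spec (.of (DualNumber k))}
  {i : X ⟶ Z} {g : X ⟶ Spec (.of k)}

/-- On affine schemes the functions on `Z` surject onto those on `X` with kernel the multiples of
`ε`. A section as algebras over the functions of `Spec k` is a retraction over `k`, which makes `Z`
a product. -/
theorem exists_retraction_of_smooth [IsAffine X] [IsAffine Z] [Smooth g] [Flat f]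
    (H : IsPullback i g f (specFst k)) :
    ∃ r : Z ⟶ X, IsPullback r f g (specDual k) ∧ i ≫ r = 𝟙 X := by
  have hw : i ≫ f ≫ specDual k = g := by
    rw [← Category.assoc, H.w, Category.assoc, specFst_specDual, Category.comp_id]
  have hsm : g.appTop.hom.Smooth := by
    have h := g.smooth_appLE (isAffineOpen_top _) (isAffineOpen_top X) le_top
    rwa [show g.appLE ⊤ ⊤ le_top = g.appTop from Scheme.Hom.appLE_eq_app _] at h
  obtain ⟨s, h1, h2⟩ := exists_ringHom_section g.appTop.hom (f ≫ specDual k).appTop.hom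
    i.appTop.hom hsm (by rw [← CommRingCat.hom_comp, ← Scheme.Hom.comp_appTop, hw])
    (fun b => exists_app_eq H (isAffineOpen_top Z) b) (fun x y hx hy => by
      obtain ⟨x', rfl⟩ := exists_eps_mul_of_app_eq_zero H (isAffineOpen_top Z) x hx
      obtain ⟨y', rfl⟩ := exists_eps_mul_of_app_eq_zero H (isAffineOpen_top Z) y hy
      rw [mul_mul_mul_comm, epsOf_mul_epsOf, zero_mul])
  obtain ⟨r, hr⟩ := exists_hom_appTop_eq (CommRingCat.ofHom s)
  have h3 : i ≫ r = 𝟙 X := by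
    apply ext_of_isAffine
    rw [Scheme.Hom.comp_appTop, hr, Scheme.Hom.id_appTop]
    exact CommRingCat.hom_ext h1
  refine ⟨r, isPullback_of_retraction H r h3 (ext_of_isAffine ?_), h3⟩
  rw [Scheme.Hom.comp_appTop, hr]
  exact CommRingCat.hom_ext h2

theorem FirstOrderDeformation.isLocallyTrivial_of_smooth [X.Over (Spec (.of k))]
    {Λ : PoissonStructure (X ↘ Spec (.of k))} (h : Smooth (X ↘ Spec (.of k)))
    (ξ : FirstOrderDeformation Λ) : ξ.IsLocallyTrivial := fun x => by
  obtain ⟨V, hV, -, hx⟩ := exists_affine_le (U := (⊤ : ξ.total.Opens)) (p := ξ.incl x) trivial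
  have := isClosedImmersion_of_isPullback ξ.isPullback
  have := ξ.flat
  have h1 : IsAffine V.toScheme := hV
  have h2 : IsAffine (ξ.incl ⁻¹ᵁ V).toScheme := hV.preimage ξ.incl
  have h3 : Flat (V.ι ≫ ξ.proj) := inferInstance
  have h4 : Smooth ((ξ.incl ⁻¹ᵁ V).ι ≫ X ↘ Spec (.of k)) := inferInstance
  obtain ⟨r, hr⟩ := exists_retraction_of_smooth (ξ.isPullback_restrict V)
  exact ⟨V, hx, r, hr⟩


/-! ### The Kodaira–Spencer map and its bijectivity. -/

namespace FirstOrderDeformation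

variable {k : Type u} [Field k] {X : Scheme.{u}} [X.Over (Spec (.of k))]
  {Λ : PoissonStructure (X ↘ Spec (.of k))} {ξ η : FirstOrderDeformation Λ}

theorem IsLocallyTrivial.exists_isMarked (h : ξ.IsLocallyTrivial) : ∃ c, ξ.ext.IsMarked c :=
  (isLocallyTrivial_iff.1 h).exists_isMarked

/-- The Kodaira-Spencer class of a locally trivial deformation. -/
noncomputable def IsLocallyTrivial.kodairaSpencer (h : ξ.IsLocallyTrivial) : HP k Λ 2 :=
  h.exists_isMarked.choose

theorem IsLocallyTrivial.isMarked (h : ξ.IsLocallyTrivial) : ξ.ext.IsMarked h.kodairaSpencer :=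
  h.exists_isMarked.choose_spec

theorem kodairaSpencer_eq_iff (hξ : ξ.IsLocallyTrivial) (hη : η.IsLocallyTrivial) :
    hξ.kodairaSpencer = hη.kodairaSpencer ↔ ξ.Equivalent η := by
  rw [equivalent_iff]
  constructor
  · intro h
    have h1 := hξ.isMarked
    rw [h] at h1
    exact hη.isMarked.nonempty_hom h1
  · rintro ⟨Φ⟩
    exact hξ.isMarked.unique (hη.isMarked.map Φ)

theorem kodairaSpencer_eq_zero_iff (h : ξ.IsLocallyTrivial) :
    h.kodairaSpencer = 0 ↔ ξ.IsTrivial := by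
  rw [← isMarked_zero_iff]
  exact ⟨fun h0 => h0 ▸ h.isMarked, fun h0 => h.isMarked.unique h0⟩

/-- The extension realising `c` maps to the extension of its own deformation, and a marking is
transported along this morphism. -/
theorem exists_kodairaSpencer_eq [Nonempty X] (c : HP k Λ 2) :
    ∃ (ξ : FirstOrderDeformation Λ) (h : ξ.IsLocallyTrivial), h.kodairaSpencer = c := by
  obtain ⟨M, hM⟩ := SheafExt.exists_isMarked c
  obtain ⟨Φ⟩ := SheafExt.nonempty_hom_ext hM.locSplit
  have h := hM.map Φ
  have hl := isLocallyTrivial_iff.2 h.locSplit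
  exact ⟨_, hl, hl.isMarked.unique h⟩

/-- The Kodaira-Spencer map on classes of locally trivial deformations. -/
noncomputable def kodairaSpencerEquiv [Nonempty X] : LocallyTrivialClasses Λ ≃ HP k Λ 2 :=
  Equiv.ofBijective
    (Quotient.lift (fun ξ : LocallyTrivial Λ => ξ.2.kodairaSpencer)
      fun ξ η h => (kodairaSpencer_eq_iff ξ.2 η.2).2 h)
    ⟨by
      rintro ⟨ξ⟩ ⟨η⟩ h
      exact Quotient.sound ((kodairaSpencer_eq_iff ξ.2 η.2).1 h), fun c => by
      obtain ⟨ξ, h, rfl⟩ := exists_kodairaSpencer_eq c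
      exact ⟨LocallyTrivial.toClass ⟨ξ, h⟩, rfl⟩⟩

/-- The Kodaira-Spencer map when all deformations are locally trivial. -/
noncomputable def kodairaSpencerEquivOfForall [Nonempty X]
    (hl : ∀ ξ : FirstOrderDeformation Λ, ξ.IsLocallyTrivial) : Classes Λ ≃ HP k Λ 2 :=
  Equiv.ofBijective
    (Quotient.lift (fun ξ : FirstOrderDeformation Λ => (hl ξ).kodairaSpencer)
      fun ξ η h => (kodairaSpencer_eq_iff (hl ξ) (hl η)).2 h)
    ⟨by
      rintro ⟨ξ⟩ ⟨η⟩ h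
      exact Quotient.sound ((kodairaSpencer_eq_iff (hl ξ) (hl η)).1 h), fun c => by
      obtain ⟨ξ, h, rfl⟩ := exists_kodairaSpencer_eq c
      exact ⟨ξ.toClass, rfl⟩⟩

end FirstOrderDeformation

end PoissonDeformation

theorem mainTheorem6 (k : Type u) [Field k] [IsAlgClosed k]
    (X : Scheme.{u}) [X.Over (Spec (.of k))] [Nonempty X]
    [IsSeparated (X ↘ Spec (.of k))] [LocallyOfFiniteType (X ↘ Spec (.of k))]
    [QuasiCompact (X ↘ Spec (.of k))]
    (Λ₀ : PoissonDeformation.PoissonStructure (X ↘ Spec (.of k))) :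
    ∃ κ : PoissonDeformation.FirstOrderDeformation.LocallyTrivialClasses Λ₀ ≃
        PoissonDeformation.HP k Λ₀ 2,
      (∀ ξ : PoissonDeformation.FirstOrderDeformation.LocallyTrivial Λ₀,
        κ ξ.toClass = 0 ↔ ξ.1.IsTrivial) ∧
      (∀ ξ : PoissonDeformation.FirstOrderDeformation.LocallyTrivial Λ₀,
        Nonempty ξ.1.KodairaSpencerDatum ∧
          ∀ D : ξ.1.KodairaSpencerDatum, D.Represents (κ ξ.toClass)) ∧
      (Smooth (X ↘ Spec (.of k)) →
        ∃ κ' : PoissonDeformation.FirstOrderDeformation.Classes Λ₀ ≃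
            PoissonDeformation.HP k Λ₀ 2,
          (∀ ξ : PoissonDeformation.FirstOrderDeformation.LocallyTrivial Λ₀,
            κ' ξ.1.toClass = κ ξ.toClass) ∧
          ∀ ξ : PoissonDeformation.FirstOrderDeformation Λ₀,
            κ' ξ.toClass = 0 ↔ ξ.IsTrivial) := by
  open PoissonDeformation FirstOrderDeformation in
  refine ⟨kodairaSpencerEquiv, fun ξ => kodairaSpencer_eq_zero_iff ξ.2,
    fun ξ => ⟨nonempty_datum (isLocallyTrivial_iff.1 ξ.2), fun D => D.represents ξ.2.isMarked⟩,
    -- Both maps send `ξ` to the class chosen from a proof of local triviality, and proofs are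
    -- irrelevant, so they agree by `rfl`.
    fun h => ⟨kodairaSpencerEquivOfForall (isLocallyTrivial_of_smooth h), fun ξ => rfl,
      fun ξ => kodairaSpencer_eq_zero_iff (isLocallyTrivial_of_smooth h ξ)⟩⟩
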